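/- Let $X=\{X(s):s\in[0,1]\}$ be, under $P=P_{(\sigma_0^2,\alpha_0)}$ with $\sigma_0^2,\alpha_0>0$, a mean zero Gaussian process with covariance $\mathrm{Cov}(X(s),X(t))=\sigma_0^2e^{-\alpha_0|s-t|}$ (the Ornstein–Uhlenbeck process, i.e. Matérn smoothness $\nu=1/2$ in dimension $d=1$), observed at $s_i=i/n$, $i=1,\dots,n$; put $X_n=(X(s_1),\dots,X(s_n))^\top$, $\theta_0=\sigma_0^2\alpha_0$ and $\mathbb R_+=(0,\infty)$. Let $R_\alpha=(e^{-\alpha|s_i-s_j|})_{i,j}$ and $$\mathcal L_n(\sigma^2,\alpha)=-\tfrac n2\log\sigma^2-\tfrac12\log|R_\alpha|-\tfrac1{2\sigma^2}X_n^\top R_\alpha^{-1}X_n,\qquad \widetilde\theta_\alpha=\tfrac{\alpha}{n}X_n^\top R_\alpha^{-1}X_n,$$ $$\widetilde{\mathcal L}_n(\alpha)=-\tfrac n2\log\tfrac{X_n^\top R_\alpha^{-1}X_n}{n}-\tfrac12\log|R_\alpha|.$$ Let $\underline\alpha_n=n^{-\underline\kappa}$ and $\overline\alpha_n=n^{\overline\kappa}$,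 where, with $\nu=1/2$ and $d=1$, $$\underline\kappa=\tfrac12\min\Big\{\tfrac{3.9-d}{(d+3.94)(8\nu+4d-3.9)},\tfrac1{4(3\nu+d)},0.1\Big\}=0.05,\qquad \overline\kappa=\tfrac12\min\Big\{\tfrac{3.9-d}{(d+3.94)(8\nu+4d+3.9)},\tfrac1{2(2\nu+d+2)},0.04\Big\}=0.02 .$$ Let the prior of $(\theta,\alpha)\in\mathbb R_+^2$ have density $\pi(\theta|\alpha)\pi(\alpha)$, not depending on $n$, such that: (A.1) for every $\alpha>0$, $\pi(\cdot|\alpha)$ is a probability density on $\mathbb R_+$, continuously differentiable in $\theta$; $\pi(\theta|\alpha)$ is continuous in $\alpha$ for every $\theta>0$; and $\pi(\theta_0|\alpha)>0$ for all $\alpha>0$. (A.2) There are constants $C_1,C_2,C_3>0$ with $C_1+C_2<1/2$ and $C_3<1$ such that for all large $n$, $$\sup_{\alpha\in[\underline\alpha_n,\overline\alpha_n]}\sup_{\theta\in(\theta_0/2,2\theta_0)}\Big|\frac{\partial\log\pi(\theta|\alpha)}{\partial\theta}\Big|\le n^{C_1},\quad \sup_{\alpha\in[\underline\alpha_n,\overline\alpha_n]}\sup_{\theta\in(\theta_0/2,2\theta_0)}\frac{\pi(\theta|\alpha)}{\pi(\theta_0|\alpha)}\le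 n^{C_2},\quad \inf_{\alpha\in[\underline\alpha_n,\overline\alpha_n]}\log\pi(\theta_0|\alpha)\ge-n^{C_3}.$$ (A.3') $\pi(\alpha)$ is a continuous probability density on $\mathbb R_+$ with $\pi(\alpha_0)>0$; the integrals $\int_0^\infty\pi(\theta_0|\alpha)\pi(\alpha)d\alpha$, $\int_0^\infty\sqrt\alpha\,\pi(\theta_0|\alpha)\pi(\alpha)d\alpha$ and $\int_0^\infty\sqrt\alpha\,\pi(\alpha)d\alpha$ are finite; and $\sqrt n\int_0^{\underline\alpha_n}\sqrt\alpha\,\pi(\alpha)d\alpha\to0$, $\sqrt n\int_{\overline\alpha_n}^\infty\sqrt\alpha\,\pi(\alpha)d\alpha\to0$. Let $\pi(\alpha|\theta_0)=\pi(\theta_0|\alpha)\pi(\alpha)/\int_0^\infty\pi(\theta_0|\alpha')\pi(\alpha')d\alpha'$ and, for $n\ge3$, $$A_1=\sum_{i=2}^{n-1}X(s_i)^2,\quad A_2=\sum_{i=1}^{n-1}X(s_i)X(s_{i+1}),\quad A_3=\sum_{i=1}^nX(s_i)^2,\quad u_*=\frac{n(A_1-A_2)}{A_1},\quad v_*=\frac{n(A_1-2A_2+A_3)}{A_1}.$$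 Let $\Pi(d\theta,d\alpha|X_n)$ be the posterior on $\mathbb R_+^2$ with density proportional to $e^{\mathcal L_n(\theta/\alpha,\alpha)}\pi(\theta|\alpha)\pi(\alpha)$, let $\widetilde\Pi(d\alpha|X_n)$ be the profile posterior on $\mathbb R_+$ with density proportional to $e^{\widetilde{\mathcal L}_n(\alpha)}\pi(\alpha|\theta_0)$, and let $\Pi_*(d\alpha|X_n)$ be the distribution on $\mathbb R_+$ with density proportional to $\sqrt\alpha\exp\{-(\alpha-u_*)^2/(2v_*)\}\,\pi(\alpha|\theta_0)$. Then, $P$-almost surely, these three are well-defined probability measures for all $n\ge3$, and, with $\|P_1-P_2\|_{TV}=\sup_A|P_1(A)-P_2(A)|$, $$\big\|\Pi(d\theta,d\alpha|X_n)-\mathcal N(d\theta|\widetilde\theta_{\alpha_0},2\theta_0^2/n)\times\widetilde\Pi(d\alpha|X_n)\big\|_{TV}\to0,$$ $$\big\|\Pi(d\theta,d\alpha|X_n)-\mathcal N(d\theta|\widetilde\theta_{\alpha_0},2\theta_0^2/n)\times\Pi_*(d\alpha|X_n)\big\|_{TV}\to0$$ in $P$-probability as $n\to\infty$. Furthermore,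 $P$-almost surely, $v_*>0$ for all $n\ge3$ and $v_*$ is bounded above and bounded away from zero as $n\to\infty$. Finally, the marginal posterior of $\alpha$ does not converge to any degenerate distribution: there is no (deterministic or random) point $a\in\mathbb R$ such that $\Pi(d\alpha|X_n)$ converges weakly to $\delta_a$ in $P$-probability. -/

import Mathlib

open MeasureTheory ProbabilityTheory Filter Set
open scoped Topology Matrix BoundedContinuousFunction

noncomputable section

namespace OUBvM

/-! ### Total variation, normalization, weak convergence in probability -/

/-- The total variation distance `sup_A |μ(A) - ν(A)|` over measurable sets `A`
(meant for finite measures). -/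
def tvDist {E : Type*} [MeasurableSpace E] (μ ν : Measure E) : ℝ :=
  ⨆ A : {A : Set E // MeasurableSet A}, |μ.real A - ν.real A|

/-- The measure `μ` divided by its total mass; it is a probability measure exactly when the
total mass is neither `0` nor `∞` (otherwise it is the zero measure). -/
def normalized {E : Type*} [MeasurableSpace E] (μ : Measure E) : Measure E :=
  (μ univ)⁻¹ • μ

/-- The random measures `μ n` on `ℝ` converge weakly to the random measure `ν`, in
`P`-probability: the integrals of every bounded continuous function converge in probability. -/
def TendstoWeaklyInProb {Ω : Type*} [MeasurableSpace Ω] (P : Measure Ω)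
    (μ : ℕ → Ω → Measure ℝ) (ν : Ω → Measure ℝ) : Prop :=
  ∀ f : ℝ →ᵇ ℝ,
    TendstoInMeasure P (fun n ω => ∫ a, f a ∂(μ n ω)) atTop (fun ω => ∫ a, f a ∂(ν ω))

/-! ### The Ornstein-Uhlenbeck process and its observations -/

/-- `X` restricted to the times in `[0,1]` is, under `P`, a mean zero Gaussian process with
covariance function `σ2 * exp (-α |s - t|)`. -/
structure IsOUProcess {Ω : Type*} [MeasurableSpace Ω] (X : ℝ → Ω → ℝ) (P : Measure Ω)
    (σ2 α : ℝ) : Prop where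
  gaussian : IsGaussianProcess (fun t : Icc (0 : ℝ) 1 => X t) P
  mean_zero : ∀ t ∈ Icc (0 : ℝ) 1, ∫ ω, X t ω ∂P = 0
  covariance : ∀ s ∈ Icc (0 : ℝ) 1, ∀ t ∈ Icc (0 : ℝ) 1,
    cov[X s, X t; P] = σ2 * Real.exp (-α * |s - t|)

/-- The data: `obs X n ω i = X (i / n)`; only `i = 1, …, n` are used. -/
def obs {Ω : Type*} (X : ℝ → Ω → ℝ) (n : ℕ) (ω : Ω) : ℕ → ℝ :=
  fun i => X ((i : ℝ) / n) ω

/-- The data `x 1, …, x n` as a vector. -/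
def obsVec (n : ℕ) (x : ℕ → ℝ) : Fin n → ℝ := fun i => x (i + 1)

/-- The correlation matrix `R_α` of the observations on the grid `s_i = i / n`. -/
def corrMatrix (n : ℕ) (α : ℝ) : Matrix (Fin n) (Fin n) ℝ :=
  Matrix.of fun i j =>
    Real.exp (-α * |(((i : ℕ) + 1 : ℝ) / n) - (((j : ℕ) + 1 : ℝ) / n)|)

/-- The quadratic form `X_nᵀ R_α⁻¹ X_n`. -/
def quadForm (n : ℕ) (x : ℕ → ℝ) (α : ℝ) : ℝ :=
  obsVec n x ⬝ᵥ ((corrMatrix n α)⁻¹ *ᵥ obsVec n x)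

/-- The log-likelihood, up to an additive constant, in the parameters `(σ², α)`. -/
def logLik (n : ℕ) (x : ℕ → ℝ) (σ2 α : ℝ) : ℝ :=
  -(n / 2 : ℝ) * Real.log σ2 - 1 / 2 * Real.log (corrMatrix n α).det
    - 1 / (2 * σ2) * quadForm n x α

/-- The maximizer `(α / n) X_nᵀ R_α⁻¹ X_n` of the likelihood over the microergodic
parameter `θ = σ² α`, for given `α`. -/
def thetaTilde (n : ℕ) (x : ℕ → ℝ) (α : ℝ) : ℝ :=
  α / n * quadForm n x α

/-- The profile log-likelihood of `α`, up to an additive constant. -/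
def profileLogLik (n : ℕ) (x : ℕ → ℝ) (α : ℝ) : ℝ :=
  -(n / 2 : ℝ) * Real.log (quadForm n x α / n) - 1 / 2 * Real.log (corrMatrix n α).det

/-- `A₁ = ∑_{i=2}^{n-1} X(s_i)²`. -/
def A₁ (n : ℕ) (x : ℕ → ℝ) : ℝ := ∑ i ∈ Finset.Icc 2 (n - 1), x i ^ 2

/-- `A₂ = ∑_{i=1}^{n-1} X(s_i) X(s_{i+1})`. -/
def A₂ (n : ℕ) (x : ℕ → ℝ) : ℝ := ∑ i ∈ Finset.Icc 1 (n - 1), x i * x (i + 1)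

/-- `A₃ = ∑_{i=1}^{n} X(s_i)²`. -/
def A₃ (n : ℕ) (x : ℕ → ℝ) : ℝ := ∑ i ∈ Finset.Icc 1 n, x i ^ 2

/-- The center `u_*`. -/
def uStar (n : ℕ) (x : ℕ → ℝ) : ℝ := n * (A₁ n x - A₂ n x) / A₁ n x

/-- The squared scale `v_*`. -/
def vStar (n : ℕ) (x : ℕ → ℝ) : ℝ := n * (A₁ n x - 2 * A₂ n x + A₃ n x) / A₁ n x

/-! ### Assumptions on the prior

The prior is given by the conditional density `πc θ α = π(θ | α)` and the marginal density
`πm α = π(α)`; only their values at positive arguments matter. -/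

/-- The exponent of the lower end of the expanding interval, for smoothness `ν` and
dimension `d`. -/
def kappaLow (ν d : ℝ) : ℝ :=
  1 / 2 * min (min ((3.9 - d) / ((d + 3.94) * (8 * ν + 4 * d - 3.9))) (1 / (4 * (3 * ν + d)))) 0.1

/-- The exponent of the upper end of the expanding interval, for smoothness `ν` and
dimension `d`. -/
def kappaUp (ν d : ℝ) : ℝ :=
  1 / 2 * min (min ((3.9 - d) / ((d + 3.94) * (8 * ν + 4 * d + 3.9)))
    (1 / (2 * (2 * ν + d + 2)))) 0.04

/-- The lower end of the slowly expanding interval, for `ν = 1/2` and `d = 1`. -/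
def alphaLow (n : ℕ) : ℝ := (n : ℝ) ^ (-kappaLow (1 / 2) 1)

/-- The upper end of the slowly expanding interval, for `ν = 1/2` and `d = 1`. -/
def alphaUp (n : ℕ) : ℝ := (n : ℝ) ^ kappaUp (1 / 2) 1

/-- Regularity of the conditional prior: `π(· | α)` is a proper density on `(0,∞)`, `C¹` in `θ`,
continuous in `α`, and positive at `θ₀`. -/
structure RegularCondPrior (θ₀ : ℝ) (πc : ℝ → ℝ → ℝ) : Prop where
  nonneg : ∀ θ > 0, ∀ α > 0, 0 ≤ πc θ α
  integral_eq_one : ∀ α > 0, ∫ θ in Ioi (0 : ℝ), πc θ α = 1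
  contDiffOn : ∀ α > 0, ContDiffOn ℝ 1 (fun θ => πc θ α) (Ioi 0)
  continuousOn : ∀ θ > 0, ContinuousOn (fun α => πc θ α) (Ioi 0)
  pos : ∀ α > 0, 0 < πc θ₀ α

/-- Control of the conditional prior near `θ₀`, uniformly over the expanding interval. -/
def CondPriorGrowth (θ₀ : ℝ) (πc : ℝ → ℝ → ℝ) : Prop :=
  ∃ C₁ C₂ C₃ : ℝ, 0 < C₁ ∧ 0 < C₂ ∧ 0 < C₃ ∧ C₁ + C₂ < 1 / 2 ∧ C₃ < 1 ∧
    ∀ᶠ n : ℕ in atTop, ∀ α ∈ Icc (alphaLow n) (alphaUp n),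
      (∀ θ ∈ Ioo (θ₀ / 2) (2 * θ₀),
        |deriv (fun t => Real.log (πc t α)) θ| ≤ (n : ℝ) ^ C₁ ∧
        πc θ α / πc θ₀ α ≤ (n : ℝ) ^ C₂) ∧
      -(n : ℝ) ^ C₃ ≤ Real.log (πc θ₀ α)

/-- Regularity and tail conditions on the marginal prior of `α`. -/
structure MarginalPriorTails (θ₀ α₀ : ℝ) (πc : ℝ → ℝ → ℝ) (πm : ℝ → ℝ) : Prop where
  nonneg : ∀ α > 0, 0 ≤ πm α
  integral_eq_one : ∫ α in Ioi (0 : ℝ), πm α = 1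
  continuousOn : ContinuousOn πm (Ioi 0)
  pos : 0 < πm α₀
  integrable_joint : IntegrableOn (fun α => πc θ₀ α * πm α) (Ioi 0)
  integrable_sqrt_joint : IntegrableOn (fun α => √α * πc θ₀ α * πm α) (Ioi 0)
  integrable_sqrt : IntegrableOn (fun α => √α * πm α) (Ioi 0)
  left_tail : Tendsto (fun n : ℕ => √(n : ℝ) * ∫ α in Ioo 0 (alphaLow n), √α * πm α)
    atTop (𝓝 0)
  right_tail : Tendsto (fun n : ℕ => √(n : ℝ) * ∫ α in Ioi (alphaUp n), √α * πm α)
    atTop (𝓝 0)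

/-! ### The posterior and its approximations -/

/-- The conditional prior density `π(α | θ₀)`. -/
def priorGivenTheta (θ₀ : ℝ) (πc : ℝ → ℝ → ℝ) (πm : ℝ → ℝ) (α : ℝ) : ℝ :=
  πc θ₀ α * πm α / ∫ α' in Ioi (0 : ℝ), πc θ₀ α' * πm α'

/-- The joint posterior distribution of `(θ, α)` on `(0,∞)²`, with density proportional to
`exp (logLik (θ / α, α)) π(θ | α) π(α)`. -/
def posterior (πc : ℝ → ℝ → ℝ) (πm : ℝ → ℝ) (n : ℕ) (x : ℕ → ℝ) : Measure (ℝ × ℝ) :=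
  normalized ((volume.restrict (Ioi (0 : ℝ) ×ˢ Ioi (0 : ℝ))).withDensity fun p =>
    ENNReal.ofReal (Real.exp (logLik n x (p.1 / p.2) p.2) * πc p.1 p.2 * πm p.2))

/-- The profile posterior distribution of `α` on `(0,∞)`, with density proportional to
`exp (profileLogLik α) π(α | θ₀)`. -/
def profilePosterior (θ₀ : ℝ) (πc : ℝ → ℝ → ℝ) (πm : ℝ → ℝ) (n : ℕ) (x : ℕ → ℝ) : Measure ℝ :=
  normalized ((volume.restrict (Ioi (0 : ℝ))).withDensity fun α =>
    ENNReal.ofReal (Real.exp (profileLogLik n x α) * priorGivenTheta θ₀ πc πm α))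

/-- The distribution of `α` on `(0,∞)` with density proportional to
`√α exp (-(α - u_*)² / (2 v_*)) π(α | θ₀)`. -/
def tiltedNormalPosterior (θ₀ : ℝ) (πc : ℝ → ℝ → ℝ) (πm : ℝ → ℝ) (n : ℕ) (x : ℕ → ℝ) :
    Measure ℝ :=
  normalized ((volume.restrict (Ioi (0 : ℝ))).withDensity fun α =>
    ENNReal.ofReal (√α * Real.exp (-(α - uStar n x) ^ 2 / (2 * vStar n x))
      * priorGivenTheta θ₀ πc πm α))

/-- The normal distribution of `θ` with mean `thetaTilde` at `α₀` and variance `2 θ₀² / n`. -/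
def thetaLimit (θ₀ α₀ : ℝ) (n : ℕ) (x : ℕ → ℝ) : Measure ℝ :=
  gaussianReal (thetaTilde n x α₀) (2 * θ₀ ^ 2 / n).toNNReal

end OUBvM

end

namespace OUBvM

/-! ### Elementary inequalities -/

theorem one_sub_exp_neg_le (x : ℝ) : 1 - Real.exp (-x) ≤ x := by
  linarith [Real.add_one_le_exp (-x)]

theorem one_sub_exp_neg_nonneg {x : ℝ} (hx : 0 ≤ x) : 0 ≤ 1 - Real.exp (-x) := by
  have : Real.exp (-x) ≤ 1 := Real.exp_le_one_iff.2 (by linarith)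
  linarith

theorem one_sub_exp_neg_le_one (x : ℝ) : 1 - Real.exp (-x) ≤ 1 := by
  linarith [Real.exp_pos (-x)]

theorem one_sub_exp_neg_pos {x : ℝ} (hx : 0 < x) : 0 < 1 - Real.exp (-x) := by
  have : Real.exp (-x) < 1 := by rw [Real.exp_lt_one_iff]; linarith
  linarith

theorem exp_neg_mul_one_add_le {x : ℝ} : Real.exp (-x) * (1 + x) ≤ 1 := by
  have h1 : Real.exp (-x) * Real.exp x = 1 := by rw [← Real.exp_add]; simp
  have h2 := Real.add_one_le_exp x
  have h3 := Real.exp_pos (-x)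
  nlinarith

theorem sub_sq_div_le_one_sub_exp_neg {x : ℝ} (hx : 0 ≤ x) :
    x - x ^ 2 ≤ 1 - Real.exp (-x) := by
  have h1 : Real.exp (-x) * Real.exp x = 1 := by rw [← Real.exp_add]; simp
  have h2 := Real.add_one_le_exp x
  have h3 := Real.exp_pos (-x)
  have : Real.exp (-x) * (1 + x) ≤ 1 := by nlinarith
  have h4 : Real.exp (-x) ≤ 1 - x + x ^ 2 := by
    by_contra! h
    nlinarith [mul_pos (sub_pos.2 h) (show (0:ℝ) < 1 + x by linarith), pow_nonneg hx 3]
  linarith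

/-- `q - 1 - log q` is bounded below by a squared difference. -/
theorem sq_sqrt_sub_one_le {q : ℝ} (hq : 0 < q) : (√q - 1) ^ 2 ≤ q - 1 - Real.log q := by
  have h1 : Real.log q = 2 * Real.log √q := by
    rw [Real.log_sqrt hq.le]; ring
  have h2 := Real.log_le_sub_one_of_pos (Real.sqrt_pos.2 hq)
  have h3 := Real.sq_sqrt hq.le
  nlinarith

theorem abs_log_one_add_sub_le {z : ℝ} (hz : |z| ≤ 1 / 2) : |Real.log (1 + z) - z| ≤ 2 * z ^ 2 := by
  have h := Real.abs_log_sub_add_sum_range_le (x := -z) (by rw [abs_neg]; linarith) 1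
  simp at h
  have h2 : |z| ^ 2 / (1 - |z|) ≤ 2 * z ^ 2 := by
    rw [div_le_iff₀ (by linarith), sq_abs]
    nlinarith [sq_nonneg z]
  rw [sq_abs] at h2
  have h3 : Real.log (1 + z) - z = -z + Real.log (1 + z) := by ring
  rw [h3]
  linarith

theorem abs_log_one_add_sub_add_le {z : ℝ} (hz : |z| ≤ 1 / 2) :
    |z - z ^ 2 / 2 - Real.log (1 + z)| ≤ 2 * |z| ^ 3 := by
  have h := Real.abs_log_sub_add_sum_range_le (x := -z) (by rw [abs_neg]; linarith) 2
  simp [Finset.sum_range_succ] at h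
  have h2 : |z| ^ 3 / (1 - |z|) ≤ 2 * |z| ^ 3 := by
    rw [div_le_iff₀ (by linarith)]
    nlinarith [pow_nonneg (abs_nonneg z) 3]
  rw [abs_sub_comm]
  have h3 : Real.log (1 + z) - (z - z ^ 2 / 2) = -z + z ^ 2 / (1 + 1) + Real.log (1 + z) := by
    ring
  rw [h3]
  norm_num at h h2 ⊢
  linarith

/-! ### The normalized profile likelihood of the range parameter and its limit -/

/-- The innovation sum of squares at lag correlation `1 - δ`, relative to its value at `δ = 0`. -/
noncomputable def innovRatio (n b w δ : ℝ) : ℝ := 1 - (1 - b) * δ + n * w * δ ^ 2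

/-- The normalized profile likelihood of `α`. -/
noncomputable def profileFun (n b w α : ℝ) : ℝ :=
  √n * √(1 - Real.exp (-(2 * (α / n)))) *
    Real.exp (-(n / 2) * Real.log (innovRatio n b w (1 - Real.exp (-(α / n)))))

/-- The pointwise limit of the normalized profile likelihood. -/
noncomputable def tiltFun (b w α : ℝ) : ℝ :=
  √(2 * α) * Real.exp ((1 - b) * α / 2 - w * α ^ 2 / 2)

theorem profileFun_nonneg (n b w α : ℝ) : 0 ≤ profileFun n b w α := by
  unfold profileFun; positivity

theorem tiltFun_nonneg (b w α : ℝ) : 0 ≤ tiltFun b w α := by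
  unfold tiltFun; positivity

theorem measurable_profileFun (n b w : ℝ) : Measurable (profileFun n b w) := by
  unfold profileFun innovRatio; fun_prop

theorem measurable_tiltFun (b w : ℝ) : Measurable (tiltFun b w) := by
  unfold tiltFun; fun_prop

theorem innovRatio_ge {n b w w0 δ : ℝ} (hn : 0 < n) (hb : 0 ≤ b) (hw0 : 0 < w0) (hw : w0 ≤ w)
    (hδ : 0 ≤ δ) : 1 - 1 / (4 * n * w0) ≤ innovRatio n b w δ := by
  unfold innovRatio
  have h1 : 1 - δ + n * w0 * δ ^ 2 ≤ 1 - (1 - b) * δ + n * w * δ ^ 2 := by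
    have := mul_nonneg hb hδ
    have := mul_nonneg (mul_nonneg hn.le (sub_nonneg.2 hw)) (sq_nonneg δ)
    nlinarith
  refine le_trans ?_ h1
  have h2 : 1 - δ + n * w0 * δ ^ 2 - (1 - 1 / (4 * n * w0))
      = n * w0 * (δ - 1 / (2 * n * w0)) ^ 2 := by
    field_simp; ring
  have h3 : 0 ≤ n * w0 * (δ - 1 / (2 * n * w0)) ^ 2 := by positivity
  linarith

theorem sqrt_mul_sqrt_one_sub_exp_le {n α : ℝ} (hn : 0 < n) :
    √n * √(1 - Real.exp (-(2 * (α / n)))) ≤ √(2 * α) := by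
  rw [← Real.sqrt_mul hn.le]
  apply Real.sqrt_le_sqrt
  have := one_sub_exp_neg_le (2 * (α / n))
  calc n * (1 - Real.exp (-(2 * (α / n)))) ≤ n * (2 * (α / n)) := by gcongr
    _ = 2 * α := by field_simp

theorem profileFun_le {n b w w0 α : ℝ} (hb : 0 ≤ b) (hw0 : 0 < w0) (hw : w0 ≤ w)
    (hn : 1 / w0 ≤ n) (hα : 0 < α) :
    profileFun n b w α ≤ Real.exp (1 / (4 * w0)) * √(2 * α) := by
  have hn0 : 0 < n := lt_of_lt_of_le (by positivity) hn
  have hr := innovRatio_ge hn0 hb hw0 hw (one_sub_exp_neg_nonneg (x := α / n) (by positivity))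
  set r := innovRatio n b w (1 - Real.exp (-(α / n)))
  have hnw : 1 ≤ n * w0 := by rwa [div_le_iff₀ hw0] at hn
  have hy : 1 / (4 * n * w0) ≤ 1 / 4 := by
    rw [div_le_div_iff₀ (by positivity) (by norm_num)]; nlinarith
  set y := 1 / (4 * n * w0) with hydef
  have hy0 : 0 < y := by positivity
  have h1y : 0 < 1 - y := by linarith
  have hlog : -(2 * y) ≤ Real.log r := by
    have h1 := Real.one_sub_inv_le_log_of_pos h1y
    have h2 := Real.log_le_log h1y hr
    have h3 : (1 - y)⁻¹ ≤ 1 + 2 * y := by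
      rw [inv_le_iff_one_le_mul₀ h1y]; nlinarith
    linarith
  unfold profileFun
  rw [mul_comm (Real.exp (1 / (4 * w0)))]
  refine mul_le_mul (sqrt_mul_sqrt_one_sub_exp_le hn0) ?_ (Real.exp_pos _).le (Real.sqrt_nonneg _)
  apply Real.exp_le_exp.2
  have : n * y = 1 / (4 * w0) := by rw [hydef]; field_simp
  nlinarith

theorem abs_mul_one_sub_exp_neg_sub_le {n α : ℝ} (hn : 0 < n) (hα : 0 ≤ α) :
    |n * (1 - Real.exp (-(α / n))) - α| ≤ α ^ 2 / n := by
  have h1 := one_sub_exp_neg_le (α / n)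
  have h2 := sub_sq_div_le_one_sub_exp_neg (x := α / n) (by positivity)
  have e1 : n * (α / n) = α := by field_simp
  have e2 : n * (α / n) ^ 2 = α ^ 2 / n := by field_simp
  rw [abs_le]
  constructor <;> nlinarith

theorem tendsto_mul_one_sub_exp_neg {ι : Type*} {l : Filter ι} {n : ι → ℝ}
    (hn : Tendsto n l atTop) {α : ℝ} (hα : 0 ≤ α) :
    Tendsto (fun i => n i * (1 - Real.exp (-(α / n i)))) l (𝓝 α) := by
  rw [tendsto_iff_norm_sub_tendsto_zero]
  refine squeeze_zero' (Eventually.of_forall fun _ => norm_nonneg _) ?_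
    (hn.const_div_atTop (α ^ 2))
  filter_upwards [hn.eventually_gt_atTop 0] with i hi
  exact abs_mul_one_sub_exp_neg_sub_le hi hα

theorem tendsto_bdd_mul_zero {ι : Type*} {l : Filter ι} {f g : ι → ℝ} {C : ℝ}
    (hf : ∀ᶠ i in l, |f i| ≤ C) (hg : Tendsto g l (𝓝 0)) :
    Tendsto (fun i => f i * g i) l (𝓝 0) :=
  bdd_le_mul_tendsto_zero' C hf hg

theorem tendsto_profileFun_sub_tiltFun {ι : Type*} {l : Filter ι} {n b w : ι → ℝ} {K : ℝ}
    (hn : Tendsto n l atTop) (hb : ∀ᶠ i in l, |b i| ≤ K) (hw : ∀ᶠ i in l, |w i| ≤ K)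
    {α : ℝ} (hα : 0 < α) :
    Tendsto (fun i => profileFun (n i) (b i) (w i) α - tiltFun (b i) (w i) α) l (𝓝 0) := by
  set δ : ι → ℝ := fun i => 1 - Real.exp (-(α / n i)) with hδ
  have hnδ : Tendsto (fun i => n i * δ i) l (𝓝 α) := tendsto_mul_one_sub_exp_neg hn hα.le
  set z : ι → ℝ := fun i => -((1 - b i) * δ i) + n i * w i * δ i ^ 2 with hz
  have hb1 : ∀ᶠ i in l, |1 - b i| ≤ 1 + K := by
    filter_upwards [hb] with i hi
    calc |1 - b i| ≤ |(1:ℝ)| + |b i| := abs_sub _ _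
      _ ≤ 1 + K := by simpa using hi
  have hnδ0 : Tendsto (fun i => n i * δ i - α) l (𝓝 0) := by
    simpa using hnδ.sub_const α
  have hnδ2 : Tendsto (fun i => (n i * δ i) ^ 2 - α ^ 2) l (𝓝 0) := by
    exact tendsto_sub_nhds_zero_iff.2 (hnδ.pow 2)
  set m : ι → ℝ := fun i => -((1 - b i) * α) + w i * α ^ 2 with hm
  have hnz : Tendsto (fun i => n i * z i - m i) l (𝓝 0) := by
    have h1 := (tendsto_bdd_mul_zero hb1 hnδ0).neg
    have h2 := tendsto_bdd_mul_zero hw hnδ2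
    have := h1.add h2
    simp only [neg_zero, add_zero] at this
    refine this.congr fun i => ?_
    simp only [hz, hm]; ring
  have hmb : ∀ᶠ i in l, |m i| ≤ (1 + K) * α + K * α ^ 2 := by
    filter_upwards [hb1, hw] with i h1 h2
    calc |m i| ≤ |-((1 - b i) * α)| + |w i * α ^ 2| := abs_add_le _ _
      _ = |1 - b i| * α + |w i| * α ^ 2 := by
        rw [abs_neg, abs_mul, abs_mul, abs_of_pos hα, abs_of_pos (pow_pos hα 2)]
      _ ≤ _ := by gcongr
  set M := (1 + K) * α + K * α ^ 2
  have hnzb : ∀ᶠ i in l, |n i * z i| ≤ M + 1 := by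
    have : ∀ᶠ i in l, |n i * z i - m i| < 1 := by
      have := hnz.abs
      simp only [abs_zero] at this
      exact this.eventually_lt_const one_pos
    filter_upwards [this, hmb] with i h1 h2
    have := abs_add_le (n i * z i - m i) (m i)
    simp only [sub_add_cancel] at this
    linarith
  have hninv : Tendsto (fun i => (n i)⁻¹) l (𝓝 0) := tendsto_inv_atTop_zero.comp hn
  have hz0 : Tendsto z l (𝓝 0) := by
    refine (tendsto_bdd_mul_zero hnzb hninv).congr' ?_
    filter_upwards [hn.eventually_gt_atTop 0] with i hi
    field_simp
  have hlog : Tendsto (fun i => n i * (Real.log (1 + z i) - z i)) l (𝓝 0) := by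
    have h1 : Tendsto (fun i => 2 * (M + 1) ^ 2 * (n i)⁻¹) l (𝓝 0) := by
      simpa using hninv.const_mul (2 * (M + 1) ^ 2)
    refine squeeze_zero_norm' ?_ h1
    have hz1 : ∀ᶠ i in l, |z i| < 1 / 2 := by
      have := hz0.abs
      simp only [abs_zero] at this
      exact this.eventually_lt_const (by norm_num)
    filter_upwards [hz1, hnzb, hn.eventually_gt_atTop 0] with i h1 h2 h3
    rw [Real.norm_eq_abs, abs_mul, abs_of_pos h3]
    have h4 := abs_log_one_add_sub_le h1.le
    have h5 : n i * (2 * z i ^ 2) = 2 * |n i * z i| ^ 2 * (n i)⁻¹ := by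
      rw [sq_abs]; field_simp
    calc n i * |Real.log (1 + z i) - z i| ≤ n i * (2 * z i ^ 2) := by gcongr
      _ = 2 * |n i * z i| ^ 2 * (n i)⁻¹ := h5
      _ ≤ 2 * (M + 1) ^ 2 * (n i)⁻¹ := by gcongr
  set E : ι → ℝ := fun i => -(n i / 2) * Real.log (innovRatio (n i) (b i) (w i) (δ i)) with hE
  set F : ι → ℝ := fun i => (1 - b i) * α / 2 - w i * α ^ 2 / 2 with hF
  have hEF : Tendsto (fun i => E i - F i) l (𝓝 0) := by
    have := (hlog.add hnz).const_mul (-(1 / 2))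
    simp only [add_zero, mul_zero] at this
    refine this.congr fun i => ?_
    have : innovRatio (n i) (b i) (w i) (δ i) = 1 + z i := by
      simp only [innovRatio, hz]; ring
    simp only [hE, this, hF, hm]
    ring
  have hFb : ∀ᶠ i in l, |Real.exp (F i)| ≤ Real.exp M := by
    filter_upwards [hmb] with i hi
    rw [abs_of_pos (Real.exp_pos _)]
    apply Real.exp_le_exp.2
    have : F i = -(m i) / 2 := by simp only [hF, hm]; ring
    rw [this]
    have h1 := neg_abs_le (m i)
    have h2 := abs_nonneg (m i)
    linarith
  have hP : Tendsto (fun i => √(n i) * √(1 - Real.exp (-(2 * (α / n i))))) l (𝓝 √(2 * α)) := by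
    have h1 := (tendsto_mul_one_sub_exp_neg hn (α := 2 * α) (by positivity)).sqrt
    refine h1.congr' ?_
    filter_upwards [hn.eventually_gt_atTop 0] with i hi
    rw [Real.sqrt_mul hi.le, mul_div_assoc]
  have hexp : Tendsto (fun i => Real.exp (E i - F i) - 1) l (𝓝 0) := by
    simpa using (hEF.rexp).sub_const 1
  have h1 := (tendsto_bdd_mul_zero hFb hexp).mul hP
  have h2 := tendsto_bdd_mul_zero hFb (g := fun i =>
    √(n i) * √(1 - Real.exp (-(2 * (α / n i)))) - √(2 * α)) (by simpa using hP.sub_const √(2 * α))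
  have h3 := h1.add h2
  simp only [zero_mul, add_zero] at h3
  refine h3.congr fun i => ?_
  have : Real.exp (E i) = Real.exp (F i) * Real.exp (E i - F i) := by
    rw [← Real.exp_add]; ring_nf
  simp only [profileFun, tiltFun]
  change _ = _ * Real.exp (E i) - _ * Real.exp (F i)
  rw [this]; ring

theorem tiltFun_le {b w α : ℝ} {w0 : ℝ} (hb : 0 ≤ b) (hw0 : 0 < w0) (hw : w0 ≤ w) (hα : 0 < α) :
    tiltFun b w α ≤ Real.exp (1 / (4 * w0)) * √(2 * α) := by
  unfold tiltFun
  rw [mul_comm]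
  gcongr
  have h1 : w0 * α ^ 2 ≤ w * α ^ 2 := by gcongr
  have h2 : 0 ≤ b * α := by positivity
  have h3 : 1 / (4 * w0) - (α / 2 - w0 * α ^ 2 / 2) = 1 / (8 * w0) + w0 / 2 * (α - 1 / (2 * w0)) ^ 2 := by
    field_simp; ring
  have h4 : 0 ≤ 1 / (8 * w0) + w0 / 2 * (α - 1 / (2 * w0)) ^ 2 := by positivity
  nlinarith

theorem tiltFun_ge {b w α K a₁ a₂ : ℝ} (hb : b ≤ K) (hw : |w| ≤ K) (h1 : 0 < a₁)
    (hα : α ∈ Icc a₁ a₂) :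
    √(2 * a₁) * Real.exp (-(K * a₂ + K * a₂ ^ 2)) ≤ tiltFun b w α := by
  unfold tiltFun
  have hK : 0 ≤ K := (abs_nonneg w).trans hw
  have hα0 : 0 < α := h1.trans_le hα.1
  have ha2 : 0 < a₂ := hα0.trans_le hα.2
  have h3 : (-K) * α ≤ (1 - b) * α := by
    apply mul_le_mul_of_nonneg_right _ hα0.le; linarith
  have h4 : K * α ≤ K * a₂ := by gcongr; exact hα.2
  have h5 : w * α ^ 2 ≤ K * a₂ ^ 2 := by
    have := le_abs_self w
    have := hα.2
    gcongr; linarith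
  have h6 : 0 ≤ K * a₂ ^ 2 := by positivity
  have h7 : 0 ≤ K * a₂ := by positivity
  have := hα.1
  gcongr
  linarith

/-! ### The microergodic parameter -/

/-- The maximizer of the likelihood over the microergodic parameter, for given `α`. -/
noncomputable def thetaFun (n S b w α : ℝ) : ℝ :=
  S * innovRatio n b w (1 - Real.exp (-(α / n))) * ((α / n) / (1 - Real.exp (-(2 * (α / n)))))

theorem abs_thetaFun_sub_le {n S b w α K a : ℝ} (hα : 0 < α) (ha : α ≤ a) (ha1 : 1 ≤ a)
    (hn : 2 * a ≤ n) (hS : |S| ≤ K) (hb : |b| ≤ K) (hw : |w| ≤ K) :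
    |thetaFun n S b w α - S / 2| ≤ K * (2 + 2 * K) * (a ^ 2 / n) := by
  have hK : 0 ≤ K := (abs_nonneg _).trans hS
  have hn0 : 0 < n := by linarith
  unfold thetaFun
  set x := α / n with hx
  have hx0 : 0 < x := by positivity
  have hx2 : x ≤ 1 / 2 := by rw [hx, div_le_iff₀ hn0]; linarith
  set y := x / (1 - Real.exp (-(2 * x))) with hy
  have h1 := one_sub_exp_neg_le (2 * x)
  have h2 := sub_sq_div_le_one_sub_exp_neg (x := 2 * x) (by positivity)
  have h0 := one_sub_exp_neg_pos (x := 2 * x) (by positivity)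
  set δ := 1 - Real.exp (-x) with hδ
  have hδ0 : 0 ≤ δ := one_sub_exp_neg_nonneg hx0.le
  have hδx : δ ≤ x := one_sub_exp_neg_le x
  have hxa : x ≤ a / n := by rw [hx]; gcongr
  have haa : a / n ≤ a ^ 2 / n := by gcongr; nlinarith
  set e := a ^ 2 / n with he
  have hnx : n * x ^ 2 ≤ e := by
    have : n * x ^ 2 = α ^ 2 / n := by rw [hx]; field_simp
    rw [this, he]; gcongr
  have hr : |innovRatio n b w δ - 1| ≤ (1 + 2 * K) * e := by
    have e1 : innovRatio n b w δ - 1 = -((1 - b) * δ) + w * (n * δ ^ 2) := by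
      unfold innovRatio; ring
    have hb1 : |1 - b| ≤ 1 + K := by
      calc |1 - b| ≤ |(1:ℝ)| + |b| := abs_sub _ _
        _ ≤ 1 + K := by simpa using hb
    rw [e1]
    calc |-((1 - b) * δ) + w * (n * δ ^ 2)| ≤ |-((1 - b) * δ)| + |w * (n * δ ^ 2)| := abs_add_le _ _
      _ = |1 - b| * δ + |w| * (n * δ ^ 2) := by
        rw [abs_neg, abs_mul, abs_mul, abs_of_nonneg hδ0,
          abs_of_nonneg (show 0 ≤ n * δ ^ 2 by positivity)]
      _ ≤ (1 + K) * e + K * e := by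
        gcongr
        · linarith
        · calc n * δ ^ 2 ≤ n * x ^ 2 := by gcongr
            _ ≤ e := hnx
      _ = _ := by ring
  have hy1 : |y - 1 / 2| ≤ e := by
    have : y ≤ 1 / 2 + x := by
      rw [hy, div_le_iff₀ h0]
      have h3 := exp_neg_mul_one_add_le (x := 2 * x)
      nlinarith
    have : 1 / 2 ≤ y := by
      rw [hy, le_div_iff₀ h0]; linarith
    rw [abs_le]; constructor <;> linarith
  have hy2 : |y| ≤ 1 := by
    have : y ≤ 1 := by
      rw [hy, div_le_iff₀ h0]
      have h3 := exp_neg_mul_one_add_le (x := 2 * x)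
      nlinarith [Real.exp_pos (-(2 * x))]
    have : 0 ≤ y := by positivity
    rw [abs_le]; constructor <;> linarith
  have e2 : S * innovRatio n b w δ * y - S / 2
      = S * ((innovRatio n b w δ - 1) * y) + S * (y - 1 / 2) := by ring
  have he0 : 0 ≤ e := by positivity
  rw [e2]
  calc _ ≤ |S * ((innovRatio n b w δ - 1) * y)| + |S * (y - 1 / 2)| := abs_add_le _ _
    _ = |S| * (|innovRatio n b w δ - 1| * |y|) + |S| * |y - 1 / 2| := by
      simp only [abs_mul]
    _ ≤ K * (((1 + 2 * K) * e) * 1) + K * e := by gcongr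
    _ = _ := by ring

/-! ### The likelihood of the microergodic parameter, relative to its maximum -/

/-- The likelihood of `θ`, divided by its maximal value, attained at `t`. -/
noncomputable def thetaKer (n t θ : ℝ) : ℝ :=
  Real.exp (-(n / 2) * (t / θ - 1 - Real.log (t / θ)))

theorem measurable_thetaKer (n t : ℝ) : Measurable (thetaKer n t) := by
  unfold thetaKer; fun_prop

theorem thetaKer_pos (n t θ : ℝ) : 0 < thetaKer n t θ := Real.exp_pos _

theorem thetaKer_le_exp {n t θ c : ℝ} (hn : 0 ≤ n) (ht : 0 < t) (hθ : 0 < θ)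
    (hc : c ≤ (√(t / θ) - 1) ^ 2) : thetaKer n t θ ≤ Real.exp (-(n / 2 * c)) := by
  unfold thetaKer
  apply Real.exp_le_exp.2
  have := sq_sqrt_sub_one_le (q := t / θ) (by positivity)
  have h2 : n / 2 * c ≤ n / 2 * (t / θ - 1 - Real.log (t / θ)) := by gcongr; linarith
  linarith

theorem thetaKer_le_one {n t θ : ℝ} (hn : 0 ≤ n) (ht : 0 < t) (hθ : 0 < θ) :
    thetaKer n t θ ≤ 1 := by
  have := thetaKer_le_exp hn ht hθ (c := 0) (by positivity)
  simpa using this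

theorem thetaKer_le_of_near {n t θ θ₀ : ℝ} (hn : 0 ≤ n) (hθ₀ : 0 < θ₀) (ht : |t - θ₀| ≤ θ₀ / 10)
    (hθ : |θ - θ₀| < θ₀ / 2) :
    thetaKer n t θ ≤ Real.exp (-(2 / (81 * θ₀ ^ 2) * (n * (t - θ) ^ 2))) := by
  rw [abs_le] at ht
  rw [abs_lt] at hθ
  have ht0 : 0 < t := by linarith
  have hθ0 : 0 < θ := by linarith
  have hq : t / θ ≤ 4 := by rw [div_le_iff₀ hθ0]; linarith
  have hq0 : 0 < t / θ := by positivity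
  set s := √(t / θ) with hs
  have hs0 : 0 ≤ s := Real.sqrt_nonneg _
  have hs2 : s ^ 2 = t / θ := Real.sq_sqrt hq0.le
  have hs3 : s ≤ 2 := by nlinarith
  have h1 : (t / θ - 1) ^ 2 / 9 ≤ (s - 1) ^ 2 := by
    rw [← hs2]
    have : (s ^ 2 - 1) ^ 2 = (s - 1) ^ 2 * (s + 1) ^ 2 := by ring
    rw [this]
    have : (s + 1) ^ 2 ≤ 9 := by nlinarith
    nlinarith [sq_nonneg (s - 1)]
  have h2 : 4 * (t - θ) ^ 2 / (9 * θ₀ ^ 2) ≤ (t / θ - 1) ^ 2 := by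
    have : (t / θ - 1) ^ 2 = (t - θ) ^ 2 / θ ^ 2 := by field_simp
    rw [this, div_le_div_iff₀ (by positivity) (by positivity)]
    have : 4 * θ ^ 2 ≤ 9 * θ₀ ^ 2 := by nlinarith
    nlinarith [mul_le_mul_of_nonneg_left this (sq_nonneg (t - θ))]
  have h3 := thetaKer_le_exp hn ht0 hθ0 (c := 4 * (t - θ) ^ 2 / (9 * θ₀ ^ 2) / 9) (by linarith)
  refine h3.trans_eq ?_
  congr 1
  field_simp
  ring

theorem thetaKer_le_of_far {n t θ θ₀ : ℝ} (hn : 0 ≤ n) (hθ₀ : 0 < θ₀) (ht : |t - θ₀| ≤ θ₀ / 10)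
    (hθ0 : 0 < θ) (hθ : θ₀ / 2 ≤ |θ - θ₀|) :
    thetaKer n t θ ≤ Real.exp (-(n / 128)) := by
  rw [abs_le] at ht
  have ht0 : 0 < t := by linarith
  have hq0 : 0 < t / θ := by positivity
  set s := √(t / θ) with hs
  have hs0 : 0 ≤ s := Real.sqrt_nonneg _
  have hs2 : s ^ 2 = t / θ := Real.sq_sqrt hq0.le
  have h : 1 / 64 ≤ (s - 1) ^ 2 := by
    rcases le_abs.1 hθ with h | h
    · have : t / θ ≤ 49 / 64 := by rw [div_le_iff₀ hθ0]; linarith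
      have : s ≤ 7 / 8 := by nlinarith
      nlinarith
    · have : 81 / 64 ≤ t / θ := by rw [le_div_iff₀ hθ0]; linarith
      have : 9 / 8 ≤ s := by nlinarith
      nlinarith
  refine (thetaKer_le_exp hn ht0 hθ0 h).trans_eq ?_
  congr 1
  ring

theorem eventually_abs_lt_of_tendsto_zero {ι : Type*} {l : Filter ι} {f : ι → ℝ}
    (hf : Tendsto f l (𝓝 0)) {ε : ℝ} (hε : 0 < ε) : ∀ᶠ i in l, |f i| < ε := by
  have := hf.abs
  simp only [abs_zero] at this
  exact this.eventually_lt_const hε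

theorem eventually_abs_le_of_sub_tendsto_zero {ι : Type*} {l : Filter ι} {f g : ι → ℝ} {C : ℝ}
    (hg : ∀ᶠ i in l, |g i| ≤ C) (h : Tendsto (fun i => f i - g i) l (𝓝 0)) :
    ∀ᶠ i in l, |f i| ≤ C + 1 := by
  filter_upwards [hg, eventually_abs_lt_of_tendsto_zero h one_pos] with i h1 h2
  have := abs_add_le (f i - g i) (g i)
  simp only [sub_add_cancel] at this
  linarith

theorem tendsto_exp_neg_sub_exp_neg {ι : Type*} {l : Filter ι} {f g : ι → ℝ}
    (hg : ∀ᶠ i in l, 0 ≤ g i) (h : Tendsto (fun i => f i - g i) l (𝓝 0)) :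
    Tendsto (fun i => Real.exp (-f i) - Real.exp (-g i)) l (𝓝 0) := by
  have h1 : Tendsto (fun i => Real.exp (-(f i - g i)) - 1) l (𝓝 0) := by
    simpa using (h.neg.rexp).sub_const 1
  have h2 : ∀ᶠ i in l, |Real.exp (-g i)| ≤ 1 := by
    filter_upwards [hg] with i hi
    rw [abs_of_pos (Real.exp_pos _)]
    exact Real.exp_le_one_iff.2 (by linarith)
  refine (tendsto_bdd_mul_zero h2 h1).congr fun i => ?_
  rw [mul_sub, ← Real.exp_add]
  ring_nf

theorem tendsto_thetaKer_sub {ι : Type*} {l : Filter ι} {n t m : ι → ℝ} {θ₀ K : ℝ}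
    (hθ₀ : 0 < θ₀) (hn : Tendsto n l atTop) (hm : ∀ᶠ i in l, |m i| ≤ K)
    (htm : Tendsto (fun i => √(n i) * (t i - θ₀) - m i) l (𝓝 0)) (y : ℝ) :
    Tendsto (fun i => thetaKer (n i) (t i) (θ₀ + y / √(n i))
      - Real.exp (-((y - m i) ^ 2 / (4 * θ₀ ^ 2)))) l (𝓝 0) := by
  have hs : Tendsto (fun i => √(n i)) l atTop := Real.tendsto_sqrt_atTop.comp hn
  have hθ : Tendsto (fun i => θ₀ + y / √(n i)) l (𝓝 θ₀) := by
    simpa using (hs.const_div_atTop y).const_add θ₀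
  set θ : ι → ℝ := fun i => θ₀ + y / √(n i) with hθd
  set z : ι → ℝ := fun i => t i / θ i - 1 with hz
  have hθi : Tendsto (fun i => (θ i)⁻¹) l (𝓝 θ₀⁻¹) := hθ.inv₀ hθ₀.ne'
  have hθpos : ∀ᶠ i in l, 0 < θ i := hθ.eventually_const_lt hθ₀
  have hspos : ∀ᶠ i in l, 0 < √(n i) := hs.eventually_gt_atTop 0
  have hmy : ∀ᶠ i in l, |m i - y| ≤ K + |y| := by
    filter_upwards [hm] with i hi
    have := abs_sub (m i) y
    linarith
  have hsz : Tendsto (fun i => √(n i) * z i - (m i - y) * θ₀⁻¹) l (𝓝 0) := by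
    have h1 := htm.mul hθi
    have h2 := tendsto_bdd_mul_zero hmy (tendsto_sub_nhds_zero_iff.2 hθi)
    have h3 := h1.add h2
    simp only [zero_mul, add_zero] at h3
    refine h3.congr' ?_
    filter_upwards [hθpos, hspos] with i h1 h2
    have : z i = (t i - θ i) * (θ i)⁻¹ := by simp only [hz]; field_simp
    rw [this]
    have h4 : √(n i) * (t i - θ i) = √(n i) * (t i - θ₀) - y := by
      simp only [hθd]; field_simp; ring
    rw [← mul_assoc, h4]
    ring
  have hmyb : ∀ᶠ i in l, |(m i - y) * θ₀⁻¹| ≤ (K + |y|) * θ₀⁻¹ := by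
    filter_upwards [hmy] with i hi
    rw [abs_mul, abs_of_pos (inv_pos.2 hθ₀)]
    gcongr
  have hszb := eventually_abs_le_of_sub_tendsto_zero hmyb hsz
  set C := (K + |y|) * θ₀⁻¹ + 1
  have hsinv : Tendsto (fun i => (√(n i))⁻¹) l (𝓝 0) := tendsto_inv_atTop_zero.comp hs
  have hz0 : Tendsto z l (𝓝 0) := by
    refine (tendsto_bdd_mul_zero hszb hsinv).congr' ?_
    filter_upwards [hspos] with i hi
    field_simp
  have hsq : Tendsto (fun i => (√(n i) * z i) ^ 2 - ((m i - y) * θ₀⁻¹) ^ 2) l (𝓝 0) := by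
    have hb : ∀ᶠ i in l, |√(n i) * z i + (m i - y) * θ₀⁻¹| ≤ C + C := by
      filter_upwards [hszb, hmyb] with i h1 h2
      have := abs_add_le (√(n i) * z i) ((m i - y) * θ₀⁻¹)
      linarith
    refine (tendsto_bdd_mul_zero hb hsz).congr fun i => ?_
    ring
  have hcub : Tendsto (fun i => n i * (z i - z i ^ 2 / 2 - Real.log (1 + z i))) l (𝓝 0) := by
    have hC : Tendsto (fun i => 2 * C ^ 2 * |z i|) l (𝓝 0) := by
      have := hz0.abs.const_mul (2 * C ^ 2)
      simpa using this
    refine squeeze_zero_norm' ?_ hC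
    filter_upwards [hszb, eventually_abs_lt_of_tendsto_zero hz0 (show (0:ℝ) < 1 / 2 by norm_num),
      hn.eventually_ge_atTop 0] with i h1 h2 h3
    rw [Real.norm_eq_abs, abs_mul, abs_of_nonneg h3]
    have h4 := abs_log_one_add_sub_add_le h2.le
    have h5 : n i * (2 * |z i| ^ 3) = 2 * |√(n i) * z i| ^ 2 * |z i| := by
      rw [sq_abs, mul_pow, Real.sq_sqrt h3, pow_succ, sq_abs]; ring
    calc _ ≤ n i * (2 * |z i| ^ 3) := by gcongr
      _ = _ := h5
      _ ≤ _ := by gcongr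
  unfold thetaKer
  have := tendsto_exp_neg_sub_exp_neg (l := l)
    (f := fun i => n i / 2 * (t i / θ i - 1 - Real.log (t i / θ i)))
    (g := fun i => (y - m i) ^ 2 / (4 * θ₀ ^ 2)) (Eventually.of_forall fun i => by positivity) ?_
  · refine this.congr fun i => ?_
    simp only [neg_mul]
    rfl
  · have h6 := (hcub.const_mul (1 / 2)).add (hsq.const_mul (1 / 4))
    simp only [mul_zero, add_zero] at h6
    refine h6.congr' ?_
    filter_upwards [hn.eventually_ge_atTop 0] with i hi
    have e1 : t i / θ i = 1 + z i := by simp only [hz]; ring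
    rw [e1, mul_pow, Real.sq_sqrt hi]
    field_simp
    ring

/-! ### Priors with bounded log-derivative -/

theorem exp_bounds_of_abs_deriv_log_le {p : ℝ → ℝ} {L θ₀ θ : ℝ} (hθ₀ : 0 < θ₀)
    (hp : ContDiffOn ℝ 1 p (Ioi 0)) (hp0 : ∀ θ > 0, 0 ≤ p θ)
    (hL : ∀ θ ∈ Ioo (θ₀ / 2) (2 * θ₀), |deriv (fun t => Real.log (p t)) θ| ≤ L)
    (hθ : θ ∈ Ioo (θ₀ / 2) (2 * θ₀)) :
    p θ₀ * Real.exp (-(L * |θ - θ₀|)) ≤ p θ ∧ p θ ≤ p θ₀ * Real.exp (L * |θ - θ₀|) := by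
  set I := Ioo (θ₀ / 2) (2 * θ₀) with hI
  have hI0 : ∀ x ∈ I, 0 < x := fun x hx => by linarith [hx.1]
  have hdiff : ∀ x ∈ I, DifferentiableAt ℝ p x := fun x hx =>
    (hp.differentiableOn one_ne_zero).differentiableAt (Ioi_mem_nhds (hI0 x hx))
  have hder : ∀ x ∈ I, |deriv p x| ≤ L * p x := by
    intro x hx
    rcases (hp0 x (hI0 x hx)).eq_or_lt with h | h
    · have : IsLocalMin p x := by
        filter_upwards [Ioi_mem_nhds (hI0 x hx)] with z hz
        rw [← h]; exact hp0 z hz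
      rw [this.deriv_eq_zero, ← h]; simp
    · have h1 := hL x hx
      rw [deriv.log (hdiff x hx) h.ne', abs_div, abs_of_pos h, div_le_iff₀ h] at h1
      exact h1
  have hI0' : θ₀ ∈ I := ⟨by linarith, by linarith⟩
  have hconv : Convex ℝ I := convex_Ioo _ _
  have hd : ∀ (c : ℝ), ∀ x ∈ I, HasDerivAt (fun x => p x * Real.exp (c * x))
      ((deriv p x + c * p x) * Real.exp (c * x)) x := by
    intro c x hx
    have h1 := (hdiff x hx).hasDerivAt.mul (((hasDerivAt_id x).const_mul c).exp)
    refine h1.congr_deriv ?_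
    simp only [id_eq, mul_one]
    ring
  have hmono : MonotoneOn (fun x => p x * Real.exp (L * x)) I := by
    refine monotoneOn_of_deriv_nonneg hconv
      (fun x hx => (hd L x hx).continuousAt.continuousWithinAt)
      (fun x hx => (hd L x (interior_subset hx)).differentiableAt.differentiableWithinAt) ?_
    intro x hx
    have hx := interior_subset hx
    rw [(hd L x hx).deriv]
    have := abs_le.1 (hder x hx)
    exact mul_nonneg (by linarith [this.1]) (Real.exp_pos _).le
  have hanti : AntitoneOn (fun x => p x * Real.exp (-L * x)) I := by
    refine antitoneOn_of_deriv_nonpos hconv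
      (fun x hx => (hd (-L) x hx).continuousAt.continuousWithinAt)
      (fun x hx => (hd (-L) x (interior_subset hx)).differentiableAt.differentiableWithinAt) ?_
    intro x hx
    have hx := interior_subset hx
    rw [(hd (-L) x hx).deriv]
    have := abs_le.1 (hder x hx)
    exact mul_nonpos_of_nonpos_of_nonneg (by linarith [this.2]) (Real.exp_pos _).le
  have key : ∀ c a b : ℝ, p a * Real.exp (c * a) ≤ p b * Real.exp (c * b) →
      p a * Real.exp (c * (a - b)) ≤ p b := by
    intro c a b h
    have h1 : Real.exp (c * (a - b)) = Real.exp (c * a) * Real.exp (-(c * b)) := by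
      rw [← Real.exp_add]; ring_nf
    have h2 : Real.exp (c * b) * Real.exp (-(c * b)) = 1 := by rw [← Real.exp_add]; simp
    calc p a * Real.exp (c * (a - b)) = p a * Real.exp (c * a) * Real.exp (-(c * b)) := by
          rw [h1]; ring
      _ ≤ p b * Real.exp (c * b) * Real.exp (-(c * b)) := by gcongr
      _ = p b := by rw [mul_assoc, h2, mul_one]
  have key2 : ∀ e a b : ℝ, p a * Real.exp (-e) ≤ p b → p a ≤ p b * Real.exp e := by
    intro e a b h
    have h2 : Real.exp (-e) * Real.exp e = 1 := by rw [← Real.exp_add]; simp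
    calc p a = p a * Real.exp (-e) * Real.exp e := by rw [mul_assoc, h2, mul_one]
      _ ≤ _ := by gcongr
  rcases le_total θ₀ θ with h | h
  · rw [abs_of_nonneg (by linarith)]
    constructor
    · have := key L θ₀ θ (hmono hI0' hθ h)
      rwa [show L * (θ₀ - θ) = -(L * (θ - θ₀)) by ring] at this
    · apply key2
      have := key (-L) θ θ₀ (hanti hI0' hθ h)
      rwa [show -L * (θ - θ₀) = -(L * (θ - θ₀)) by ring] at this
  · rw [abs_of_nonpos (by linarith)]
    constructor
    · have := key (-L) θ₀ θ (hanti hθ hI0' h)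
      rwa [show -L * (θ₀ - θ) = -(L * -(θ - θ₀)) by ring] at this
    · apply key2
      have := key L θ θ₀ (hmono hθ hI0' h)
      rwa [show L * (θ - θ₀) = -(L * -(θ - θ₀)) by ring] at this

/-! ### Asymptotic normality of the conditional posterior of the microergodic parameter -/

theorem lintegral_comp_mul_sub (f : ℝ → ENNReal) (hf : Measurable f) {s : ℝ} (hs : 0 < s) (c : ℝ) :
    ∫⁻ x, ENNReal.ofReal s * f (s * (x - c)) = ∫⁻ y, f y := by
  have h1 : ∫⁻ x, ENNReal.ofReal s * f (s * (x - c)) = ∫⁻ x, ENNReal.ofReal s * f (s * x) :=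
    lintegral_sub_right_eq_self (fun x => ENNReal.ofReal s * f (s * x)) c
  have h2 := Real.smul_map_volume_mul_left hs.ne'
  rw [h1]
  conv_rhs => rw [← h2]
  rw [lintegral_smul_measure, lintegral_map hf (by fun_prop), abs_of_pos hs, smul_eq_mul,
    lintegral_const_mul _ (by fun_prop)]

theorem tendsto_rpow_sub_mul_atBot {c C₃ : ℝ} (hc : 0 < c) (hC₃ : C₃ < 1) :
    ∀ᶠ x : ℝ in atTop, x ^ C₃ ≤ c * x := by
  have h := (tendsto_rpow_neg_atTop (show 0 < 1 - C₃ by linarith))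
  filter_upwards [h.eventually_lt_const hc, eventually_gt_atTop 0] with x h1 h2
  have h3 : x ^ C₃ = x ^ (-(1 - C₃)) * x := by
    nth_rewrite 3 [← Real.rpow_one x]
    rw [← Real.rpow_add h2]; ring_nf
  rw [h3]
  gcongr

theorem tendsto_sqrt_mul_exp_rpow_sub {C₃ : ℝ} (hC₃ : C₃ < 1) :
    Tendsto (fun x : ℝ => √x * Real.exp (-(x / 128)) * Real.exp (x ^ C₃)) atTop (𝓝 0) := by
  have h1 : Tendsto (fun x : ℝ => 256 * ((x / 256) ^ 1 * Real.exp (-(x / 256)))) atTop (𝓝 0) := by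
    have := ((Real.tendsto_pow_mul_exp_neg_atTop_nhds_zero 1).comp
      (tendsto_id.atTop_div_const (show (0:ℝ) < 256 by norm_num))).const_mul 256
    simpa using this
  refine squeeze_zero' (Eventually.of_forall fun x => by positivity) ?_ h1
  filter_upwards [tendsto_rpow_sub_mul_atBot (c := 1 / 256) (by norm_num) hC₃,
    eventually_ge_atTop 1] with x h2 h3
  have h4 : √x ≤ x := by
    rw [Real.sqrt_le_left (by linarith)]; nlinarith
  have h5 : Real.exp (-(x / 128)) * Real.exp (x ^ C₃) ≤ Real.exp (-(x / 256)) := by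
    rw [← Real.exp_add]
    apply Real.exp_le_exp.2
    linarith
  calc √x * Real.exp (-(x / 128)) * Real.exp (x ^ C₃)
      = √x * (Real.exp (-(x / 128)) * Real.exp (x ^ C₃)) := by ring
    _ ≤ x * Real.exp (-(x / 256)) := by gcongr
    _ = _ := by ring

theorem sq_sub_ge_half_sub {y m : ℝ} : y ^ 2 / 2 - m ^ 2 ≤ (m - y) ^ 2 := by
  nlinarith [sq_nonneg (y - 2 * m)]

/-- The density of `√n (θ - θ₀)` under the conditional posterior near `θ₀`, up to a constant. -/
noncomputable def localDensity (n t θ₀ : ℝ) (R : ℝ → ℝ) (y : ℝ) : ℝ :=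
  {y | |y| < √n * θ₀ / 2}.indicator (fun y => thetaKer n t (θ₀ + y / √n) * R (θ₀ + y / √n)) y

theorem measurable_localDensity (n t θ₀ : ℝ) {R : ℝ → ℝ} (hR : Measurable R) :
    Measurable (localDensity n t θ₀ R) := by
  unfold localDensity
  refine Measurable.indicator ?_ (measurableSet_lt (by fun_prop) (by fun_prop))
  have := measurable_thetaKer n t
  fun_prop

section
variable {ι : Type*} {l : Filter ι} [l.IsCountablyGenerated] {n t t0 : ι → ℝ} {R : ι → ℝ → ℝ}
  {θ₀ K C₁ C₃ : ℝ}

theorem tendsto_lintegral_localDensity_sub (hθ₀ : 0 < θ₀) (hn : Tendsto n l atTop)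
    (hC₁ : C₁ < 1 / 2)
    (ht0 : ∀ᶠ i in l, |√(n i) * (t0 i - θ₀)| ≤ K)
    (htt : Tendsto (fun i => √(n i) * (t i - t0 i)) l (𝓝 0))
    (hRm : ∀ i, Measurable (R i)) (hR0 : ∀ i θ, 0 ≤ R i θ)
    (hR : ∀ᶠ i in l, ∀ θ, |θ - θ₀| < θ₀ / 2 →
      Real.exp (-(n i ^ C₁ * |θ - θ₀|)) ≤ R i θ ∧ R i θ ≤ Real.exp (n i ^ C₁ * |θ - θ₀|)) :
    Tendsto (fun i => ∫⁻ y, ENNReal.ofReal |localDensity (n i) (t i) θ₀ (R i) y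
      - Real.exp (-((y - √(n i) * (t0 i - θ₀)) ^ 2 / (4 * θ₀ ^ 2)))|) l (𝓝 0) := by
  have hs : Tendsto (fun i => √(n i)) l atTop := Real.tendsto_sqrt_atTop.comp hn
  set m : ι → ℝ := fun i => √(n i) * (t0 i - θ₀) with hm
  set m' : ι → ℝ := fun i => √(n i) * (t i - θ₀) with hm'
  have hmm : Tendsto (fun i => m' i - m i) l (𝓝 0) := by
    refine htt.congr fun i => ?_
    simp only [hm, hm']; ring
  have hm'b : ∀ᶠ i in l, |m' i| ≤ K + 1 := eventually_abs_le_of_sub_tendsto_zero ht0 hmm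
  have ht : ∀ᶠ i in l, |t i - θ₀| ≤ θ₀ / 10 := by
    filter_upwards [hm'b, hs.eventually_ge_atTop ((K + 1) / (θ₀ / 10)),
      hs.eventually_gt_atTop 0] with i h1 h2 h3
    rw [div_le_iff₀ (by positivity)] at h2
    simp only [hm', abs_mul, abs_of_pos h3] at h1
    exact le_of_mul_le_mul_left (h1.trans h2) h3
  set c := 2 / (81 * θ₀ ^ 2) with hc
  have hc0 : 0 < c := by positivity
  have hc4 : c ≤ 1 / (4 * θ₀ ^ 2) := by
    rw [hc, div_le_div_iff₀ (by positivity) (by positivity)]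
    nlinarith [sq_nonneg θ₀]
  set A := c * (K + 1) ^ 2 + 1 / c with hA
  have hpow : ∀ᶠ i in l, n i ^ C₁ ≤ √(n i) := by
    filter_upwards [hn.eventually_ge_atTop 1] with i hi
    rw [Real.sqrt_eq_rpow]
    exact Real.rpow_le_rpow_of_exponent_le hi hC₁.le
  have hbound : ∀ᶠ i in l, ∀ y : ℝ, |localDensity (n i) (t i) θ₀ (R i) y
      - Real.exp (-((y - m i) ^ 2 / (4 * θ₀ ^ 2)))| ≤ 2 * Real.exp (A - c / 4 * y ^ 2) := by
    filter_upwards [hR, hm'b, ht, ht0, hpow, hs.eventually_gt_atTop 0,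
      hn.eventually_gt_atTop 0] with i hRi hmi hti hmi0 hpi hsi hni y
    have hmsq : (m' i) ^ 2 ≤ (K + 1) ^ 2 := sq_le_sq' (abs_le.1 hmi).1 (abs_le.1 hmi).2
    have hmsq0 : (m i) ^ 2 ≤ (K + 1) ^ 2 := by
      have := abs_le.1 (show |m i| ≤ K + 1 by linarith)
      exact sq_le_sq' this.1 this.2
    have hy : |y| ≤ c / 4 * y ^ 2 + 1 / c := by
      have h0 : c / 4 * y ^ 2 + 1 / c - |y| = (c / 2 * |y| - 1) ^ 2 / c := by
        rw [← sq_abs y]; field_simp; ring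
      have h2 : 0 ≤ (c / 2 * |y| - 1) ^ 2 / c := by positivity
      linarith
    have hG : Real.exp (-((y - m i) ^ 2 / (4 * θ₀ ^ 2))) ≤ Real.exp (A - c / 4 * y ^ 2) := by
      apply Real.exp_le_exp.2
      have h1 := sq_sub_ge_half_sub (y := y) (m := m i)
      have h2 : c * (m i - y) ^ 2 ≤ (y - m i) ^ 2 / (4 * θ₀ ^ 2) := by
        calc c * (m i - y) ^ 2 ≤ 1 / (4 * θ₀ ^ 2) * (m i - y) ^ 2 := by gcongr
          _ = _ := by ring
      have h3 : 0 < 1 / c := by positivity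
      nlinarith [sq_nonneg y]
    have hF : localDensity (n i) (t i) θ₀ (R i) y ≤ Real.exp (A - c / 4 * y ^ 2) := by
      unfold localDensity
      rw [indicator_apply]
      split_ifs with hys
      · simp only [mem_ofPred_eq] at hys
        set θ := θ₀ + y / √(n i) with hθ
        have hd : θ - θ₀ = y / √(n i) := by rw [hθ]; ring
        have hdn : |θ - θ₀| < θ₀ / 2 := by
          rw [hd, abs_div, abs_of_pos hsi, div_lt_iff₀ hsi]; linarith
        have h1 := thetaKer_le_of_near hni.le hθ₀ hti hdn
        have h2 := (hRi θ hdn).2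
        have h3 : n i * (t i - θ) ^ 2 = (m' i - y) ^ 2 := by
          have : m' i - y = √(n i) * (t i - θ) := by
            simp only [hm', hθ]; field_simp; ring
          rw [this, mul_pow, Real.sq_sqrt hni.le]
        rw [h3] at h1
        have h4 : n i ^ C₁ * |θ - θ₀| ≤ |y| := by
          rw [hd, abs_div, abs_of_pos hsi]
          calc n i ^ C₁ * (|y| / √(n i)) ≤ √(n i) * (|y| / √(n i)) := by gcongr
            _ = |y| := by field_simp
        calc _ ≤ Real.exp (-(c * (m' i - y) ^ 2)) * Real.exp (n i ^ C₁ * |θ - θ₀|) := by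
              gcongr
              exact hR0 i θ
          _ = Real.exp (-(c * (m' i - y) ^ 2) + n i ^ C₁ * |θ - θ₀|) := by rw [Real.exp_add]
          _ ≤ _ := by
              apply Real.exp_le_exp.2
              have h5 := sq_sub_ge_half_sub (y := y) (m := m' i)
              nlinarith
      · exact (Real.exp_pos _).le
    have hF0 : 0 ≤ localDensity (n i) (t i) θ₀ (R i) y :=
      indicator_nonneg (fun y _ => mul_nonneg (thetaKer_pos _ _ _).le (hR0 _ _)) y
    have hG0 := (Real.exp_pos (-((y - m i) ^ 2 / (4 * θ₀ ^ 2)))).le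
    rw [abs_le]
    constructor <;> linarith [Real.exp_pos (A - c / 4 * y ^ 2)]
  have hlim : ∀ y : ℝ, Tendsto (fun i => localDensity (n i) (t i) θ₀ (R i) y
      - Real.exp (-((y - m i) ^ 2 / (4 * θ₀ ^ 2)))) l (𝓝 0) := by
    intro y
    have hker := tendsto_thetaKer_sub hθ₀ hn ht0 hmm y
    have hRlim : Tendsto (fun i => R i (θ₀ + y / √(n i)) - 1) l (𝓝 0) := by
      have he : Tendsto (fun i => n i ^ C₁ * |y / √(n i)|) l (𝓝 0) := by
        have h1 : Tendsto (fun i => n i ^ (-(1 / 2 - C₁)) * |y|) l (𝓝 0) := by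
          simpa using ((tendsto_rpow_neg_atTop (show 0 < 1 / 2 - C₁ by linarith)).comp
            hn).mul_const |y|
        refine h1.congr' ?_
        filter_upwards [hn.eventually_gt_atTop 0] with i hi
        rw [abs_div, abs_of_nonneg (Real.sqrt_nonneg _), Real.sqrt_eq_rpow,
          show -(1 / 2 - C₁) = C₁ - 1 / 2 by ring, Real.rpow_sub hi]
        ring
      have hnear : ∀ᶠ i in l, |y / √(n i)| < θ₀ / 2 :=
        eventually_abs_lt_of_tendsto_zero (hs.const_div_atTop y) (by positivity)
      have hlo : Tendsto (fun i => Real.exp (-(n i ^ C₁ * |y / √(n i)|)) - 1) l (𝓝 0) := by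
        simpa using he.neg.rexp.sub_const 1
      have hhi : Tendsto (fun i => Real.exp (n i ^ C₁ * |y / √(n i)|) - 1) l (𝓝 0) := by
        simpa using he.rexp.sub_const 1
      refine tendsto_of_tendsto_of_tendsto_of_le_of_le' hlo hhi ?_ ?_
      · filter_upwards [hR, hnear] with i h1 h2
        have := (h1 (θ₀ + y / √(n i)) (by simpa using h2)).1
        simp only [add_sub_cancel_left] at this
        linarith
      · filter_upwards [hR, hnear] with i h1 h2
        have := (h1 (θ₀ + y / √(n i)) (by simpa using h2)).2
        simp only [add_sub_cancel_left] at this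
        linarith
    have hker1 : ∀ᶠ i in l, |thetaKer (n i) (t i) (θ₀ + y / √(n i))| ≤ 1 + 1 := by
      refine eventually_abs_le_of_sub_tendsto_zero (Eventually.of_forall fun i => ?_) hker
      rw [abs_of_pos (Real.exp_pos _)]
      exact Real.exp_le_one_iff.2 (by simp only [Left.neg_nonpos_iff]; positivity)
    have h1 := (tendsto_bdd_mul_zero hker1 hRlim).add hker
    simp only [add_zero] at h1
    refine h1.congr' ?_
    have hin : ∀ᶠ i in l, |y| < √(n i) * θ₀ / 2 := by
      filter_upwards [hs.eventually_gt_atTop (|y| / (θ₀ / 2))] with i hi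
      rw [div_lt_iff₀ (by positivity)] at hi
      linarith
    filter_upwards [hin] with i hi
    unfold localDensity
    rw [indicator_of_mem (by simpa using hi)]
    ring
  have hzero : ∫⁻ _ : ℝ, (0 : ENNReal) = 0 := by simp
  rw [← hzero]
  refine tendsto_lintegral_filter_of_dominated_convergence
    (fun y => ENNReal.ofReal (2 * Real.exp (A - c / 4 * y ^ 2))) ?_ ?_ ?_ ?_
  · refine Eventually.of_forall fun i => ?_
    have := measurable_localDensity (n i) (t i) θ₀ (hRm i)
    fun_prop
  · filter_upwards [hbound] with i hi
    exact ae_of_all _ fun y => ENNReal.ofReal_le_ofReal (hi y)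
  · have : Integrable fun y : ℝ => 2 * Real.exp (A - c / 4 * y ^ 2) := by
      have h := (integrable_exp_neg_mul_sq (show 0 < c / 4 by positivity)).const_mul
        (2 * Real.exp A)
      refine h.congr (ae_of_all _ fun y => ?_)
      simp only
      rw [mul_assoc, ← Real.exp_add]
      ring_nf
    exact this.lintegral_lt_top.ne
  · refine ae_of_all _ fun y => ?_
    have := ENNReal.tendsto_ofReal (hlim y).abs
    simpa using this

/-- The conditional posterior of the microergodic parameter is asymptotically normal in `L¹`. -/
theorem tendsto_lintegral_thetaKer_sub (hθ₀ : 0 < θ₀) (hn : Tendsto n l atTop)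
    (hC₁ : C₁ < 1 / 2) (hC₃ : C₃ < 1)
    (ht0 : ∀ᶠ i in l, |√(n i) * (t0 i - θ₀)| ≤ K)
    (htt : Tendsto (fun i => √(n i) * (t i - t0 i)) l (𝓝 0))
    (hRm : ∀ i, Measurable (R i)) (hR0 : ∀ i θ, 0 ≤ R i θ) (hRneg : ∀ i, ∀ θ ≤ 0, R i θ = 0)
    (hRint : ∀ᶠ i in l, ∫⁻ θ, ENNReal.ofReal (R i θ) ≤ ENNReal.ofReal (Real.exp (n i ^ C₃)))
    (hR : ∀ᶠ i in l, ∀ θ, |θ - θ₀| < θ₀ / 2 →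
      Real.exp (-(n i ^ C₁ * |θ - θ₀|)) ≤ R i θ ∧ R i θ ≤ Real.exp (n i ^ C₁ * |θ - θ₀|)) :
    Tendsto (fun i => ∫⁻ θ, ENNReal.ofReal |√(n i) * thetaKer (n i) (t i) θ * R i θ
      - √(n i) * Real.exp (-(n i * (θ - t0 i) ^ 2 / (4 * θ₀ ^ 2)))|) l (𝓝 0) := by
  have hs : Tendsto (fun i => √(n i)) l atTop := Real.tendsto_sqrt_atTop.comp hn
  have h1 := tendsto_lintegral_localDensity_sub hθ₀ hn hC₁ ht0 htt hRm hR0 hR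
  have h2 := ENNReal.tendsto_ofReal ((tendsto_sqrt_mul_exp_rpow_sub hC₃).comp hn)
  have h3 := h1.add h2
  simp only [ENNReal.ofReal_zero, add_zero] at h3
  have ht : ∀ᶠ i in l, |t i - θ₀| ≤ θ₀ / 10 := by
    have hmm : Tendsto (fun i => √(n i) * (t i - θ₀) - √(n i) * (t0 i - θ₀)) l (𝓝 0) := by
      refine htt.congr fun i => ?_
      ring
    filter_upwards [eventually_abs_le_of_sub_tendsto_zero ht0 hmm,
      hs.eventually_ge_atTop ((K + 1) / (θ₀ / 10)), hs.eventually_gt_atTop 0] with i h1 h2 h3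
    rw [div_le_iff₀ (by positivity)] at h2
    simp only [abs_mul, abs_of_pos h3] at h1
    exact le_of_mul_le_mul_left (h1.trans h2) h3
  refine tendsto_of_tendsto_of_tendsto_of_le_of_le' tendsto_const_nhds h3
    (Eventually.of_forall fun _ => zero_le) ?_
  filter_upwards [hRint, ht, hs.eventually_gt_atTop 0, hn.eventually_gt_atTop 0]
    with i hRi hti hsi hni
  have hmeas : Measurable fun y => ENNReal.ofReal |localDensity (n i) (t i) θ₀ (R i) y
      - Real.exp (-((y - √(n i) * (t0 i - θ₀)) ^ 2 / (4 * θ₀ ^ 2)))| := by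
    have := measurable_localDensity (n i) (t i) θ₀ (hRm i)
    fun_prop
  rw [← lintegral_comp_mul_sub _ hmeas hsi θ₀]
  have hfar : ∫⁻ θ, ENNReal.ofReal (√(n i) * Real.exp (-(n i / 128))) * ENNReal.ofReal (R i θ)
      ≤ ENNReal.ofReal (√(n i) * Real.exp (-(n i / 128)) * Real.exp (n i ^ C₃)) := by
    rw [lintegral_const_mul _ (hRm i).ennreal_ofReal,
      ENNReal.ofReal_mul (p := √(n i) * Real.exp (-(n i / 128))) (by positivity)]
    exact mul_le_mul_right hRi _
  refine le_trans ?_ (add_le_add le_rfl hfar)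
  rw [← lintegral_add_right _ ((hRm i).ennreal_ofReal.const_mul _)]
  refine lintegral_mono fun θ => ?_
  rw [← ENNReal.ofReal_mul hsi.le, ← ENNReal.ofReal_mul (by positivity),
    ← ENNReal.ofReal_add (by positivity) (mul_nonneg (by positivity) (hR0 _ _))]
  apply ENNReal.ofReal_le_ofReal
  have e1 : (√(n i) * (θ - θ₀) - √(n i) * (t0 i - θ₀)) ^ 2 = n i * (θ - t0 i) ^ 2 := by
    rw [← mul_sub, mul_pow, Real.sq_sqrt hni.le]; ring
  have e2 : θ₀ + √(n i) * (θ - θ₀) / √(n i) = θ := by field_simp; ring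
  rw [e1]
  set G := Real.exp (-(n i * (θ - t0 i) ^ 2 / (4 * θ₀ ^ 2)))
  have hmem : |√(n i) * (θ - θ₀)| < √(n i) * θ₀ / 2 ↔ |θ - θ₀| < θ₀ / 2 := by
    rw [abs_mul, abs_of_pos hsi, mul_div_assoc, mul_lt_mul_iff_right₀ hsi]
  unfold localDensity
  rw [indicator_apply]
  simp only [mem_ofPred_eq, hmem, e2]
  split_ifs with h
  · have e3 : √(n i) * thetaKer (n i) (t i) θ * R i θ - √(n i) * G
        = √(n i) * (thetaKer (n i) (t i) θ * R i θ - G) := by ring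
    rw [e3, abs_mul, abs_of_pos hsi]
    have : 0 ≤ √(n i) * Real.exp (-(n i / 128)) * R i θ := mul_nonneg (by positivity) (hR0 _ _)
    linarith
  · have hG : 0 ≤ √(n i) * G := by positivity
    have e4 : √(n i) * |0 - G| = √(n i) * G := by
      rw [zero_sub, abs_neg, abs_of_pos (Real.exp_pos _)]
    rw [e4]
    have hk : √(n i) * thetaKer (n i) (t i) θ * R i θ
        ≤ √(n i) * Real.exp (-(n i / 128)) * R i θ := by
      rcases le_or_gt θ 0 with h0 | h0
      · rw [hRneg i θ h0]; simp
      · have := thetaKer_le_of_far hni.le hθ₀ hti h0 (not_lt.1 h)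
        have := hR0 i θ
        gcongr
    have hk0 : 0 ≤ √(n i) * thetaKer (n i) (t i) θ * R i θ :=
      mul_nonneg (mul_nonneg hsi.le (thetaKer_pos _ _ _).le) (hR0 _ _)
    rw [abs_le]
    constructor <;> linarith

end

/-! ### Normalization and total variation -/

section
variable {E : Type*} [MeasurableSpace E]

theorem normalized_real (μ : Measure E) (A : Set E) :
    (normalized μ).real A = μ.real A / μ.real univ := by
  simp [normalized, Measure.real, ENNReal.toReal_inv, div_eq_inv_mul]

theorem isProbabilityMeasure_normalized {μ : Measure E} (h0 : μ univ ≠ 0) (h1 : μ univ ≠ ⊤) :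
    IsProbabilityMeasure (normalized μ) :=
  ⟨by simp [normalized, ENNReal.inv_mul_cancel h0 h1]⟩

theorem normalized_smul (μ : Measure E) {c : ENNReal} (h0 : c ≠ 0) (h1 : c ≠ ⊤) :
    normalized (c • μ) = normalized μ := by
  simp only [normalized, Measure.smul_apply, smul_eq_mul, smul_smul]
  congr 1
  rw [ENNReal.mul_inv (Or.inl h0) (Or.inl h1), mul_comm, ← mul_assoc, ENNReal.mul_inv_cancel h0 h1,
    one_mul]

theorem normalized_withDensity_const_mul (μ : Measure E) {f : E → ENNReal} (hf : Measurable f)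
    {c : ENNReal} (h0 : c ≠ 0) (h1 : c ≠ ⊤) :
    normalized (μ.withDensity fun x => c * f x) = normalized (μ.withDensity f) := by
  rw [← normalized_smul (μ.withDensity f) h0 h1, ← withDensity_smul c hf]
  rfl

theorem tvDist_normalized_le {μ ν : Measure E} {ε : ℝ}
    (h : ∀ A, MeasurableSet A → |μ.real A - ν.real A| ≤ ε) (hμ : 0 < μ.real univ)
    (hν : 0 < ν.real univ) : tvDist (normalized μ) (normalized ν) ≤ 2 * ε / ν.real univ := by
  have : IsFiniteMeasure μ := by
    constructor
    by_contra h1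
    simp only [not_lt, top_le_iff] at h1
    simp [Measure.real, h1] at hμ
  have : Nonempty {A : Set E // MeasurableSet A} := ⟨⟨univ, MeasurableSet.univ⟩⟩
  refine ciSup_le fun A => ?_
  rw [normalized_real, normalized_real]
  have h1 := h A A.2
  have h2 := h univ MeasurableSet.univ
  have h3 : μ.real (A : Set E) ≤ μ.real univ := measureReal_mono (subset_univ _)
  have h4 : 0 ≤ μ.real (A : Set E) := measureReal_nonneg
  set a := μ.real (A : Set E)
  set b := ν.real (A : Set E)
  set M := μ.real univ
  set N := ν.real univ
  have e : a / M - b / N = (a - b) / N + a / M * ((N - M) / N) := by field_simp; ring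
  rw [e]
  have h5 : |a / M| ≤ 1 := by
    rw [abs_of_nonneg (by positivity), div_le_one hμ]; exact h3
  calc |(a - b) / N + a / M * ((N - M) / N)| ≤ |(a - b) / N| + |a / M * ((N - M) / N)| :=
        abs_add_le _ _
    _ = |a - b| / N + |a / M| * (|M - N| / N) := by
        rw [abs_mul, abs_div, abs_div (N - M), abs_of_pos hν, abs_sub_comm N M]
    _ ≤ ε / N + 1 * (ε / N) := by gcongr
    _ = _ := by ring

theorem withDensity_real_sub_le (μ : Measure E) {f g : E → ℝ} (hg : Measurable g)
    (hD : ∫⁻ x, ENNReal.ofReal |f x - g x| ∂μ ≠ ⊤)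
    (hG : ∫⁻ x, ENNReal.ofReal (g x) ∂μ ≠ ⊤) {A : Set E} (hA : MeasurableSet A) :
    (μ.withDensity fun x => ENNReal.ofReal (f x)).real A
      - (μ.withDensity fun x => ENNReal.ofReal (g x)).real A
      ≤ (∫⁻ x, ENNReal.ofReal |f x - g x| ∂μ).toReal := by
  have h1 : (μ.withDensity fun x => ENNReal.ofReal (f x)) A
      ≤ (μ.withDensity fun x => ENNReal.ofReal (g x)) A
        + ∫⁻ x, ENNReal.ofReal |f x - g x| ∂μ := by
    rw [withDensity_apply _ hA, withDensity_apply _ hA]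
    calc ∫⁻ x in A, ENNReal.ofReal (f x) ∂μ
        ≤ ∫⁻ x in A, (ENNReal.ofReal (g x) + ENNReal.ofReal |f x - g x|) ∂μ := by
          refine lintegral_mono fun x => ?_
          refine le_trans (ENNReal.ofReal_le_ofReal ?_) ENNReal.ofReal_add_le
          linarith [le_abs_self (f x - g x)]
      _ = ∫⁻ x in A, ENNReal.ofReal (g x) ∂μ + ∫⁻ x in A, ENNReal.ofReal |f x - g x| ∂μ :=
          lintegral_add_left (by fun_prop) _
      _ ≤ _ := by gcongr; exact Measure.restrict_le_self
  have hGA : (μ.withDensity fun x => ENNReal.ofReal (g x)) A ≠ ⊤ := by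
    rw [withDensity_apply _ hA]
    exact ((setLIntegral_le_lintegral _ _).trans_lt hG.lt_top).ne
  have h2 := ENNReal.toReal_mono (ENNReal.add_ne_top.2 ⟨hGA, hD⟩) h1
  rw [ENNReal.toReal_add hGA hD] at h2
  simp only [Measure.real]
  linarith

theorem tvDist_normalized_withDensity_le (μ : Measure E) {f g : E → ℝ} (hf : Measurable f)
    (hg : Measurable g) (hD : ∫⁻ x, ENNReal.ofReal |f x - g x| ∂μ ≠ ⊤)
    (hF0 : ∫⁻ x, ENNReal.ofReal (f x) ∂μ ≠ 0) (hF : ∫⁻ x, ENNReal.ofReal (f x) ∂μ ≠ ⊤)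
    (hG0 : ∫⁻ x, ENNReal.ofReal (g x) ∂μ ≠ 0) (hG : ∫⁻ x, ENNReal.ofReal (g x) ∂μ ≠ ⊤) :
    tvDist (normalized (μ.withDensity fun x => ENNReal.ofReal (f x)))
      (normalized (μ.withDensity fun x => ENNReal.ofReal (g x)))
      ≤ 2 * (∫⁻ x, ENNReal.ofReal |f x - g x| ∂μ).toReal
        / (∫⁻ x, ENNReal.ofReal (g x) ∂μ).toReal := by
  have e : ∀ k : E → ℝ, (μ.withDensity fun x => ENNReal.ofReal (k x)).real univ
      = (∫⁻ x, ENNReal.ofReal (k x) ∂μ).toReal := fun k => by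
    rw [Measure.real, withDensity_apply _ MeasurableSet.univ, setLIntegral_univ]
  rw [← e g]
  refine tvDist_normalized_le (fun A hA => ?_) ?_ ?_
  · have h1 := withDensity_real_sub_le μ hg hD hG hA
    have h2 := withDensity_real_sub_le μ (f := g) (g := f) hf
      (by simpa only [abs_sub_comm] using hD) hF hA
    simp only [abs_sub_comm (g _)] at h2
    rw [abs_le]; constructor <;> linarith
  · rw [e]; exact ENNReal.toReal_pos hF0 hF
  · rw [e]; exact ENNReal.toReal_pos hG0 hG

theorem tvDist_nonneg (μ ν : Measure E) : 0 ≤ tvDist μ ν :=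
  Real.iSup_nonneg fun _ => abs_nonneg _

theorem abs_sub_le_tvDist (μ ν : Measure E) [IsProbabilityMeasure μ] [IsProbabilityMeasure ν]
    {A : Set E} (hA : MeasurableSet A) : |μ.real A - ν.real A| ≤ tvDist μ ν := by
  refine le_ciSup (f := fun A : {A : Set E // MeasurableSet A} => |μ.real A - ν.real A|)
    ⟨1, ?_⟩ ⟨A, hA⟩
  rintro _ ⟨B, rfl⟩
  have h1 : μ.real (B : Set E) ≤ 1 := measureReal_le_one
  have h2 : ν.real (B : Set E) ≤ 1 := measureReal_le_one
  have h3 : 0 ≤ μ.real (B : Set E) := measureReal_nonneg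
  have h4 : 0 ≤ ν.real (B : Set E) := measureReal_nonneg
  simp only
  rw [abs_le]; constructor <;> linarith

end

/-! ### The ends of the expanding interval -/

theorem kappaLow_pos : 0 < kappaLow (1 / 2) 1 := by
  unfold kappaLow; norm_num

theorem kappaUp_pos : 0 < kappaUp (1 / 2) 1 := by
  unfold kappaUp; norm_num

theorem kappaUp_le : kappaUp (1 / 2) 1 ≤ 0.02 := by
  unfold kappaUp
  have := min_le_right (min ((3.9 - 1 : ℝ) / ((1 + 3.94) * (8 * (1 / 2) + 4 * 1 + 3.9)))
    (1 / (2 * (2 * (1 / 2) + 1 + 2)))) 0.04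
  linarith

theorem alphaLow_pos {n : ℕ} (hn : 0 < n) : 0 < alphaLow n :=
  Real.rpow_pos_of_pos (by exact_mod_cast hn) _

theorem tendsto_alphaLow : Tendsto alphaLow atTop (𝓝 0) :=
  (tendsto_rpow_neg_atTop kappaLow_pos).comp tendsto_natCast_atTop_atTop

theorem tendsto_alphaUp : Tendsto alphaUp atTop atTop :=
  (tendsto_rpow_atTop kappaUp_pos).comp tendsto_natCast_atTop_atTop

theorem one_le_alphaUp {n : ℕ} (hn : 0 < n) : 1 ≤ alphaUp n :=
  Real.one_le_rpow (by exact_mod_cast hn) kappaUp_pos.le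

theorem alphaUp_le {n : ℕ} (hn : 0 < n) : alphaUp n ≤ (n : ℝ) ^ (0.02 : ℝ) :=
  Real.rpow_le_rpow_of_exponent_le (by exact_mod_cast hn) kappaUp_le

theorem eventually_two_mul_alphaUp_le : ∀ᶠ n : ℕ in atTop, 2 * alphaUp n ≤ n := by
  have h := tendsto_natCast_atTop_atTop.eventually
    (tendsto_rpow_sub_mul_atBot (c := 1 / 2) (C₃ := 0.02) (by norm_num) (by norm_num))
  filter_upwards [h, eventually_gt_atTop 0] with n h1 h2
  have := alphaUp_le h2
  linarith

theorem tendsto_sqrt_mul_alphaUp_sq : Tendsto (fun n : ℕ => √(n : ℝ) * (alphaUp n ^ 2 / n))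
    atTop (𝓝 0) := by
  have h : Tendsto (fun n : ℕ => (n : ℝ) ^ (-0.46 : ℝ)) atTop (𝓝 0) :=
    (tendsto_rpow_neg_atTop (show (0:ℝ) < 0.46 by norm_num)).comp tendsto_natCast_atTop_atTop
  refine squeeze_zero' (Eventually.of_forall fun n => by positivity) ?_ h
  filter_upwards [eventually_gt_atTop 0] with n hn
  have hn' : (0:ℝ) < n := by exact_mod_cast hn
  have h1 : alphaUp n ^ 2 ≤ (n : ℝ) ^ (0.04 : ℝ) := by
    have h0 : (0:ℝ) ≤ alphaUp n := le_trans zero_le_one (one_le_alphaUp hn)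
    calc alphaUp n ^ 2 ≤ ((n : ℝ) ^ (0.02 : ℝ)) ^ 2 := by gcongr; exact alphaUp_le hn
      _ = (n : ℝ) ^ (0.04 : ℝ) := by rw [← Real.rpow_mul_natCast hn'.le]; norm_num
  calc √(n : ℝ) * (alphaUp n ^ 2 / n) ≤ √(n : ℝ) * ((n : ℝ) ^ (0.04 : ℝ) / n) := by gcongr
    _ = (n : ℝ) ^ (1 / 2 : ℝ) * ((n : ℝ) ^ (0.04 : ℝ) / (n : ℝ) ^ (1 : ℝ)) := by
        rw [Real.sqrt_eq_rpow, Real.rpow_one]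
    _ = (n : ℝ) ^ (-0.46 : ℝ) := by
        rw [← Real.rpow_sub hn', ← Real.rpow_add hn']; norm_num

/-! ### Extension of the priors by zero -/

/-- The conditional prior, extended by zero. -/
noncomputable def condPrior (πc : ℝ → ℝ → ℝ) (θ α : ℝ) : ℝ := if 0 < θ ∧ 0 < α then πc θ α else 0

/-- The marginal prior, extended by zero. -/
noncomputable def margPrior (πm : ℝ → ℝ) (α : ℝ) : ℝ := if 0 < α then πm α else 0

section
variable {θ₀ α₀ : ℝ} {πc : ℝ → ℝ → ℝ} {πm : ℝ → ℝ}

theorem condPrior_of_pos {θ α : ℝ} (hθ : 0 < θ) (hα : 0 < α) : condPrior πc θ α = πc θ α :=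
  if_pos ⟨hθ, hα⟩

theorem margPrior_of_pos {α : ℝ} (hα : 0 < α) : margPrior πm α = πm α := if_pos hα

theorem condPrior_nonneg (h1 : RegularCondPrior θ₀ πc) (θ α : ℝ) : 0 ≤ condPrior πc θ α := by
  unfold condPrior
  split_ifs with h
  · exact h1.nonneg _ h.1 _ h.2
  · exact le_rfl

theorem margPrior_nonneg (h3 : MarginalPriorTails θ₀ α₀ πc πm) (α : ℝ) : 0 ≤ margPrior πm α := by
  unfold margPrior
  split_ifs with h
  · exact h3.nonneg _ h
  · exact le_rfl

theorem measurable_margPrior (h3 : MarginalPriorTails θ₀ α₀ πc πm) : Measurable (margPrior πm) := by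
  have := (h3.continuousOn).measurable_piecewise (g := fun _ => (0:ℝ)) continuousOn_const
    measurableSet_Ioi
  convert this using 1
  ext α
  simp [margPrior, Set.piecewise]

theorem measurable_condPrior (h1 : RegularCondPrior θ₀ πc) :
    Measurable (Function.uncurry (condPrior πc)) := by
  have hm : Measurable (Function.uncurry fun x y => πc (Real.exp x) (Real.exp y)) := by
    refine measurable_uncurry_of_continuous_of_measurable (fun y => ?_) fun x => ?_
    · exact (h1.contDiffOn _ (Real.exp_pos y)).continuousOn.comp_continuous Real.continuous_exp
        fun x => Real.exp_pos x
    · exact ((h1.continuousOn _ (Real.exp_pos x)).comp_continuous Real.continuous_exp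
        fun x => Real.exp_pos x).measurable
  have h2 : Measurable fun q : ℝ × ℝ => πc (Real.exp (Real.log q.1)) (Real.exp (Real.log q.2)) :=
    hm.comp (f := fun q : ℝ × ℝ => (Real.log q.1, Real.log q.2)) (by fun_prop)
  have hs : MeasurableSet {q : ℝ × ℝ | 0 < q.1 ∧ 0 < q.2} :=
    (measurableSet_lt measurable_const measurable_fst).inter
      (measurableSet_lt measurable_const measurable_snd)
  convert h2.indicator hs using 1
  ext ⟨θ, α⟩
  by_cases h : 0 < θ ∧ 0 < α
  · rw [indicator_of_mem (by exact h)]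
    simp [condPrior, h, Real.exp_log]
  · rw [indicator_of_notMem (by exact h)]
    simp [condPrior, h]

theorem measurable_condPrior_left (h1 : RegularCondPrior θ₀ πc) (α : ℝ) :
    Measurable fun θ => condPrior πc θ α :=
  (measurable_condPrior h1).comp (f := fun θ => (θ, α)) (by fun_prop)

theorem measurable_condPrior_right (h1 : RegularCondPrior θ₀ πc) (θ : ℝ) :
    Measurable (condPrior πc θ) :=
  (measurable_condPrior h1).comp (f := fun α => (θ, α)) (by fun_prop)

theorem lintegral_condPrior (h1 : RegularCondPrior θ₀ πc) {α : ℝ} (hα : 0 < α) :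
    ∫⁻ θ, ENNReal.ofReal (condPrior πc θ α) = 1 := by
  have e : (fun θ => ENNReal.ofReal (condPrior πc θ α))
      = (Ioi (0:ℝ)).indicator fun θ => ENNReal.ofReal (πc θ α) := by
    ext θ
    by_cases h : 0 < θ <;> simp [condPrior, h, hα]
  rw [e, lintegral_indicator measurableSet_Ioi]
  have hi : IntegrableOn (fun θ => πc θ α) (Ioi 0) := by
    by_contra h
    have := h1.integral_eq_one α hα
    rw [integral_undef h] at this
    exact zero_ne_one this
  rw [← ofReal_integral_eq_lintegral_ofReal hi, h1.integral_eq_one α hα, ENNReal.ofReal_one]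
  filter_upwards [ae_restrict_mem measurableSet_Ioi] with θ hθ
  exact h1.nonneg θ hθ α hα

/-- The prior density of `α` at `θ₀`, up to a constant. -/
noncomputable def jointPrior (θ₀ : ℝ) (πc : ℝ → ℝ → ℝ) (πm : ℝ → ℝ) (α : ℝ) : ℝ :=
  condPrior πc θ₀ α * margPrior πm α

theorem jointPrior_nonneg (h1 : RegularCondPrior θ₀ πc) (h3 : MarginalPriorTails θ₀ α₀ πc πm)
    (α : ℝ) : 0 ≤ jointPrior θ₀ πc πm α :=
  mul_nonneg (condPrior_nonneg h1 _ _) (margPrior_nonneg h3 _)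

theorem measurable_jointPrior (h1 : RegularCondPrior θ₀ πc) (h3 : MarginalPriorTails θ₀ α₀ πc πm) :
    Measurable (jointPrior θ₀ πc πm) :=
  (measurable_condPrior_right h1 θ₀).mul (measurable_margPrior h3)

theorem jointPrior_of_nonpos {α : ℝ} (hα : α ≤ 0) : jointPrior θ₀ πc πm α = 0 := by
  simp [jointPrior, margPrior, not_lt.2 hα]

theorem lintegral_sqrt_jointPrior_lt_top (hθ₀ : 0 < θ₀) (h3 : MarginalPriorTails θ₀ α₀ πc πm) :
    ∫⁻ α, ENNReal.ofReal (√(2 * α) * jointPrior θ₀ πc πm α) < ⊤ := by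
  have e : (fun α => ENNReal.ofReal (√(2 * α) * jointPrior θ₀ πc πm α))
      = (Ioi (0:ℝ)).indicator fun α => ENNReal.ofReal (√2 * (√α * πc θ₀ α * πm α)) := by
    ext α
    by_cases h : 0 < α
    · simp only [jointPrior, condPrior, margPrior, h, hθ₀, mem_Ioi, indicator_of_mem, and_self,
        if_true]
      rw [Real.sqrt_mul (by norm_num)]
      ring_nf
    · simp [jointPrior, margPrior, h]
  rw [e, lintegral_indicator measurableSet_Ioi]
  exact (h3.integrable_sqrt_joint.const_mul √2).lintegral_lt_top

end

/-! ### Convergence of the unnormalized densities -/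

section
variable {ι : Type*} {l : Filter ι} {ν : ι → ℕ} {S b w : ι → ℝ}
  {θ₀ α₀ K w0 : ℝ} {πc : ℝ → ℝ → ℝ} {πm : ℝ → ℝ}

/-- The unnormalized profile posterior and tilted normal distribution merge in `L¹`. -/
theorem tendsto_lintegral_profileFun_sub_tiltFun [l.IsCountablyGenerated] (hθ₀ : 0 < θ₀) (h1 : RegularCondPrior θ₀ πc)
    (h3 : MarginalPriorTails θ₀ α₀ πc πm) (hν : Tendsto ν l atTop)
    (hb : ∀ᶠ i in l, 0 ≤ b i ∧ b i ≤ K) (hw0 : 0 < w0) (hw : ∀ᶠ i in l, w0 ≤ w i ∧ w i ≤ K) :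
    Tendsto (fun i => ∫⁻ α, ENNReal.ofReal (|profileFun (ν i) (b i) (w i) α
      - tiltFun (b i) (w i) α| * jointPrior θ₀ πc πm α)) l (𝓝 0) := by
  have hn : Tendsto (fun i => (ν i : ℝ)) l atTop := tendsto_natCast_atTop_atTop.comp hν
  set C := Real.exp (1 / (4 * w0))
  have hzero : ∫⁻ _ : ℝ, (0 : ENNReal) = 0 := by simp
  rw [← hzero]
  have hb' : ∀ᶠ i in l, |b i| ≤ K := hb.mono fun i h => abs_le.2 ⟨by linarith [h.1, h.2], h.2⟩
  have hw' : ∀ᶠ i in l, |w i| ≤ K := hw.mono fun i h => abs_le.2 ⟨by linarith [h.1, h.2], h.2⟩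
  refine tendsto_lintegral_filter_of_dominated_convergence
    (fun α => ENNReal.ofReal (2 * C) * ENNReal.ofReal (√(2 * α) * jointPrior θ₀ πc πm α))
    ?_ ?_ ?_ ?_
  · refine Eventually.of_forall fun i => ?_
    have := measurable_profileFun (ν i) (b i) (w i)
    have := measurable_tiltFun (b i) (w i)
    have := measurable_jointPrior h1 h3
    fun_prop
  · filter_upwards [hb, hw, hn.eventually_ge_atTop (1 / w0)] with i hbi hwi hni
    refine ae_of_all _ fun α => ?_
    rcases le_or_gt α 0 with hα | hα
    · simp [jointPrior_of_nonpos hα]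
    · rw [← ENNReal.ofReal_mul (by positivity)]
      apply ENNReal.ofReal_le_ofReal
      have e1 := profileFun_le hbi.1 hw0 hwi.1 hni hα
      have e2 := tiltFun_le hbi.1 hw0 hwi.1 hα
      have e3 := profileFun_nonneg (ν i) (b i) (w i) α
      have e4 := tiltFun_nonneg (b i) (w i) α
      rw [← mul_assoc]
      refine mul_le_mul_of_nonneg_right ?_ (jointPrior_nonneg h1 h3 α)
      rw [abs_le]; constructor <;> nlinarith
  · exact (by
      rw [lintegral_const_mul']
      · exact ENNReal.mul_ne_top ENNReal.ofReal_ne_top (lintegral_sqrt_jointPrior_lt_top hθ₀ h3).ne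
      · exact ENNReal.ofReal_ne_top)
  · refine ae_of_all _ fun α => ?_
    rcases le_or_gt α 0 with hα | hα
    · simp only [jointPrior_of_nonpos hα, mul_zero, ENNReal.ofReal_zero]
      exact tendsto_const_nhds
    · have := ENNReal.tendsto_ofReal
        ((tendsto_profileFun_sub_tiltFun hn hb' hw' hα).abs.mul_const (jointPrior θ₀ πc πm α))
      simpa using this

theorem tendsto_sqrt_mul_thetaFun_sub (hν : Tendsto ν l atTop) (hα₀ : 0 < α₀)
    (hS : ∀ᶠ i in l, |S i| ≤ K) (hb : ∀ᶠ i in l, |b i| ≤ K) (hw : ∀ᶠ i in l, |w i| ≤ K) {α : ι → ℝ}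
    (hα : ∀ᶠ i in l, α i ∈ Ioc 0 (alphaUp (ν i))) :
    Tendsto (fun i => √(ν i : ℝ) * (thetaFun (ν i) (S i) (b i) (w i) (α i)
      - thetaFun (ν i) (S i) (b i) (w i) α₀)) l (𝓝 0) := by
  have h1 := (tendsto_sqrt_mul_alphaUp_sq.comp hν).const_mul (2 * (K * (2 + 2 * K)))
  rw [mul_zero] at h1
  refine squeeze_zero_norm' ?_ h1
  filter_upwards [hS, hb, hw, hα, hν.eventually eventually_two_mul_alphaUp_le,
    hν.eventually_gt_atTop 0, (tendsto_alphaUp.comp hν).eventually_ge_atTop α₀]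
    with i hSi hbi hwi hαi h2 h3 h4
  change α₀ ≤ alphaUp (ν i) at h4
  have h5 := abs_thetaFun_sub_le hαi.1 hαi.2 (one_le_alphaUp h3) h2 hSi hbi hwi
  have h6 := abs_thetaFun_sub_le hα₀ h4 (one_le_alphaUp h3) h2 hSi hbi hwi
  rw [Real.norm_eq_abs, abs_mul, abs_of_nonneg (Real.sqrt_nonneg _)]
  have h7 := abs_sub_le (thetaFun (ν i) (S i) (b i) (w i) (α i)) (S i / 2)
    (thetaFun (ν i) (S i) (b i) (w i) α₀)
  rw [abs_sub_comm (S i / 2)] at h7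
  set e := alphaUp (ν i) ^ 2 / (ν i : ℝ) with he
  calc _ ≤ √(ν i : ℝ) * (2 * (K * (2 + 2 * K) * e)) := by gcongr; linarith
    _ = _ := by simp only [Function.comp_apply, ← he]; ring

/-- The `L¹` distance between the conditional posterior of `θ` given `α` and its normal
approximation, up to normalization. -/
noncomputable def thetaDist (θ₀ α₀ : ℝ) (πc : ℝ → ℝ → ℝ) (n S b w α : ℝ) : ENNReal :=
  ∫⁻ θ, ENNReal.ofReal |√n * thetaKer n (thetaFun n S b w α) θ *
    (condPrior πc θ α / condPrior πc θ₀ α)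
      - √n * Real.exp (-(n * (θ - thetaFun n S b w α₀) ^ 2 / (4 * θ₀ ^ 2)))|

theorem tendsto_iSup_thetaDist [l.IsCountablyGenerated] (hθ₀ : 0 < θ₀) (hα₀ : 0 < α₀) (h1 : RegularCondPrior θ₀ πc)
    (h2 : CondPriorGrowth θ₀ πc) (hν : Tendsto ν l atTop)
    (hS : ∀ᶠ i in l, |S i| ≤ K) (hb : ∀ᶠ i in l, |b i| ≤ K) (hw : ∀ᶠ i in l, |w i| ≤ K)
    (ht0 : ∀ᶠ i in l, |√(ν i : ℝ) * (thetaFun (ν i) (S i) (b i) (w i) α₀ - θ₀)| ≤ K) :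
    Tendsto (fun i => ⨆ α ∈ Icc (alphaLow (ν i)) (alphaUp (ν i)),
      thetaDist θ₀ α₀ πc (ν i) (S i) (b i) (w i) α) l (𝓝 0) := by
  obtain ⟨C₁, C₂, C₃, hC₁, hC₂, hC₃, hC₁₂, hC₃', hgrow⟩ := h2
  set l' : Filter (ι × ℝ) :=
    comap Prod.fst l ⊓ 𝓟 {q | q.2 ∈ Icc (alphaLow (ν q.1)) (alphaUp (ν q.1))} with hl'
  have hfst : Tendsto Prod.fst l' l := tendsto_comap.mono_left inf_le_left
  have hmem : ∀ᶠ q in l', q.2 ∈ Icc (alphaLow (ν q.1)) (alphaUp (ν q.1)) :=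
    mem_inf_of_right (mem_principal_self _)
  have hmain : Tendsto (fun q : ι × ℝ => thetaDist θ₀ α₀ πc (ν q.1) (S q.1) (b q.1) (w q.1) q.2)
      l' (𝓝 0) := by
    have hν' : Tendsto (fun q : ι × ℝ => ν q.1) l' atTop := hν.comp hfst
    have hposα : ∀ᶠ q : ι × ℝ in l', 0 < q.2 := by
      filter_upwards [hmem, hν'.eventually_gt_atTop 0] with q h h0
      exact (alphaLow_pos h0).trans_le h.1
    have hθ₀' : ∀ α, 0 ≤ condPrior πc θ₀ α := condPrior_nonneg h1 θ₀
    refine tendsto_lintegral_thetaKer_sub (l := l') (C₁ := C₁) (C₃ := C₃)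
      (n := fun q => (ν q.1 : ℝ)) hθ₀
      (tendsto_natCast_atTop_atTop.comp hν') (by linarith) hC₃' (hfst.eventually ht0)
      (tendsto_sqrt_mul_thetaFun_sub hν' hα₀ (hfst.eventually hS) (hfst.eventually hb)
        (hfst.eventually hw) ?_)
      (fun q => (measurable_condPrior_left h1 q.2).div_const _)
      (fun q θ => div_nonneg (condPrior_nonneg h1 _ _) (hθ₀' _))
      (fun q θ hθ => by simp [condPrior, not_lt.2 hθ]) ?_ ?_
    · filter_upwards [hmem, hposα] with q h h0
      exact ⟨h0, h.2⟩
    · filter_upwards [hmem, hposα, hν'.eventually hgrow] with q h h0 hg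
      have hp : 0 < condPrior πc θ₀ q.2 := by
        rw [condPrior_of_pos hθ₀ h0]; exact h1.pos _ h0
      simp_rw [div_eq_mul_inv]
      have e : ∀ θ, ENNReal.ofReal (condPrior πc θ q.2 * (condPrior πc θ₀ q.2)⁻¹)
          = ENNReal.ofReal (condPrior πc θ q.2) * ENNReal.ofReal ((condPrior πc θ₀ q.2)⁻¹) :=
        fun θ => ENNReal.ofReal_mul (condPrior_nonneg h1 _ _)
      simp_rw [e]
      rw [lintegral_mul_const' _ _ ENNReal.ofReal_ne_top, lintegral_condPrior h1 h0, one_mul]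
      apply ENNReal.ofReal_le_ofReal
      have h5 := (hg q.2 h).2
      rw [condPrior_of_pos hθ₀ h0] at hp ⊢
      rw [← Real.exp_log hp, ← Real.exp_neg]
      apply Real.exp_le_exp.2
      linarith
    · filter_upwards [hmem, hposα, hν'.eventually hgrow] with q h h0 hg θ hθ
      have hp : 0 < πc θ₀ q.2 := h1.pos _ h0
      have hθm : θ ∈ Ioo (θ₀ / 2) (2 * θ₀) := by
        rw [abs_lt] at hθ
        constructor <;> linarith [hθ.1, hθ.2]
      have hθ0 : 0 < θ := by linarith [hθm.1]
      have h5 := exp_bounds_of_abs_deriv_log_le hθ₀ (h1.contDiffOn _ h0)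
        (fun θ hθ => h1.nonneg θ hθ _ h0) (fun θ hθ => ((hg q.2 h).1 θ hθ).1) hθm
      rw [condPrior_of_pos hθ₀ h0, condPrior_of_pos hθ0 h0, le_div_iff₀ hp, div_le_iff₀ hp]
      constructor
      · linarith [h5.1]
      · linarith [h5.2]
  rw [ENNReal.tendsto_nhds_zero] at hmain ⊢
  intro ε hε
  have h5 := hmain ε hε
  rw [hl', eventually_inf_principal, eventually_comap] at h5
  filter_upwards [h5] with i hi
  exact iSup₂_le fun α hα => hi (i, α) rfl hα

/-- The unnormalized joint posterior density, extended by zero. -/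
noncomputable def jointDensity (πc : ℝ → ℝ → ℝ) (πm : ℝ → ℝ) (n S b w : ℝ) (q : ℝ × ℝ) : ℝ :=
  √n * thetaKer n (thetaFun n S b w q.2) q.1 * condPrior πc q.1 q.2 * margPrior πm q.2 *
    profileFun n b w q.2

/-- The kernel of the limiting normal distribution of `θ`. -/
noncomputable def normalKer (θ₀ n t θ : ℝ) : ℝ :=
  √n * Real.exp (-(n * (θ - t) ^ 2 / (4 * θ₀ ^ 2)))

theorem measurable_normalKer (θ₀ n t : ℝ) : Measurable (normalKer θ₀ n t) := by
  unfold normalKer; fun_prop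

theorem normalKer_nonneg (θ₀ n t θ : ℝ) : 0 ≤ normalKer θ₀ n t θ := by
  unfold normalKer; positivity

theorem measurable_jointDensity (h1 : RegularCondPrior θ₀ πc)
    (h3 : MarginalPriorTails θ₀ α₀ πc πm) (n S b w : ℝ) :
    Measurable (jointDensity πc πm n S b w) := by
  have e1 := measurable_condPrior h1
  have e2 := measurable_margPrior h3
  have e3 := measurable_profileFun n b w
  have e4 : Measurable (thetaFun n S b w) := by
    unfold thetaFun innovRatio; fun_prop
  have e5 : Measurable fun q : ℝ × ℝ => condPrior πc q.1 q.2 := e1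
  unfold jointDensity thetaKer
  fun_prop

theorem jointDensity_nonneg (h1 : RegularCondPrior θ₀ πc)
    (h3 : MarginalPriorTails θ₀ α₀ πc πm) (n S b w : ℝ) (q : ℝ × ℝ) :
    0 ≤ jointDensity πc πm n S b w q :=
  mul_nonneg (mul_nonneg (mul_nonneg (mul_nonneg (Real.sqrt_nonneg _) (thetaKer_pos _ _ _).le)
    (condPrior_nonneg h1 _ _)) (margPrior_nonneg h3 _)) (profileFun_nonneg _ _ _ _)

theorem gaussianPDFReal_eq_normalKer (hθ₀ : 0 < θ₀) {n : ℝ} (hn : 0 < n) (t θ : ℝ) :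
    gaussianPDFReal t (2 * θ₀ ^ 2 / n).toNNReal θ = (2 * θ₀ * √Real.pi)⁻¹ * normalKer θ₀ n t θ := by
  unfold gaussianPDFReal normalKer
  rw [Real.coe_toNNReal _ (by positivity)]
  have e1 : √(2 * Real.pi * (2 * θ₀ ^ 2 / n)) = 2 * θ₀ * √Real.pi / √n := by
    rw [show 2 * Real.pi * (2 * θ₀ ^ 2 / n) = (2 * θ₀) ^ 2 * Real.pi / n by ring,
      Real.sqrt_div' _ hn.le, Real.sqrt_mul (by positivity), Real.sqrt_sq (by positivity)]
  rw [e1, inv_div, div_eq_inv_mul, mul_assoc]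
  congr 3
  field_simp
  ring_nf

theorem lintegral_normalKer (hθ₀ : 0 < θ₀) {n : ℝ} (hn : 0 < n) (t : ℝ) :
    ∫⁻ θ, ENNReal.ofReal (normalKer θ₀ n t θ) = ENNReal.ofReal (2 * θ₀ * √Real.pi) := by
  have hc : 0 < 2 * θ₀ * √Real.pi := by positivity
  have hv : (2 * θ₀ ^ 2 / n).toNNReal ≠ 0 := by
    rw [ne_eq, Real.toNNReal_eq_zero, not_le]; positivity
  have h := lintegral_gaussianPDFReal_eq_one t hv
  simp_rw [gaussianPDFReal_eq_normalKer hθ₀ hn t,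
    ENNReal.ofReal_mul (p := (2 * θ₀ * √Real.pi)⁻¹) (by positivity)] at h
  rw [lintegral_const_mul' _ _ ENNReal.ofReal_ne_top] at h
  have h2 : ENNReal.ofReal (2 * θ₀ * √Real.pi) * (ENNReal.ofReal (2 * θ₀ * √Real.pi)⁻¹ *
      ∫⁻ θ, ENNReal.ofReal (normalKer θ₀ n t θ)) = ENNReal.ofReal (2 * θ₀ * √Real.pi) := by
    rw [h, mul_one]
  rw [← mul_assoc, ← ENNReal.ofReal_mul hc.le, mul_inv_cancel₀ hc.ne', ENNReal.ofReal_one,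
    one_mul] at h2
  exact h2

/-- The integral over `θ` of the difference between the unnormalized joint posterior density and
its approximation. -/
noncomputable def sliceDist (θ₀ α₀ : ℝ) (πc : ℝ → ℝ → ℝ) (πm : ℝ → ℝ) (n S b w α : ℝ) : ENNReal :=
  ∫⁻ θ, ENNReal.ofReal |jointDensity πc πm n S b w (θ, α)
    - normalKer θ₀ n (thetaFun n S b w α₀) θ * (profileFun n b w α * jointPrior θ₀ πc πm α)|

theorem sliceDist_eq_mul (hθ₀ : 0 < θ₀) (h1 : RegularCondPrior θ₀ πc)
    (h3 : MarginalPriorTails θ₀ α₀ πc πm) {n S b w α : ℝ} (hα : 0 < α) :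
    sliceDist θ₀ α₀ πc πm n S b w α = ENNReal.ofReal (profileFun n b w α * jointPrior θ₀ πc πm α) *
      thetaDist θ₀ α₀ πc n S b w α := by
  unfold sliceDist thetaDist
  have h0 : 0 ≤ profileFun n b w α * jointPrior θ₀ πc πm α :=
    mul_nonneg (profileFun_nonneg _ _ _ _) (jointPrior_nonneg h1 h3 _)
  rw [← lintegral_const_mul' _ _ ENNReal.ofReal_ne_top]
  refine lintegral_congr fun θ => ?_
  rw [← ENNReal.ofReal_mul h0]
  congr 1
  rw [← abs_of_nonneg h0, ← abs_mul, abs_of_nonneg h0]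
  congr 1
  have hp : condPrior πc θ₀ α ≠ 0 := by
    rw [condPrior_of_pos hθ₀ hα]; exact (h1.pos _ hα).ne'
  unfold jointDensity normalKer jointPrior
  field_simp

theorem sliceDist_of_nonpos {n S b w α : ℝ} (hα : α ≤ 0) :
    sliceDist θ₀ α₀ πc πm n S b w α = 0 := by
  simp [sliceDist, jointDensity, jointPrior, margPrior, not_lt.2 hα]

theorem lintegral_jointDensity_le (h1 : RegularCondPrior θ₀ πc)
    (h3 : MarginalPriorTails θ₀ α₀ πc πm) {n S b w α : ℝ} (hα : 0 < α) (hn : 0 ≤ n)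
    (ht : 0 < thetaFun n S b w α) :
    ∫⁻ θ, ENNReal.ofReal (jointDensity πc πm n S b w (θ, α))
      ≤ ENNReal.ofReal (√n * (margPrior πm α * profileFun n b w α)) := by
  have h0 : 0 ≤ √n * (margPrior πm α * profileFun n b w α) :=
    mul_nonneg (Real.sqrt_nonneg _) (mul_nonneg (margPrior_nonneg h3 _) (profileFun_nonneg _ _ _ _))
  calc ∫⁻ θ, ENNReal.ofReal (jointDensity πc πm n S b w (θ, α))
      ≤ ∫⁻ θ, ENNReal.ofReal (√n * (margPrior πm α * profileFun n b w α)) *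
          ENNReal.ofReal (condPrior πc θ α) := by
        refine lintegral_mono fun θ => ?_
        rw [← ENNReal.ofReal_mul h0]
        apply ENNReal.ofReal_le_ofReal
        have e : jointDensity πc πm n S b w (θ, α) = thetaKer n (thetaFun n S b w α) θ *
            (√n * (margPrior πm α * profileFun n b w α) * condPrior πc θ α) := by
          unfold jointDensity; ring
        rw [e]
        rcases le_or_gt θ 0 with hθ | hθ
        · simp [condPrior, not_lt.2 hθ]
        · exact mul_le_of_le_one_left (mul_nonneg h0 (condPrior_nonneg h1 _ _))
            (thetaKer_le_one hn ht hθ)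
    _ = _ := by
        rw [lintegral_const_mul' _ _ ENNReal.ofReal_ne_top, lintegral_condPrior h1 hα, mul_one]

theorem sliceDist_le (hθ₀ : 0 < θ₀) (h1 : RegularCondPrior θ₀ πc)
    (h3 : MarginalPriorTails θ₀ α₀ πc πm) {n S b w α : ℝ} (hα : 0 < α) (hn : 0 < n)
    (ht : 0 < thetaFun n S b w α) :
    sliceDist θ₀ α₀ πc πm n S b w α
      ≤ ENNReal.ofReal (√n * (margPrior πm α * profileFun n b w α)) +
        ENNReal.ofReal (2 * θ₀ * √Real.pi) *
          ENNReal.ofReal (profileFun n b w α * jointPrior θ₀ πc πm α) := by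
  have h0 : 0 ≤ profileFun n b w α * jointPrior θ₀ πc πm α :=
    mul_nonneg (profileFun_nonneg _ _ _ _) (jointPrior_nonneg h1 h3 _)
  have hm : Measurable fun θ => ENNReal.ofReal (jointDensity πc πm n S b w (θ, α)) :=
    ((measurable_jointDensity h1 h3 n S b w).comp
      (f := fun θ : ℝ => (θ, α)) (by fun_prop)).ennreal_ofReal
  rw [← lintegral_normalKer hθ₀ hn (thetaFun n S b w α₀),
    ← lintegral_mul_const' _ _ ENNReal.ofReal_ne_top]
  refine le_trans ?_ (add_le_add (lintegral_jointDensity_le h1 h3 hα hn.le ht) le_rfl)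
  rw [← lintegral_add_left hm]
  refine lintegral_mono fun θ => ?_
  have e1 := jointDensity_nonneg h1 h3 n S b w (θ, α)
  have e2 := mul_nonneg (normalKer_nonneg θ₀ n (thetaFun n S b w α₀) θ) h0
  rw [← ENNReal.ofReal_mul (normalKer_nonneg _ _ _ _), ← ENNReal.ofReal_add e1 e2]
  apply ENNReal.ofReal_le_ofReal
  rw [abs_le]; constructor <;> linarith

end

section
variable {ι : Type*} {l : Filter ι} {ν : ι → ℕ} {S b w : ι → ℝ}
  {θ₀ α₀ K w0 : ℝ} {πc : ℝ → ℝ → ℝ} {πm : ℝ → ℝ}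

theorem innovRatio_pos {n b w δ : ℝ} (hb : 0 ≤ b) (hw : 0 < w) (hn : 0 < n) (hδ : 0 ≤ δ)
    (hδ1 : δ ≤ 1) : 0 < innovRatio n b w δ := by
  unfold innovRatio
  have h1 := mul_nonneg hb hδ
  have h2 : 0 < n * w := by positivity
  rcases hδ.eq_or_lt with rfl | h
  · simp
  · have : 0 < n * w * δ ^ 2 := by positivity
    nlinarith

theorem thetaFun_pos {n S b w α : ℝ} (hS : 0 < S) (hb : 0 ≤ b) (hw : 0 < w)
    (hn : 0 < n) (hα : 0 < α) : 0 < thetaFun n S b w α := by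
  have h1 := innovRatio_pos hb hw hn (one_sub_exp_neg_nonneg (x := α / n) (by positivity))
    (one_sub_exp_neg_le_one _)
  have h2 := one_sub_exp_neg_pos (x := 2 * (α / n)) (by positivity)
  unfold thetaFun
  positivity

theorem tendsto_lintegral_tails_margPrior (h3 : MarginalPriorTails θ₀ α₀ πc πm)
    (hν : Tendsto ν l atTop) :
    Tendsto (fun i => ∫⁻ α, {α : ℝ | 0 < α ∧ α ∉ Icc (alphaLow (ν i)) (alphaUp (ν i))}.indicator
      (fun α => ENNReal.ofReal (√(ν i : ℝ) * (√(2 * α) * margPrior πm α))) α) l (𝓝 0) := by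
  have h1 := ((h3.left_tail.add h3.right_tail).const_mul √2).comp hν
  have h2 := ENNReal.tendsto_ofReal h1
  simp only [add_zero, mul_zero, ENNReal.ofReal_zero] at h2
  refine h2.congr' ?_
  filter_upwards [hν.eventually_gt_atTop 0] with i hi
  set n := ν i
  have hset : {α : ℝ | 0 < α ∧ α ∉ Icc (alphaLow n) (alphaUp n)}
      = Ioo 0 (alphaLow n) ∪ Ioi (alphaUp n) := by
    ext α
    have := one_le_alphaUp hi
    simp only [mem_ofPred_eq, mem_Icc, mem_union, mem_Ioo, mem_Ioi, not_and_or, not_le]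
    constructor
    · rintro ⟨h, h' | h'⟩
      · exact Or.inl ⟨h, h'⟩
      · exact Or.inr h'
    · rintro (⟨h, h'⟩ | h)
      · exact ⟨h, Or.inl h'⟩
      · exact ⟨by linarith, Or.inr h⟩
  have hlow : alphaLow n ≤ 1 := by
    refine Real.rpow_le_one_of_one_le_of_nonpos (by exact_mod_cast hi) ?_
    linarith [kappaLow_pos]
  have hup := one_le_alphaUp hi
  have hdisj : Disjoint (Ioo 0 (alphaLow n)) (Ioi (alphaUp n)) := by
    rw [Set.disjoint_left]
    intro x hx hx'
    simp only [mem_Ioo, mem_Ioi] at hx hx'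
    linarith [hx.2]
  have hsub1 : Ioo 0 (alphaLow n) ⊆ Ioi (0 : ℝ) := fun x hx => hx.1
  have hsub2 : Ioi (alphaUp n) ⊆ Ioi (0 : ℝ) := Ioi_subset_Ioi (by linarith)
  have hI := h3.integrable_sqrt
  have hI' : ∀ s : Set ℝ, MeasurableSet s → s ⊆ Ioi 0 →
      ∫⁻ α in s, ENNReal.ofReal (√(n : ℝ) * (√(2 * α) * margPrior πm α))
        = ENNReal.ofReal (√2 * (√(n : ℝ) * ∫ α in s, √α * πm α)) := by
    intro s hs hs0
    rw [← mul_assoc, ← integral_const_mul,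
      ofReal_integral_eq_lintegral_ofReal ((hI.mono_set hs0).const_mul _)]
    · refine setLIntegral_congr_fun hs fun α hα => ?_
      rw [margPrior_of_pos (hs0 hα), Real.sqrt_mul (by norm_num)]
      ring_nf
    · filter_upwards [ae_restrict_mem hs] with α hα
      exact mul_nonneg (by positivity) (mul_nonneg (Real.sqrt_nonneg _) (h3.nonneg _ (hs0 hα)))
  rw [hset, lintegral_indicator (measurableSet_Ioo.union measurableSet_Ioi),
    lintegral_union measurableSet_Ioi hdisj, hI' _ measurableSet_Ioo hsub1,
    hI' _ measurableSet_Ioi hsub2, ← ENNReal.ofReal_add, ← mul_add]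
  · rfl
  · exact mul_nonneg (Real.sqrt_nonneg _) (mul_nonneg (Real.sqrt_nonneg _)
      (setIntegral_nonneg measurableSet_Ioo fun x hx =>
        mul_nonneg (Real.sqrt_nonneg _) (h3.nonneg _ (hsub1 hx))))
  · exact mul_nonneg (Real.sqrt_nonneg _) (mul_nonneg (Real.sqrt_nonneg _)
      (setIntegral_nonneg measurableSet_Ioi fun x hx =>
        mul_nonneg (Real.sqrt_nonneg _) (h3.nonneg _ (hsub2 hx))))

theorem measurableSet_outside (ν : ℕ) :
    MeasurableSet {α : ℝ | 0 < α ∧ α ∉ Icc (alphaLow ν) (alphaUp ν)} :=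
  measurableSet_Ioi.inter measurableSet_Icc.compl

theorem tendsto_lintegral_tails_jointPrior [l.IsCountablyGenerated] (hθ₀ : 0 < θ₀)
    (h1 : RegularCondPrior θ₀ πc)
    (h3 : MarginalPriorTails θ₀ α₀ πc πm) (hν : Tendsto ν l atTop) :
    Tendsto (fun i => ∫⁻ α, {α : ℝ | 0 < α ∧ α ∉ Icc (alphaLow (ν i)) (alphaUp (ν i))}.indicator
      (fun α => ENNReal.ofReal (√(2 * α) * jointPrior θ₀ πc πm α)) α) l (𝓝 0) := by
  have hzero : ∫⁻ _ : ℝ, (0 : ENNReal) = 0 := by simp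
  rw [← hzero]
  have hm := measurable_jointPrior h1 h3
  refine tendsto_lintegral_filter_of_dominated_convergence
    (fun α => ENNReal.ofReal (√(2 * α) * jointPrior θ₀ πc πm α)) ?_ ?_
    (lintegral_sqrt_jointPrior_lt_top hθ₀ h3).ne ?_
  · exact Eventually.of_forall fun i =>
      Measurable.indicator (by fun_prop) (measurableSet_outside _)
  · exact Eventually.of_forall fun i => ae_of_all _ fun α => indicator_le_self _ _ _
  · refine ae_of_all _ fun α => tendsto_const_nhds.congr' ?_
    rcases le_or_gt α 0 with hα | hα
    · refine Eventually.of_forall fun i => (indicator_of_notMem ?_ _).symm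
      simp [not_lt.2 hα]
    · filter_upwards [(tendsto_alphaUp.comp hν).eventually_ge_atTop α,
        (tendsto_alphaLow.comp hν).eventually_le_const hα] with i h4 h5
      refine (indicator_of_notMem ?_ _).symm
      simp only [mem_ofPred_eq, not_and, not_not]
      exact fun _ => ⟨h5, h4⟩

/-- The unnormalized joint posterior merges in `L¹` with the product of the normal distribution and
the unnormalized profile posterior. -/
theorem tendsto_lintegral_sliceDist [l.IsCountablyGenerated] (hθ₀ : 0 < θ₀) (hα₀ : 0 < α₀)
    (h1 : RegularCondPrior θ₀ πc) (h2 : CondPriorGrowth θ₀ πc)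
    (h3 : MarginalPriorTails θ₀ α₀ πc πm) (hν : Tendsto ν l atTop)
    (hS : ∀ᶠ i in l, 0 < S i ∧ S i ≤ K) (hb : ∀ᶠ i in l, 0 ≤ b i ∧ b i ≤ K) (hw0 : 0 < w0)
    (hw : ∀ᶠ i in l, w0 ≤ w i ∧ w i ≤ K)
    (ht0 : ∀ᶠ i in l, |√(ν i : ℝ) * (thetaFun (ν i) (S i) (b i) (w i) α₀ - θ₀)| ≤ K) :
    Tendsto (fun i => ∫⁻ α, sliceDist θ₀ α₀ πc πm (ν i) (S i) (b i) (w i) α) l (𝓝 0) := by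
  have hn : Tendsto (fun i => (ν i : ℝ)) l atTop := tendsto_natCast_atTop_atTop.comp hν
  have hS' : ∀ᶠ i in l, |S i| ≤ K := hS.mono fun i h => abs_le.2 ⟨by linarith [h.1, h.2], h.2⟩
  have hb' : ∀ᶠ i in l, |b i| ≤ K := hb.mono fun i h => abs_le.2 ⟨by linarith [h.1, h.2], h.2⟩
  have hw' : ∀ᶠ i in l, |w i| ≤ K := hw.mono fun i h => abs_le.2 ⟨by linarith [h.1, h.2], h.2⟩
  set C := Real.exp (1 / (4 * w0))
  set c := ENNReal.ofReal (2 * θ₀ * √Real.pi)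
  set M := ∫⁻ α, ENNReal.ofReal (√(2 * α) * jointPrior θ₀ πc πm α) with hM
  set sJ : ι → ENNReal := fun i => ⨆ α ∈ Icc (alphaLow (ν i)) (alphaUp (ν i)),
      thetaDist θ₀ α₀ πc (ν i) (S i) (b i) (w i) α with hsJ
  have t1 : Tendsto sJ l (𝓝 0) := tendsto_iSup_thetaDist hθ₀ hα₀ h1 h2 hν hS' hb' hw' ht0
  have t2 := tendsto_lintegral_tails_margPrior h3 hν
  have t3 := tendsto_lintegral_tails_jointPrior hθ₀ h1 h3 hν
  have hMtop : M ≠ ⊤ := (lintegral_sqrt_jointPrior_lt_top hθ₀ h3).ne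
  have hC : ENNReal.ofReal C ≠ ⊤ := ENNReal.ofReal_ne_top
  have hc : c ≠ ⊤ := ENNReal.ofReal_ne_top
  have T := ((ENNReal.Tendsto.const_mul (a := ENNReal.ofReal C)
    (ENNReal.Tendsto.mul_const (b := M) t1 (Or.inr hMtop)) (Or.inr hC)).add
    (ENNReal.Tendsto.const_mul (a := ENNReal.ofReal C) t2 (Or.inr hC))).add
    (ENNReal.Tendsto.const_mul (a := ENNReal.ofReal C * c) t3
      (Or.inr (ENNReal.mul_ne_top hC hc)))
  simp only [zero_mul, mul_zero, add_zero] at T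
  refine tendsto_of_tendsto_of_tendsto_of_le_of_le' tendsto_const_nhds T
    (Eventually.of_forall fun _ => zero_le) ?_
  filter_upwards [hS, hb, hw, hn.eventually_ge_atTop (1 / w0), hν.eventually_gt_atTop 0]
    with i hSi hbi hwi hni hni0
  have hni' : (0:ℝ) < ν i := by exact_mod_cast hni0
  have mj := measurable_jointPrior h1 h3
  have mm := measurable_margPrior h3
  have m2 : Measurable ({α : ℝ | 0 < α ∧ α ∉ Icc (alphaLow (ν i)) (alphaUp (ν i))}.indicator
      (fun α => ENNReal.ofReal (√(ν i : ℝ) * (√(2 * α) * margPrior πm α)))) :=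
    Measurable.indicator (by fun_prop) (measurableSet_outside _)
  have m3 : Measurable ({α : ℝ | 0 < α ∧ α ∉ Icc (alphaLow (ν i)) (alphaUp (ν i))}.indicator
      (fun α => ENNReal.ofReal (√(2 * α) * jointPrior θ₀ πc πm α))) :=
    Measurable.indicator (by fun_prop) (measurableSet_outside _)
  have m1 : Measurable fun α => ENNReal.ofReal (√(2 * α) * jointPrior θ₀ πc πm α) := by fun_prop
  rw [hM, ← lintegral_const_mul _ m1, ← lintegral_const_mul _ (m1.const_mul _),
    ← lintegral_const_mul _ m2, ← lintegral_const_mul _ m3,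
    ← lintegral_add_left ((m1.const_mul _).const_mul _),
    ← lintegral_add_right _ (m3.const_mul _)]
  refine lintegral_mono fun α => ?_
  rcases le_or_gt α 0 with hα | hα
  · rw [sliceDist_of_nonpos hα]; exact zero_le
  have hprof := profileFun_le hbi.1 hw0 hwi.1 hni hα
  have hjp := jointPrior_nonneg h1 h3 α
  have hmp := margPrior_nonneg h3 α
  have hgj : ENNReal.ofReal (profileFun (ν i) (b i) (w i) α * jointPrior θ₀ πc πm α)
      ≤ ENNReal.ofReal C * ENNReal.ofReal (√(2 * α) * jointPrior θ₀ πc πm α) := by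
    rw [← ENNReal.ofReal_mul (Real.exp_pos _).le, ← mul_assoc]
    exact ENNReal.ofReal_le_ofReal (mul_le_mul_of_nonneg_right hprof hjp)
  by_cases hI : α ∈ Icc (alphaLow (ν i)) (alphaUp (ν i))
  · rw [sliceDist_eq_mul hθ₀ h1 h3 hα, add_assoc]
    refine le_trans ?_ le_self_add
    have hJ : thetaDist θ₀ α₀ πc (ν i) (S i) (b i) (w i) α ≤ sJ i :=
      le_iSup₂ (f := fun α (_ : α ∈ Icc (alphaLow (ν i)) (alphaUp (ν i))) =>
        thetaDist θ₀ α₀ πc (ν i) (S i) (b i) (w i) α) α hI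
    calc _ ≤ ENNReal.ofReal C * ENNReal.ofReal (√(2 * α) * jointPrior θ₀ πc πm α) * sJ i :=
          mul_le_mul' hgj hJ
      _ = _ := by ring
  · have hout : α ∈ {α : ℝ | 0 < α ∧ α ∉ Icc (alphaLow (ν i)) (alphaUp (ν i))} := ⟨hα, hI⟩
    rw [indicator_of_mem hout, indicator_of_mem hout, add_assoc]
    refine le_trans ?_ le_add_self
    refine (sliceDist_le hθ₀ h1 h3 hα hni'
      (thetaFun_pos hSi.1 hbi.1 (hw0.trans_le hwi.1) hni' hα)).trans (add_le_add ?_ ?_)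
    · rw [← ENNReal.ofReal_mul (Real.exp_pos _).le]
      apply ENNReal.ofReal_le_ofReal
      calc √(ν i : ℝ) * (margPrior πm α * profileFun (ν i) (b i) (w i) α)
          ≤ √(ν i : ℝ) * (margPrior πm α * (C * √(2 * α))) := by gcongr
        _ = _ := by ring
    · calc _ ≤ c * (ENNReal.ofReal C * ENNReal.ofReal (√(2 * α) * jointPrior θ₀ πc πm α)) := by
            gcongr
        _ = _ := by ring

end

/-! ### Total masses -/

section
variable {θ₀ α₀ : ℝ} {πc : ℝ → ℝ → ℝ} {πm : ℝ → ℝ}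

theorem exists_profileFun_le {n b w : ℝ} (hn : 0 < n) (hb : 0 ≤ b) (hw : 0 < w) :
    ∃ C : ℝ, 0 < C ∧ ∀ α > 0, profileFun n b w α ≤ C * √(2 * α) := by
  set m := min (1 / 2) (n * w / 4) with hm
  have hm0 : 0 < m := lt_min (by norm_num) (by positivity)
  refine ⟨Real.exp (-(n / 2) * Real.log m), Real.exp_pos _, fun α hα => ?_⟩
  unfold profileFun
  rw [mul_comm (Real.exp (-(n / 2) * Real.log m))]
  refine mul_le_mul (sqrt_mul_sqrt_one_sub_exp_le hn) ?_ (Real.exp_pos _).le (Real.sqrt_nonneg _)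
  apply Real.exp_le_exp.2
  have h0 := one_sub_exp_neg_nonneg (x := α / n) (by positivity)
  have h1 := one_sub_exp_neg_le_one (α / n)
  set δ := 1 - Real.exp (-(α / n))
  have h2 : m ≤ innovRatio n b w δ := by
    unfold innovRatio
    have h3 := mul_nonneg hb h0
    have h4 : 0 < n * w := by positivity
    rcases le_total δ (1 / 2) with h | h
    · have := min_le_left (1 / 2) (n * w / 4)
      nlinarith [mul_nonneg h4.le (sq_nonneg δ)]
    · have := min_le_right (1 / 2) (n * w / 4)
      have h5 : 1 / 4 ≤ δ ^ 2 := by nlinarith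
      nlinarith [mul_le_mul_of_nonneg_left h5 h4.le]
  have h3 := Real.log_le_log hm0 h2
  nlinarith

theorem profileFun_pos {n b w α : ℝ} (hn : 0 < n) (hα : 0 < α) : 0 < profileFun n b w α := by
  have := one_sub_exp_neg_pos (x := 2 * (α / n)) (by positivity)
  unfold profileFun
  positivity

theorem tiltFun_pos {b w α : ℝ} (hα : 0 < α) : 0 < tiltFun b w α := by
  unfold tiltFun
  positivity

theorem margPrior_eventually_pos (hα₀ : 0 < α₀) (h3 : MarginalPriorTails θ₀ α₀ πc πm) :
    ∀ᶠ α in 𝓝 α₀, 0 < α ∧ 0 < πm α :=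
  (lt_mem_nhds hα₀).and
    ((h3.continuousOn.continuousAt (Ioi_mem_nhds hα₀)).eventually (lt_mem_nhds h3.pos))

theorem lintegral_ne_zero_of_eventually_pos {f : ℝ → ENNReal} (hf : Measurable f) {a : ℝ}
    (h : ∀ᶠ x in 𝓝 a, 0 < f x) : ∫⁻ x, f x ≠ 0 := by
  rw [← pos_iff_ne_zero, lintegral_pos_iff_support hf]
  refine Measure.measure_pos_of_mem_nhds (x := a) _ ?_
  filter_upwards [h] with x hx using hx.ne'

theorem jointPrior_eventually_pos (hθ₀ : 0 < θ₀) (hα₀ : 0 < α₀) (h1 : RegularCondPrior θ₀ πc)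
    (h3 : MarginalPriorTails θ₀ α₀ πc πm) : ∀ᶠ α in 𝓝 α₀, 0 < α ∧ 0 < jointPrior θ₀ πc πm α := by
  filter_upwards [margPrior_eventually_pos hα₀ h3] with α h
  refine ⟨h.1, ?_⟩
  unfold jointPrior
  rw [condPrior_of_pos hθ₀ h.1, margPrior_of_pos h.1]
  exact mul_pos (h1.pos _ h.1) h.2

theorem lintegral_mul_jointPrior_ne_zero (hθ₀ : 0 < θ₀) (hα₀ : 0 < α₀)
    (h1 : RegularCondPrior θ₀ πc) (h3 : MarginalPriorTails θ₀ α₀ πc πm) {k : ℝ → ℝ}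
    (hk : Measurable k) (hk0 : ∀ α > 0, 0 < k α) :
    ∫⁻ α, ENNReal.ofReal (k α * jointPrior θ₀ πc πm α) ≠ 0 := by
  have := measurable_jointPrior h1 h3
  refine lintegral_ne_zero_of_eventually_pos (a := α₀) (by fun_prop) ?_
  filter_upwards [jointPrior_eventually_pos hθ₀ hα₀ h1 h3] with α h
  exact ENNReal.ofReal_pos.2 (mul_pos (hk0 _ h.1) h.2)

theorem lintegral_mul_jointPrior_ne_top (hθ₀ : 0 < θ₀)
    (h1 : RegularCondPrior θ₀ πc) (h3 : MarginalPriorTails θ₀ α₀ πc πm) {k : ℝ → ℝ} {C : ℝ}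
    (hC : 0 ≤ C) (hk0 : ∀ α > 0, k α ≤ C * √(2 * α)) :
    ∫⁻ α, ENNReal.ofReal (k α * jointPrior θ₀ πc πm α) ≠ ⊤ := by
  have h : ∫⁻ α, ENNReal.ofReal (k α * jointPrior θ₀ πc πm α)
      ≤ ∫⁻ α, ENNReal.ofReal C * ENNReal.ofReal (√(2 * α) * jointPrior θ₀ πc πm α) := by
    refine lintegral_mono fun α => ?_
    rw [← ENNReal.ofReal_mul hC]
    apply ENNReal.ofReal_le_ofReal
    rcases le_or_gt α 0 with hα | hα
    · simp [jointPrior_of_nonpos hα]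
    · rw [← mul_assoc]
      exact mul_le_mul_of_nonneg_right (hk0 α hα) (jointPrior_nonneg h1 h3 α)
  rw [lintegral_const_mul' _ _ ENNReal.ofReal_ne_top] at h
  exact (h.trans_lt (ENNReal.mul_lt_top ENNReal.ofReal_lt_top
    (lintegral_sqrt_jointPrior_lt_top hθ₀ h3))).ne

theorem lintegral_profileFun_ne_top (hθ₀ : 0 < θ₀)
    (h1 : RegularCondPrior θ₀ πc) (h3 : MarginalPriorTails θ₀ α₀ πc πm) {n b w : ℝ} (hn : 0 < n)
    (hb : 0 ≤ b) (hw : 0 < w) :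
    ∫⁻ α, ENNReal.ofReal (profileFun n b w α * jointPrior θ₀ πc πm α) ≠ ⊤ := by
  obtain ⟨C, hC, h⟩ := exists_profileFun_le hn hb hw
  exact lintegral_mul_jointPrior_ne_top hθ₀ h1 h3 hC.le h

theorem lintegral_tiltFun_ne_top (hθ₀ : 0 < θ₀)
    (h1 : RegularCondPrior θ₀ πc) (h3 : MarginalPriorTails θ₀ α₀ πc πm) {b w : ℝ}
    (hb : 0 ≤ b) (hw : 0 < w) :
    ∫⁻ α, ENNReal.ofReal (tiltFun b w α * jointPrior θ₀ πc πm α) ≠ ⊤ :=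
  lintegral_mul_jointPrior_ne_top hθ₀ h1 h3 (Real.exp_pos _).le fun _ hα => tiltFun_le hb hw le_rfl hα

theorem lintegral_prod_eq_slices {f : ℝ × ℝ → ENNReal} (hf : Measurable f) :
    ∫⁻ q, f q = ∫⁻ α, ∫⁻ θ, f (θ, α) := by
  rw [Measure.volume_eq_prod, lintegral_prod_symm _ hf.aemeasurable]

theorem lintegral_jointDensity_ne_zero (hθ₀ : 0 < θ₀) (hα₀ : 0 < α₀)
    (h1 : RegularCondPrior θ₀ πc) (h3 : MarginalPriorTails θ₀ α₀ πc πm) {n S b w : ℝ}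
    (hn : 0 < n) : ∫⁻ q, ENNReal.ofReal (jointDensity πc πm n S b w q) ≠ 0 := by
  have hm := (measurable_jointDensity h1 h3 n S b w).ennreal_ofReal
  rw [lintegral_prod_eq_slices hm]
  refine lintegral_ne_zero_of_eventually_pos (a := α₀) hm.lintegral_prod_left' ?_
  filter_upwards [margPrior_eventually_pos hα₀ h3] with α h
  rw [pos_iff_ne_zero]
  refine lintegral_ne_zero_of_eventually_pos (a := θ₀)
    (hm.comp (f := fun θ : ℝ => (θ, α)) (by fun_prop)) ?_
  have hc : ContinuousAt (fun θ => πc θ α) θ₀ :=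
    (h1.contDiffOn α h.1).continuousOn.continuousAt (Ioi_mem_nhds hθ₀)
  filter_upwards [lt_mem_nhds hθ₀, hc.eventually (lt_mem_nhds (h1.pos α h.1))] with θ hθ hp
  refine ENNReal.ofReal_pos.2 ?_
  unfold jointDensity
  simp only
  rw [condPrior_of_pos hθ h.1, margPrior_of_pos h.1]
  exact mul_pos (mul_pos (mul_pos (mul_pos (Real.sqrt_pos.2 hn) (thetaKer_pos _ _ _)) hp) h.2)
    (profileFun_pos hn h.1)

theorem lintegral_jointDensity_ne_top
    (h1 : RegularCondPrior θ₀ πc) (h3 : MarginalPriorTails θ₀ α₀ πc πm) {n S b w : ℝ}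
    (hn : 0 < n) (hS : 0 < S) (hb : 0 ≤ b) (hw : 0 < w) :
    ∫⁻ q, ENNReal.ofReal (jointDensity πc πm n S b w q) ≠ ⊤ := by
  have hm := (measurable_jointDensity h1 h3 n S b w).ennreal_ofReal
  rw [lintegral_prod_eq_slices hm]
  obtain ⟨C, hC, hCle⟩ := exists_profileFun_le hn hb hw
  have hle : ∫⁻ α, ∫⁻ θ, ENNReal.ofReal (jointDensity πc πm n S b w (θ, α))
      ≤ ∫⁻ α in Ioi 0, ENNReal.ofReal (√n * C * √2 * (√α * πm α)) := by
    rw [← lintegral_indicator measurableSet_Ioi]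
    refine lintegral_mono fun α => ?_
    rcases le_or_gt α 0 with hα | hα
    · simp [jointDensity, margPrior, not_lt.2 hα]
    · rw [indicator_of_mem (show α ∈ Ioi (0:ℝ) from hα)]
      refine (lintegral_jointDensity_le h1 h3 hα hn.le (thetaFun_pos hS hb hw hn hα)).trans ?_
      apply ENNReal.ofReal_le_ofReal
      have h4 := hCle α hα
      have h5 := h3.nonneg α hα
      rw [margPrior_of_pos hα]
      rw [Real.sqrt_mul (by norm_num)] at h4
      calc √n * (πm α * profileFun n b w α) ≤ √n * (πm α * (C * (√2 * √α))) := by gcongr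
        _ = _ := by ring
  exact (hle.trans_lt (h3.integrable_sqrt.const_mul _).lintegral_lt_top).ne

theorem measurable_normalKer_mul (θ₀ n t : ℝ) {k : ℝ → ℝ} (hk : Measurable k) :
    Measurable fun q : ℝ × ℝ => normalKer θ₀ n t q.1 * k q.2 := by
  have := measurable_normalKer θ₀ n t
  fun_prop

theorem lintegral_normalKer_mul (hθ₀ : 0 < θ₀) {n : ℝ} (hn : 0 < n) (t : ℝ) {k : ℝ → ℝ}
    (hk : Measurable k) :
    ∫⁻ q : ℝ × ℝ, ENNReal.ofReal (normalKer θ₀ n t q.1 * k q.2)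
      = ENNReal.ofReal (2 * θ₀ * √Real.pi) * ∫⁻ α, ENNReal.ofReal (k α) := by
  have hN := measurable_normalKer θ₀ n t
  simp_rw [ENNReal.ofReal_mul (normalKer_nonneg _ _ _ _)]
  rw [Measure.volume_eq_prod, lintegral_prod_mul
    (f := fun θ => ENNReal.ofReal (normalKer θ₀ n t θ)) (g := fun α => ENNReal.ofReal (k α))
    (by fun_prop) (by fun_prop),
    lintegral_normalKer hθ₀ hn]

end

/-! ### Total variation approximation of the unnormalized densities -/

section
variable {ι : Type*} {l : Filter ι} [l.IsCountablyGenerated] {ν : ι → ℕ} {S b w : ι → ℝ}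
  {θ₀ α₀ K w0 : ℝ} {πc : ℝ → ℝ → ℝ} {πm : ℝ → ℝ}

/-- The normalized measure with the given unnormalized density. -/
noncomputable def densityMeasure {E : Type*} [MeasureSpace E] (f : E → ℝ) : Measure E :=
  normalized ((volume : Measure E).withDensity fun x => ENNReal.ofReal (f x))

theorem tendsto_tvDist_densityMeasure (hθ₀ : 0 < θ₀) (hα₀ : 0 < α₀)
    (h1 : RegularCondPrior θ₀ πc) (h2 : CondPriorGrowth θ₀ πc)
    (h3 : MarginalPriorTails θ₀ α₀ πc πm) (hν : Tendsto ν l atTop)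
    (hS : ∀ᶠ i in l, 0 < S i ∧ S i ≤ K) (hb : ∀ᶠ i in l, 0 ≤ b i ∧ b i ≤ K) (hw0 : 0 < w0)
    (hw : ∀ᶠ i in l, w0 ≤ w i ∧ w i ≤ K)
    (ht0 : ∀ᶠ i in l, |√(ν i : ℝ) * (thetaFun (ν i) (S i) (b i) (w i) α₀ - θ₀)| ≤ K) :
    Tendsto (fun i => tvDist (densityMeasure (jointDensity πc πm (ν i) (S i) (b i) (w i)))
      (densityMeasure fun q : ℝ × ℝ =>
        normalKer θ₀ (ν i) (thetaFun (ν i) (S i) (b i) (w i) α₀) q.1 *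
          (profileFun (ν i) (b i) (w i) q.2 * jointPrior θ₀ πc πm q.2))) l (𝓝 0) ∧
    Tendsto (fun i => tvDist (densityMeasure (jointDensity πc πm (ν i) (S i) (b i) (w i)))
      (densityMeasure fun q : ℝ × ℝ =>
        normalKer θ₀ (ν i) (thetaFun (ν i) (S i) (b i) (w i) α₀) q.1 *
          (tiltFun (b i) (w i) q.2 * jointPrior θ₀ πc πm q.2))) l (𝓝 0) := by
  have hjp := measurable_jointPrior h1 h3
  set c := ENNReal.ofReal (2 * θ₀ * √Real.pi) with hc
  have hcpos : 0 < 2 * θ₀ * √Real.pi := by positivity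
  have hc0 : c ≠ 0 := (ENNReal.ofReal_pos.2 hcpos).ne'
  have hctop : c ≠ ⊤ := ENNReal.ofReal_ne_top
  set fJ : ι → ℝ × ℝ → ℝ := fun i => jointDensity πc πm (ν i) (S i) (b i) (w i) with hfJ
  set t : ι → ℝ := fun i => thetaFun (ν i) (S i) (b i) (w i) α₀ with ht
  set kP : ι → ℝ → ℝ := fun i α => profileFun (ν i) (b i) (w i) α * jointPrior θ₀ πc πm α with hkP
  set kT : ι → ℝ → ℝ := fun i α => tiltFun (b i) (w i) α * jointPrior θ₀ πc πm α with hkT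
  have mkP : ∀ i, Measurable (kP i) := fun i => (measurable_profileFun _ _ _).mul hjp
  have mkT : ∀ i, Measurable (kT i) := fun i => (measurable_tiltFun _ _).mul hjp
  set fP : ι → ℝ × ℝ → ℝ := fun i q => normalKer θ₀ (ν i) (t i) q.1 * kP i q.2 with hfP
  set fT : ι → ℝ × ℝ → ℝ := fun i q => normalKer θ₀ (ν i) (t i) q.1 * kT i q.2 with hfT
  have mJ : ∀ i, Measurable (fJ i) := fun i => measurable_jointDensity h1 h3 _ _ _ _
  have mP : ∀ i, Measurable (fP i) := fun i => measurable_normalKer_mul _ _ _ (mkP i)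
  have mT : ∀ i, Measurable (fT i) := fun i => measurable_normalKer_mul _ _ _ (mkT i)
  set D1 : ι → ENNReal := fun i => ∫⁻ q, ENNReal.ofReal |fJ i q - fP i q| with hD1
  set D2 : ι → ENNReal := fun i => ∫⁻ q, ENNReal.ofReal |fP i q - fT i q| with hD2
  have tD1 : Tendsto D1 l (𝓝 0) := by
    refine (tendsto_lintegral_sliceDist hθ₀ hα₀ h1 h2 h3 hν hS hb hw0 hw ht0).congr fun i => ?_
    have m : Measurable fun q => ENNReal.ofReal |fJ i q - fP i q| :=
      (((mJ i).sub (mP i)).abs).ennreal_ofReal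
    simp only [hD1]
    rw [lintegral_prod_eq_slices m]
    rfl
  have hposn : ∀ᶠ i in l, (0:ℝ) < ν i := by
    filter_upwards [hν.eventually_gt_atTop 0] with i hi
    exact_mod_cast hi
  have tD2 : Tendsto D2 l (𝓝 0) := by
    have h := ENNReal.Tendsto.const_mul (a := c)
      (tendsto_lintegral_profileFun_sub_tiltFun hθ₀ h1 h3 hν hb hw0 hw) (Or.inr hctop)
    rw [mul_zero] at h
    refine h.congr' ?_
    filter_upwards [hposn] with i hi
    simp only [hD2]
    have e : ∀ q : ℝ × ℝ, |fP i q - fT i q| = normalKer θ₀ (ν i) (t i) q.1 *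
        (|profileFun (ν i) (b i) (w i) q.2 - tiltFun (b i) (w i) q.2| *
          jointPrior θ₀ πc πm q.2) := by
      intro q
      simp only [hfP, hfT, hkP, hkT]
      rw [← mul_sub, ← sub_mul, abs_mul, abs_mul, abs_of_nonneg (normalKer_nonneg _ _ _ _),
        abs_of_nonneg (jointPrior_nonneg h1 h3 _)]
    simp_rw [e]
    have m1 := measurable_profileFun (ν i) (b i) (w i)
    have m2 := measurable_tiltFun (b i) (w i)
    rw [lintegral_normalKer_mul hθ₀ hi (t i) (k := fun α =>
      |profileFun (ν i) (b i) (w i) α - tiltFun (b i) (w i) α| * jointPrior θ₀ πc πm α)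
      (by fun_prop)]
  set D3 : ι → ENNReal := fun i => ∫⁻ q, ENNReal.ofReal |fJ i q - fT i q| with hD3
  have hD3le : ∀ i, D3 i ≤ D1 i + D2 i := by
    intro i
    have m : Measurable fun q => ENNReal.ofReal |fJ i q - fP i q| :=
      (((mJ i).sub (mP i)).abs).ennreal_ofReal
    simp only [hD1, hD2, hD3]
    rw [← lintegral_add_left m]
    refine lintegral_mono fun q => ?_
    rw [← ENNReal.ofReal_add (abs_nonneg _) (abs_nonneg _)]
    exact ENNReal.ofReal_le_ofReal (abs_sub_le _ _ _)
  have tD3 : Tendsto D3 l (𝓝 0) := by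
    have := tD1.add tD2
    rw [add_zero] at this
    exact tendsto_of_tendsto_of_tendsto_of_le_of_le tendsto_const_nhds this
      (fun _ => zero_le) hD3le
  obtain ⟨a₁, a₂, ha, ha1, hapos⟩ : ∃ a₁ a₂, α₀ ∈ Ioo a₁ a₂ ∧ 0 < a₁ ∧
      ∀ α ∈ Icc a₁ a₂, 0 < jointPrior θ₀ πc πm α := by
    obtain ⟨ε, hε, hball⟩ := Metric.eventually_nhds_iff_ball.1
      (jointPrior_eventually_pos hθ₀ hα₀ h1 h3)
    have hs : Icc (α₀ - ε / 2) (α₀ + ε / 2) ⊆ Metric.ball α₀ ε := by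
      rw [← Real.closedBall_eq_Icc]
      exact Metric.closedBall_subset_ball (by linarith)
    exact ⟨α₀ - ε / 2, α₀ + ε / 2, ⟨by linarith, by linarith⟩,
      (hball _ (hs ⟨le_rfl, by linarith⟩)).1, fun α hα => (hball α (hs hα)).2⟩
  set c0 := √(2 * a₁) * Real.exp (-(K * a₂ + K * a₂ ^ 2))
  have hc0pos : 0 < c0 := by positivity
  set m0 := c * (ENNReal.ofReal c0 * ∫⁻ α in Icc a₁ a₂, ENNReal.ofReal (jointPrior θ₀ πc πm α))
    with hm0
  have hm0pos : m0 ≠ 0 := by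
    refine mul_ne_zero hc0 (mul_ne_zero (ENNReal.ofReal_pos.2 hc0pos).ne' ?_)
    rw [← lintegral_indicator measurableSet_Icc]
    refine lintegral_ne_zero_of_eventually_pos (a := α₀)
      (hjp.ennreal_ofReal.indicator measurableSet_Icc) ?_
    filter_upwards [Icc_mem_nhds ha.1 ha.2] with α hα
    rw [indicator_of_mem hα]
    exact ENNReal.ofReal_pos.2 (hapos α hα)
  have hMT : ∀ᶠ i in l, m0 ≤ ∫⁻ q, ENNReal.ofReal (fT i q) := by
    filter_upwards [hposn, hb, hw] with i hi hbi hwi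
    simp only [hfT]
    rw [lintegral_normalKer_mul hθ₀ hi (t i) (mkT i), hm0,
      ← lintegral_const_mul' _ _ ENNReal.ofReal_ne_top]
    refine mul_le_mul' le_rfl (le_trans ?_ (setLIntegral_le_lintegral (Icc a₁ a₂) _))
    refine setLIntegral_mono (mkT i).ennreal_ofReal fun α hα => ?_
    rw [← ENNReal.ofReal_mul hc0pos.le]
    apply ENNReal.ofReal_le_ofReal
    exact mul_le_mul_of_nonneg_right
      (tiltFun_ge hbi.2 (abs_le.2 ⟨by linarith [hwi.1, hwi.2], hwi.2⟩) ha1 hα) (hapos α hα).le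
  have hMTtop : ∀ᶠ i in l, ∫⁻ q, ENNReal.ofReal (fT i q) ≠ ⊤ := by
    filter_upwards [hposn, hb, hw] with i hi hbi hwi
    simp only [hfT]
    rw [lintegral_normalKer_mul hθ₀ hi (t i) (mkT i)]
    exact ENNReal.mul_ne_top hctop
      (lintegral_tiltFun_ne_top hθ₀ h1 h3 hbi.1 (hw0.trans_le hwi.1))
  rcases l.eq_or_neBot with hbot | hne
  · rw [hbot]; exact ⟨tendsto_bot, tendsto_bot⟩
  have hm0top : m0 ≠ ⊤ := by
    obtain ⟨i, hi1, hi2⟩ := (hMT.and hMTtop).exists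
    exact (hi1.trans_lt hi2.lt_top).ne
  have hm0half : m0 / 2 ≠ 0 := by simp [hm0pos]
  have hm0half' : m0 / 2 ≠ ⊤ := ENNReal.div_ne_top hm0top (by norm_num)
  have hMP : ∀ᶠ i in l, m0 / 2 ≤ ∫⁻ q, ENNReal.ofReal (fP i q) := by
    filter_upwards [hMT, tD2.eventually_le_const (pos_iff_ne_zero.2 hm0half)] with i h4 h5
    have h6 : ∫⁻ q, ENNReal.ofReal (fT i q) ≤ (∫⁻ q, ENNReal.ofReal (fP i q)) + D2 i := by
      simp only [hD2]
      have m : Measurable fun q => ENNReal.ofReal (fP i q) := (mP i).ennreal_ofReal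
      rw [← lintegral_add_left m]
      refine lintegral_mono fun q => ?_
      refine le_trans (ENNReal.ofReal_le_ofReal ?_) ENNReal.ofReal_add_le
      linarith [neg_abs_le (fP i q - fT i q)]
    have h7 : m0 / 2 + m0 / 2 ≤ (∫⁻ q, ENNReal.ofReal (fP i q)) + m0 / 2 := by
      rw [ENNReal.add_halves]
      exact h4.trans (h6.trans (by gcongr))
    exact (ENNReal.add_le_add_iff_right hm0half').1 h7
  have hMPtop : ∀ᶠ i in l, ∫⁻ q, ENNReal.ofReal (fP i q) ≠ ⊤ := by
    filter_upwards [hposn, hb, hw] with i hi hbi hwi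
    simp only [hfP]
    rw [lintegral_normalKer_mul hθ₀ hi (t i) (mkP i)]
    exact ENNReal.mul_ne_top hctop
      (lintegral_profileFun_ne_top hθ₀ h1 h3 hi hbi.1 (hw0.trans_le hwi.1))
  have key : ∀ (f : ι → ℝ × ℝ → ℝ) (D : ι → ENNReal), (∀ i, Measurable (f i)) →
      (∀ i, D i = ∫⁻ q, ENNReal.ofReal |fJ i q - f i q|) → Tendsto D l (𝓝 0) →
      (∀ᶠ i in l, m0 / 2 ≤ ∫⁻ q, ENNReal.ofReal (f i q)) →
      (∀ᶠ i in l, ∫⁻ q, ENNReal.ofReal (f i q) ≠ ⊤) →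
      Tendsto (fun i => tvDist (densityMeasure (fJ i)) (densityMeasure (f i))) l (𝓝 0) := by
    intro f D mf hDf tD hM hMtop
    have tDr : Tendsto (fun i => 2 * (D i).toReal / (m0 / 2).toReal) l (𝓝 0) := by
      have h := (ENNReal.tendsto_toReal ENNReal.zero_ne_top).comp tD
      have := (h.const_mul 2).div_const (m0 / 2).toReal
      simpa using this
    refine squeeze_zero' (Eventually.of_forall fun _ => tvDist_nonneg _ _) ?_ tDr
    filter_upwards [hM, hMtop, tD.eventually_lt_const ENNReal.zero_lt_top, hposn, hS, hb, hw]
      with i h4 h5 h6 hi hSi hbi hwi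
    have hne0 : ∫⁻ q, ENNReal.ofReal (f i q) ≠ 0 := fun h0 => by
      rw [h0] at h4
      exact hm0half (le_antisymm h4 zero_le)
    have h7 := tvDist_normalized_withDensity_le volume (mJ i) (mf i)
      (by rw [← hDf]; exact h6.ne) (lintegral_jointDensity_ne_zero hθ₀ hα₀ h1 h3 hi)
      (lintegral_jointDensity_ne_top h1 h3 hi hSi.1 hbi.1 (hw0.trans_le hwi.1)) hne0 h5
    rw [← hDf] at h7
    refine h7.trans ?_
    have h8 : 0 < (m0 / 2).toReal := ENNReal.toReal_pos hm0half hm0half'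
    have h9 := ENNReal.toReal_mono h5 h4
    gcongr
  refine ⟨key fP D1 mP (fun _ => rfl) tD1 hMP hMPtop, key fT D3 mT (fun _ => rfl) tD3 ?_ hMTtop⟩
  filter_upwards [hMT] with i hi
  exact ENNReal.half_le_self.trans hi

end

/-! ### The correlation matrix of the Ornstein-Uhlenbeck process -/

/-- The unit lower bidiagonal matrix that maps the observations to the innovations. -/
noncomputable def innovMatrix (m : ℕ) (ρ : ℝ) : Matrix (Fin (m + 1)) (Fin (m + 1)) ℝ :=
  Matrix.of fun i j => if i = j then 1 else if (j : ℕ) + 1 = i then -ρ else 0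

theorem innovMatrix_mulVec_zero (m : ℕ) (ρ : ℝ) (v : Fin (m + 1) → ℝ) :
    (innovMatrix m ρ *ᵥ v) 0 = v 0 := by
  simp [Matrix.mulVec, dotProduct, innovMatrix]

theorem innovMatrix_mulVec_succ (m : ℕ) (ρ : ℝ) (v : Fin (m + 1) → ℝ) (i : Fin m) :
    (innovMatrix m ρ *ᵥ v) i.succ = v i.succ - ρ * v i.castSucc := by
  have h : ∀ j : Fin (m + 1), innovMatrix m ρ i.succ j * v j
      = (if i.succ = j then v j else 0) + (if i.castSucc = j then -ρ * v j else 0) := by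
    intro j
    simp only [innovMatrix, Matrix.of_apply, Fin.val_succ]
    have h3 : ((j : ℕ) + 1 = (i : ℕ) + 1) ↔ i.castSucc = j := by
      rw [Fin.ext_iff, Fin.val_castSucc]; omega
    simp only [h3]
    by_cases h1 : i.succ = j
    · have h2 : ¬ i.castSucc = j := by
        intro h2
        rw [← h2] at h1
        simp [Fin.ext_iff] at h1
      simp [h1, h2]
    · by_cases h2 : i.castSucc = j <;> simp [h1, h2]
  simp only [Matrix.mulVec, dotProduct, h, Finset.sum_add_distrib, Finset.sum_ite_eq,
    Finset.mem_univ, if_true]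
  ring

theorem innovMatrix_mul_apply_zero (m : ℕ) (ρ : ℝ) (M : Matrix (Fin (m + 1)) (Fin (m + 1)) ℝ)
    (j : Fin (m + 1)) : (innovMatrix m ρ * M) 0 j = M 0 j :=
  innovMatrix_mulVec_zero m ρ fun i => M i j

theorem innovMatrix_mul_apply_succ (m : ℕ) (ρ : ℝ) (M : Matrix (Fin (m + 1)) (Fin (m + 1)) ℝ)
    (i : Fin m) (j : Fin (m + 1)) :
    (innovMatrix m ρ * M) i.succ j = M i.succ j - ρ * M i.castSucc j :=
  innovMatrix_mulVec_succ m ρ (fun i => M i j) i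

theorem mul_transpose_innovMatrix_apply_zero (m : ℕ) (ρ : ℝ)
    (M : Matrix (Fin (m + 1)) (Fin (m + 1)) ℝ) (i : Fin (m + 1)) :
    (M * (innovMatrix m ρ)ᵀ) i 0 = M i 0 := by
  rw [← Matrix.transpose_apply (M * _), Matrix.transpose_mul, Matrix.transpose_transpose,
    innovMatrix_mul_apply_zero, Matrix.transpose_apply]

theorem mul_transpose_innovMatrix_apply_succ (m : ℕ) (ρ : ℝ)
    (M : Matrix (Fin (m + 1)) (Fin (m + 1)) ℝ) (i : Fin (m + 1)) (j : Fin m) :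
    (M * (innovMatrix m ρ)ᵀ) i j.succ = M i j.succ - ρ * M i j.castSucc := by
  rw [← Matrix.transpose_apply (M * _), Matrix.transpose_mul, Matrix.transpose_transpose,
    innovMatrix_mul_apply_succ, Matrix.transpose_apply, Matrix.transpose_apply]

theorem det_innovMatrix (m : ℕ) (ρ : ℝ) : (innovMatrix m ρ).det = 1 := by
  rw [Matrix.det_of_isLowerTriangular]
  · simp [innovMatrix]
  · intro i j hij
    simp only [OrderDual.toDual_lt_toDual] at hij
    have h1 : i ≠ j := hij.ne
    have h2 : ¬ ((j : ℕ) + 1 = i) := by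
      have : (i : ℕ) < j := hij
      omega
    simp [innovMatrix, h1, h2]

theorem corrMatrix_apply (m : ℕ) (α : ℝ) (i j : Fin (m + 1)) :
    corrMatrix (m + 1) α i j
      = Real.exp (-(α / ((m + 1 : ℕ) : ℝ))) ^ (((i : ℤ) - (j : ℤ)).natAbs) := by
  rw [← Real.exp_nat_mul]
  simp only [corrMatrix, Matrix.of_apply]
  congr 1
  have hm : (0:ℝ) < ((m + 1 : ℕ) : ℝ) := by positivity
  rw [← sub_div, abs_div, abs_of_pos hm, Nat.cast_natAbs]
  push_cast
  rw [show ((i : ℝ) + 1 - ((j : ℝ) + 1)) = (i : ℝ) - j by ring]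
  field_simp

/-- The variances of the innovations. -/
noncomputable def innovVar (m : ℕ) (ρ : ℝ) : Fin (m + 1) → ℝ :=
  fun i => if i = 0 then 1 else 1 - ρ ^ 2

theorem innovMatrix_mul_corrMatrix (m : ℕ) (α : ℝ) {ρ : ℝ}
    (hρ : ρ = Real.exp (-(α / ((m + 1 : ℕ) : ℝ)))) :
    innovMatrix m ρ * corrMatrix (m + 1) α * (innovMatrix m ρ)ᵀ
      = Matrix.diagonal (innovVar m ρ) := by
  ext i j
  refine Fin.cases ?_ (fun i => ?_) i <;> refine Fin.cases ?_ (fun j => ?_) j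
  · rw [mul_transpose_innovMatrix_apply_zero, innovMatrix_mul_apply_zero, corrMatrix_apply]
    simp [innovVar]
  · rw [mul_transpose_innovMatrix_apply_succ, innovMatrix_mul_apply_zero,
      innovMatrix_mul_apply_zero, corrMatrix_apply, corrMatrix_apply, ← hρ,
      Matrix.diagonal_apply_ne _ (Fin.succ_ne_zero j).symm]
    have e1 : ((((0 : Fin (m + 1)) : ℕ) : ℤ) - ((j.succ : ℕ) : ℤ)).natAbs = j + 1 := by
      simp only [Fin.val_zero, Fin.val_succ]; omega
    have e2 : ((((0 : Fin (m + 1)) : ℕ) : ℤ) - ((j.castSucc : ℕ) : ℤ)).natAbs = j := by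
      simp only [Fin.val_zero, Fin.val_castSucc]; omega
    rw [e1, e2]; ring
  · rw [mul_transpose_innovMatrix_apply_zero, innovMatrix_mul_apply_succ, corrMatrix_apply,
      corrMatrix_apply, ← hρ, Matrix.diagonal_apply_ne _ (Fin.succ_ne_zero i)]
    have e1 : (((i.succ : ℕ) : ℤ) - (((0 : Fin (m + 1)) : ℕ) : ℤ)).natAbs = i + 1 := by
      simp only [Fin.val_zero, Fin.val_succ]; omega
    have e2 : (((i.castSucc : ℕ) : ℤ) - (((0 : Fin (m + 1)) : ℕ) : ℤ)).natAbs = i := by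
      simp only [Fin.val_zero, Fin.val_castSucc]; omega
    rw [e1, e2]; ring
  · rw [mul_transpose_innovMatrix_apply_succ, innovMatrix_mul_apply_succ,
      innovMatrix_mul_apply_succ]
    simp only [corrMatrix_apply, ← hρ, Fin.val_succ, Fin.val_castSucc]
    rcases lt_trichotomy (i : ℕ) j with h | h | h
    · have hij : i.succ ≠ j.succ := by
        intro h'; rw [Fin.succ_inj] at h'; rw [h'] at h; exact lt_irrefl _ h
      rw [Matrix.diagonal_apply_ne _ hij]
      obtain ⟨k, hk⟩ := Nat.exists_eq_add_of_lt h
      have e1 : (((i : ℕ) + 1 : ℕ) - (((j : ℕ) + 1 : ℕ) : ℤ)).natAbs = k + 1 := by omega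
      have e2 : (((i : ℕ) : ℤ) - (((j : ℕ) + 1 : ℕ) : ℤ)).natAbs = k + 2 := by omega
      have e3 : (((i : ℕ) + 1 : ℕ) - ((j : ℕ) : ℤ)).natAbs = k := by omega
      have e4 : (((i : ℕ) : ℤ) - ((j : ℕ) : ℤ)).natAbs = k + 1 := by omega
      rw [e1, e2, e3, e4]; ring
    · have hij : i = j := Fin.ext h
      subst hij
      rw [Matrix.diagonal_apply_eq]
      have e2 : (((i : ℕ) : ℤ) - (((i : ℕ) + 1 : ℕ) : ℤ)).natAbs = 1 := by omega
      have e3 : (((i : ℕ) + 1 : ℕ) - ((i : ℕ) : ℤ)).natAbs = 1 := by omega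
      rw [e2, e3]
      simp [innovVar, Fin.succ_ne_zero]
      ring
    · have hij : i.succ ≠ j.succ := by
        intro h'; rw [Fin.succ_inj] at h'; rw [h'] at h; exact lt_irrefl _ h
      rw [Matrix.diagonal_apply_ne _ hij]
      obtain ⟨k, hk⟩ := Nat.exists_eq_add_of_lt h
      have e1 : (((i : ℕ) + 1 : ℕ) - (((j : ℕ) + 1 : ℕ) : ℤ)).natAbs = k + 1 := by omega
      have e2 : (((i : ℕ) : ℤ) - (((j : ℕ) + 1 : ℕ) : ℤ)).natAbs = k := by omega
      have e3 : (((i : ℕ) + 1 : ℕ) - ((j : ℕ) : ℤ)).natAbs = k + 2 := by omega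
      have e4 : (((i : ℕ) : ℤ) - ((j : ℕ) : ℤ)).natAbs = k + 1 := by omega
      rw [e1, e2, e3, e4]; ring

theorem det_corrMatrix (m : ℕ) (α : ℝ) {ρ : ℝ}
    (hρ : ρ = Real.exp (-(α / ((m + 1 : ℕ) : ℝ)))) :
    (corrMatrix (m + 1) α).det = (1 - ρ ^ 2) ^ m := by
  have h := congrArg Matrix.det (innovMatrix_mul_corrMatrix m α hρ)
  rw [Matrix.det_mul, Matrix.det_mul, Matrix.det_transpose, det_innovMatrix, one_mul, mul_one,
    Matrix.det_diagonal, Fin.prod_univ_succ] at h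
  simpa [innovVar, Fin.succ_ne_zero] using h

theorem inv_corrMatrix (m : ℕ) (α : ℝ) {ρ : ℝ}
    (hρ : ρ = Real.exp (-(α / ((m + 1 : ℕ) : ℝ)))) (hρ1 : 1 - ρ ^ 2 ≠ 0) :
    (corrMatrix (m + 1) α)⁻¹ = (innovMatrix m ρ)ᵀ *
      (Matrix.diagonal (fun i => (innovVar m ρ i)⁻¹) * innovMatrix m ρ) := by
  apply Matrix.inv_eq_right_inv
  set L := innovMatrix m ρ
  set R := corrMatrix (m + 1) α
  have hL : IsUnit L.det := by rw [det_innovMatrix]; exact isUnit_one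
  have h := innovMatrix_mul_corrMatrix m α hρ
  have hD : Matrix.diagonal (innovVar m ρ) * Matrix.diagonal (fun i => (innovVar m ρ i)⁻¹) = 1 := by
    rw [Matrix.diagonal_mul_diagonal, ← Matrix.diagonal_one]
    congr 1
    ext i
    refine mul_inv_cancel₀ ?_
    unfold innovVar
    split_ifs
    · exact one_ne_zero
    · exact hρ1
  have h2 : L * (R * (Lᵀ * (Matrix.diagonal (fun i => (innovVar m ρ i)⁻¹) * L))) = L := by
    calc _ = (L * R * Lᵀ) * Matrix.diagonal (fun i => (innovVar m ρ i)⁻¹) * L := by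
          simp only [Matrix.mul_assoc]
      _ = L := by rw [h, hD, Matrix.one_mul]
  have h3 := congrArg (fun M => L⁻¹ * M) h2
  simpa only [← Matrix.mul_assoc L⁻¹ L, Matrix.nonsing_inv_mul L hL, Matrix.one_mul] using h3

theorem quadForm_eq_sum (m : ℕ) (x : ℕ → ℝ) (α : ℝ) {ρ : ℝ}
    (hρ : ρ = Real.exp (-(α / ((m + 1 : ℕ) : ℝ)))) (hρ1 : 1 - ρ ^ 2 ≠ 0) :
    quadForm (m + 1) x α
      = x 1 ^ 2 + (∑ i ∈ Finset.range m, (x (i + 2) - ρ * x (i + 1)) ^ 2) / (1 - ρ ^ 2) := by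
  unfold quadForm
  rw [inv_corrMatrix m α hρ hρ1, ← Matrix.mulVec_mulVec, Matrix.dotProduct_mulVec,
    Matrix.vecMul_transpose, ← Matrix.mulVec_mulVec]
  simp only [dotProduct, Matrix.mulVec_diagonal]
  rw [Fin.sum_univ_succ, innovMatrix_mulVec_zero, Finset.sum_div, ← Fin.sum_univ_eq_sum_range
    (fun i => (x (i + 2) - ρ * x (i + 1)) ^ 2 / (1 - ρ ^ 2))]
  congr 1
  · simp [innovVar, obsVec]; ring
  · refine Finset.sum_congr rfl fun i _ => ?_
    rw [innovMatrix_mulVec_succ]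
    simp only [innovVar, Fin.succ_ne_zero, if_false, obsVec, Fin.val_succ, Fin.val_castSucc]
    ring_nf

/-! ### The sums of squares and products -/

theorem A₃_eq (m : ℕ) (x : ℕ → ℝ) :
    A₃ (m + 1) x = x 1 ^ 2 + ∑ i ∈ Finset.range m, x (i + 2) ^ 2 := by
  unfold A₃
  rw [← Finset.Ico_add_one_right_eq_Icc, Finset.sum_Ico_eq_sum_range, Nat.add_sub_cancel,
    Finset.sum_range_succ']
  rw [add_comm]
  congr 1
  refine Finset.sum_congr rfl fun i _ => ?_
  ring_nf

theorem A₂_eq (m : ℕ) (x : ℕ → ℝ) :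
    A₂ (m + 1) x = ∑ i ∈ Finset.range m, x (i + 1) * x (i + 2) := by
  unfold A₂
  rw [← Finset.Ico_add_one_right_eq_Icc, Finset.sum_Ico_eq_sum_range, Nat.add_sub_cancel,
    Nat.add_sub_cancel]
  refine Finset.sum_congr rfl fun i _ => ?_
  ring_nf

theorem A₁_add (m : ℕ) (hm : 1 ≤ m) (x : ℕ → ℝ) :
    A₁ (m + 1) x + x 1 ^ 2 = ∑ i ∈ Finset.range m, x (i + 1) ^ 2 := by
  obtain ⟨k, rfl⟩ := Nat.exists_eq_add_of_le' hm
  unfold A₁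
  rw [← Finset.Ico_add_one_right_eq_Icc, Finset.sum_Ico_eq_sum_range, Finset.sum_range_succ']
  congr 1
  refine Finset.sum_congr (by simp) fun i _ => ?_
  ring_nf

/-- The quadratic variation of the data. -/
noncomputable def quadVar (n : ℕ) (x : ℕ → ℝ) : ℝ := A₁ n x - 2 * A₂ n x + A₃ n x

/-- The boundary sum of squares. -/
noncomputable def bdrySq (n : ℕ) (x : ℕ → ℝ) : ℝ := A₃ n x - A₁ n x

theorem quadVar_eq_sum (m : ℕ) (hm : 1 ≤ m) (x : ℕ → ℝ) :
    quadVar (m + 1) x = ∑ i ∈ Finset.range m, (x (i + 2) - x (i + 1)) ^ 2 := by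
  have h1 := A₁_add m hm x
  have h2 : ∑ i ∈ Finset.range m, (x (i + 2) - x (i + 1)) ^ 2
      = ∑ i ∈ Finset.range m, x (i + 2) ^ 2 - 2 * ∑ i ∈ Finset.range m, x (i + 1) * x (i + 2)
        + ∑ i ∈ Finset.range m, x (i + 1) ^ 2 := by
    rw [Finset.mul_sum, ← Finset.sum_sub_distrib, ← Finset.sum_add_distrib]
    exact Finset.sum_congr rfl fun i _ => by ring
  unfold quadVar
  rw [A₃_eq, A₂_eq, h2, ← h1]
  ring

theorem bdrySq_eq (m : ℕ) (hm : 1 ≤ m) (x : ℕ → ℝ) :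
    bdrySq (m + 1) x = x 1 ^ 2 + x (m + 1) ^ 2 := by
  have h1 := A₁_add m hm x
  obtain ⟨k, rfl⟩ := Nat.exists_eq_add_of_le' hm
  unfold bdrySq
  rw [A₃_eq, Finset.sum_range_succ]
  rw [Finset.sum_range_succ'] at h1
  have h2 : ∑ i ∈ Finset.range k, x (i + 1 + 1) ^ 2 = ∑ i ∈ Finset.range k, x (i + 2) ^ 2 := rfl
  rw [h2] at h1
  simp only [zero_add] at h1
  rw [show k + 1 + 1 = k + 2 from rfl]
  linarith

theorem sum_innov_sq (m : ℕ) (hm : 1 ≤ m) (x : ℕ → ℝ) (ρ : ℝ) :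
    (1 - ρ ^ 2) * x 1 ^ 2 + ∑ i ∈ Finset.range m, (x (i + 2) - ρ * x (i + 1)) ^ 2
      = A₃ (m + 1) x - 2 * ρ * A₂ (m + 1) x + ρ ^ 2 * A₁ (m + 1) x := by
  have h1 := A₁_add m hm x
  have h2 : ∑ i ∈ Finset.range m, (x (i + 2) - ρ * x (i + 1)) ^ 2
      = ∑ i ∈ Finset.range m, x (i + 2) ^ 2
        - 2 * ρ * ∑ i ∈ Finset.range m, x (i + 1) * x (i + 2)
        + ρ ^ 2 * ∑ i ∈ Finset.range m, x (i + 1) ^ 2 := by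
    rw [Finset.mul_sum, Finset.mul_sum, ← Finset.sum_sub_distrib, ← Finset.sum_add_distrib]
    exact Finset.sum_congr rfl fun i _ => by ring
  rw [A₃_eq, A₂_eq, h2, ← h1]
  ring

/-- The boundary sum of squares relative to the quadratic variation. -/
noncomputable def bdryRatio (n : ℕ) (x : ℕ → ℝ) : ℝ := bdrySq n x / quadVar n x

/-- The inverse of the squared scale `v_*`. -/
noncomputable def invScale (n : ℕ) (x : ℕ → ℝ) : ℝ := A₁ n x / (n * quadVar n x)

theorem quadForm_eq {n : ℕ} (hn : 2 ≤ n) {x : ℕ → ℝ} (hS : quadVar n x ≠ 0) {α : ℝ} (hα : 0 < α) :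
    quadForm n x α = quadVar n x *
      innovRatio n (bdryRatio n x) (invScale n x) (1 - Real.exp (-(α / n)))
        / (1 - Real.exp (-(2 * (α / n)))) := by
  obtain ⟨m, rfl⟩ := Nat.exists_eq_add_of_le' (show 1 ≤ n by omega)
  have hm : 1 ≤ m := by omega
  set ρ := Real.exp (-(α / ((m + 1 : ℕ) : ℝ))) with hρ
  have hρ2 : Real.exp (-(2 * (α / ((m + 1 : ℕ) : ℝ)))) = ρ ^ 2 := by
    rw [hρ, ← Real.exp_nat_mul]; congr 1; push_cast; ring
  have hpos : 0 < 1 - ρ ^ 2 := by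
    rw [← hρ2]; exact one_sub_exp_neg_pos (by positivity)
  rw [hρ2, quadForm_eq_sum m x α hρ hpos.ne', eq_div_iff hpos.ne', add_mul,
    div_mul_cancel₀ _ hpos.ne', mul_comm (x 1 ^ 2), sum_innov_sq m hm]
  unfold innovRatio bdryRatio invScale
  have hn0 : ((m + 1 : ℕ) : ℝ) ≠ 0 := by positivity
  field_simp
  unfold bdrySq quadVar
  ring

theorem log_det_corrMatrix {n : ℕ} (hn : 1 ≤ n) (α : ℝ) :
    Real.log (corrMatrix n α).det
      = ((n : ℝ) - 1) * Real.log (1 - Real.exp (-(2 * (α / n)))) := by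
  obtain ⟨m, rfl⟩ := Nat.exists_eq_add_of_le' hn
  rw [det_corrMatrix m α rfl, Real.log_pow, ← Real.exp_nat_mul]
  push_cast
  congr 2
  · ring
  · congr 2; ring

/-! ### Identification of the likelihood, the posterior and its approximations -/

section
variable {θ₀ α₀ : ℝ} {πc : ℝ → ℝ → ℝ} {πm : ℝ → ℝ} {n : ℕ} {x : ℕ → ℝ}

theorem bdrySq_nonneg (hn : 2 ≤ n) (x : ℕ → ℝ) : 0 ≤ bdrySq n x := by
  obtain ⟨m, rfl⟩ := Nat.exists_eq_add_of_le' (show 1 ≤ n by omega)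
  rw [bdrySq_eq m (by omega)]
  positivity

theorem bdryRatio_nonneg (hn : 2 ≤ n) (hS : 0 < quadVar n x) : 0 ≤ bdryRatio n x :=
  div_nonneg (bdrySq_nonneg hn x) hS.le

theorem invScale_pos (hn : 2 ≤ n) (hS : 0 < quadVar n x) (hA : 0 < A₁ n x) : 0 < invScale n x := by
  have : (0:ℝ) < n := by exact_mod_cast (by omega : 0 < n)
  unfold invScale; positivity

theorem thetaTilde_eq (hn : 2 ≤ n) (hS : quadVar n x ≠ 0) {α : ℝ} (hα : 0 < α) :
    thetaTilde n x α = thetaFun n (quadVar n x) (bdryRatio n x) (invScale n x) α := by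
  unfold thetaTilde thetaFun
  rw [quadForm_eq hn hS hα]
  ring

/-- The logarithm of the constant factor of the profile likelihood. -/
noncomputable def logConst (n : ℕ) (x : ℕ → ℝ) : ℝ :=
  (n / 2 : ℝ) * Real.log n - (n / 2 : ℝ) * Real.log (quadVar n x)

theorem exp_profileLogLik (hn : 2 ≤ n) (hS : 0 < quadVar n x) (hA : 0 < A₁ n x) {α : ℝ}
    (hα : 0 < α) : Real.exp (profileLogLik n x α) = Real.exp (logConst n x) / √(n : ℝ) *
      profileFun n (bdryRatio n x) (invScale n x) α := by
  have hn0 : (0:ℝ) < n := by exact_mod_cast (by omega : 0 < n)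
  unfold profileLogLik profileFun
  rw [quadForm_eq hn hS.ne' hα, log_det_corrMatrix (by omega)]
  have hr := innovRatio_pos (bdryRatio_nonneg hn hS) (invScale_pos hn hS hA) hn0
    (one_sub_exp_neg_nonneg (x := α / n) (by positivity)) (one_sub_exp_neg_le_one _)
  have hE := one_sub_exp_neg_pos (x := 2 * (α / n)) (by positivity)
  set r := innovRatio n (bdryRatio n x) (invScale n x) (1 - Real.exp (-(α / n)))
  set E := 1 - Real.exp (-(2 * (α / n)))
  set S := quadVar n x with hSd
  rw [Real.log_div (by positivity) hn0.ne', Real.log_div (by positivity) hE.ne',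
    Real.log_mul hS.ne' hr.ne']
  have hsE : √E = Real.exp (Real.log E / 2) := by
    rw [← Real.log_sqrt hE.le, Real.exp_log (Real.sqrt_pos.2 hE)]
  have hsn : √(n : ℝ) ≠ 0 := (Real.sqrt_pos.2 hn0).ne'
  rw [hsE]
  have e : Real.exp (logConst n x) / √(n : ℝ) *
      (√(n : ℝ) * Real.exp (Real.log E / 2) * Real.exp (-((n : ℝ) / 2) * Real.log r))
      = Real.exp (logConst n x) * Real.exp (Real.log E / 2)
        * Real.exp (-((n : ℝ) / 2) * Real.log r) := by
    field_simp
  rw [e, ← Real.exp_add, ← Real.exp_add]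
  congr 1
  unfold logConst
  rw [← hSd]
  ring

theorem logLik_eq (hn : 2 ≤ n) (hS : 0 < quadVar n x) (hA : 0 < A₁ n x) {θ α : ℝ}
    (hθ : 0 < θ) (hα : 0 < α) :
    logLik n x (θ / α) α = profileLogLik n x α - n / 2
      + -(n / 2 : ℝ) * (thetaTilde n x α / θ - 1 - Real.log (thetaTilde n x α / θ)) := by
  have hn0 : (0:ℝ) < n := by exact_mod_cast (by omega : 0 < n)
  have ht : 0 < thetaTilde n x α := by
    rw [thetaTilde_eq hn hS.ne' hα]
    exact thetaFun_pos hS (bdryRatio_nonneg hn hS) (invScale_pos hn hS hA) hn0 hα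
  have hQ : 0 < quadForm n x α := by
    unfold thetaTilde at ht
    exact (mul_pos_iff_of_pos_left (by positivity)).1 ht
  unfold logLik profileLogLik
  have e1 : 1 / (2 * (θ / α)) * quadForm n x α = n / 2 * (thetaTilde n x α / θ) := by
    unfold thetaTilde; field_simp
  have e2 : Real.log (thetaTilde n x α / θ)
      = Real.log (quadForm n x α / n) - Real.log (θ / α) := by
    rw [← Real.log_div (by positivity) (by positivity)]
    congr 1
    unfold thetaTilde; field_simp
  rw [e1, e2]
  ring

theorem exp_logLik (hn : 2 ≤ n) (hS : 0 < quadVar n x) (hA : 0 < A₁ n x) {θ α : ℝ}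
    (hθ : 0 < θ) (hα : 0 < α) :
    Real.exp (logLik n x (θ / α) α) = Real.exp (logConst n x - n / 2) / √(n : ℝ) *
      (thetaKer n (thetaFun n (quadVar n x) (bdryRatio n x) (invScale n x) α) θ *
        profileFun n (bdryRatio n x) (invScale n x) α) := by
  rw [logLik_eq hn hS hA hθ hα, Real.exp_add, Real.exp_sub, exp_profileLogLik hn hS hA hα,
    Real.exp_sub, ← thetaTilde_eq hn hS.ne' hα]
  unfold thetaKer
  ring

theorem withDensity_restrict_eq {E : Type*} [MeasureSpace E] {s : Set E} (hs : MeasurableSet s)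
    {f g : E → ℝ} {c : ℝ} (hc : 0 < c) (hg : Measurable g) (hfg : ∀ x ∈ s, f x = c * g x)
    (hg0 : ∀ x ∉ s, g x = 0) :
    normalized (((volume : Measure E).restrict s).withDensity fun x => ENNReal.ofReal (f x))
      = densityMeasure g := by
  unfold densityMeasure
  rw [← withDensity_indicator hs, ← normalized_withDensity_const_mul volume hg.ennreal_ofReal
    (ENNReal.ofReal_pos.2 hc).ne' ENNReal.ofReal_ne_top]
  congr 2
  ext x
  by_cases hx : x ∈ s
  · rw [indicator_of_mem hx, hfg x hx, ENNReal.ofReal_mul hc.le]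
  · rw [indicator_of_notMem hx, hg0 x hx]; simp

theorem posterior_eq (hn : 2 ≤ n) (hS : 0 < quadVar n x) (hA : 0 < A₁ n x)
    (h1 : RegularCondPrior θ₀ πc) (h3 : MarginalPriorTails θ₀ α₀ πc πm) :
    posterior πc πm n x = densityMeasure
      (jointDensity πc πm n (quadVar n x) (bdryRatio n x) (invScale n x)) := by
  have hn0 : (0:ℝ) < n := by exact_mod_cast (by omega : 0 < n)
  have hs : 0 < √(n : ℝ) := Real.sqrt_pos.2 hn0
  refine withDensity_restrict_eq (c := Real.exp (logConst n x - n / 2) / √(n : ℝ) / √(n : ℝ))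
    (measurableSet_Ioi.prod measurableSet_Ioi) (by positivity)
    (measurable_jointDensity h1 h3 _ _ _ _) ?_ ?_
  · rintro ⟨θ, α⟩ ⟨hθ, hα⟩
    simp only [mem_Ioi] at hθ hα
    rw [exp_logLik hn hS hA hθ hα]
    unfold jointDensity
    simp only
    rw [condPrior_of_pos hθ hα, margPrior_of_pos hα]
    field_simp
  · rintro ⟨θ, α⟩ h
    by_cases hα : 0 < α
    · have hθ : ¬ 0 < θ := fun hθ => h ⟨hθ, hα⟩
      simp [jointDensity, condPrior, hθ]
    · simp [jointDensity, margPrior, hα]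

theorem integral_prior_pos (hθ₀ : 0 < θ₀) (hα₀ : 0 < α₀) (h1 : RegularCondPrior θ₀ πc)
    (h3 : MarginalPriorTails θ₀ α₀ πc πm) : 0 < ∫ α in Ioi (0 : ℝ), πc θ₀ α * πm α := by
  have hnn : 0 ≤ᵐ[volume.restrict (Ioi (0:ℝ))] fun α => πc θ₀ α * πm α := by
    filter_upwards [ae_restrict_mem measurableSet_Ioi] with α hα
    exact mul_nonneg (h1.nonneg _ hθ₀ _ hα) (h3.nonneg _ hα)
  refine lt_of_le_of_ne (integral_nonneg_of_ae hnn) fun h0 => ?_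
  have h4 := ofReal_integral_eq_lintegral_ofReal h3.integrable_joint hnn
  rw [← h0, ENNReal.ofReal_zero, ← lintegral_indicator measurableSet_Ioi] at h4
  refine lintegral_mul_jointPrior_ne_zero hθ₀ hα₀ h1 h3 (k := fun _ => 1) (by fun_prop)
    (fun _ _ => one_pos) (h4.symm ▸ lintegral_congr fun α => ?_)
  by_cases hα : 0 < α
  · rw [indicator_of_mem (show α ∈ Ioi (0:ℝ) from hα)]
    simp only [jointPrior, one_mul]
    rw [condPrior_of_pos hθ₀ hα, margPrior_of_pos hα]
  · simp [jointPrior, margPrior, hα]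

theorem priorGivenTheta_eq (hθ₀ : 0 < θ₀) {α : ℝ} (hα : 0 < α) :
    priorGivenTheta θ₀ πc πm α
      = jointPrior θ₀ πc πm α / ∫ α' in Ioi (0 : ℝ), πc θ₀ α' * πm α' := by
  unfold priorGivenTheta jointPrior
  rw [condPrior_of_pos hθ₀ hα, margPrior_of_pos hα]

theorem profilePosterior_eq (hn : 2 ≤ n) (hS : 0 < quadVar n x) (hA : 0 < A₁ n x)
    (hθ₀ : 0 < θ₀) (hα₀ : 0 < α₀)
    (h1 : RegularCondPrior θ₀ πc) (h3 : MarginalPriorTails θ₀ α₀ πc πm) :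
    profilePosterior θ₀ πc πm n x = densityMeasure fun α =>
      profileFun n (bdryRatio n x) (invScale n x) α * jointPrior θ₀ πc πm α := by
  have hn0 : (0:ℝ) < n := by exact_mod_cast (by omega : 0 < n)
  have hs : 0 < √(n : ℝ) := Real.sqrt_pos.2 hn0
  have hI := integral_prior_pos hθ₀ hα₀ h1 h3
  refine withDensity_restrict_eq (c := Real.exp (logConst n x) / √(n : ℝ) /
    ∫ α' in Ioi (0 : ℝ), πc θ₀ α' * πm α') measurableSet_Ioi (by positivity)
    ((measurable_profileFun _ _ _).mul (measurable_jointPrior h1 h3)) ?_ ?_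
  · intro α hα
    rw [exp_profileLogLik hn hS hA hα, priorGivenTheta_eq hθ₀ hα]
    ring
  · intro α hα
    rw [jointPrior_of_nonpos (not_lt.1 hα), mul_zero]

theorem vStar_eq (x : ℕ → ℝ) : vStar n x = n * quadVar n x / A₁ n x := rfl

theorem tiltFun_eq (hn : 2 ≤ n) (hS : 0 < quadVar n x) (hA : 0 < A₁ n x) (α : ℝ) :
    √α * Real.exp (-(α - uStar n x) ^ 2 / (2 * vStar n x))
      = Real.exp (-(uStar n x) ^ 2 / (2 * vStar n x)) / √2 *
        tiltFun (bdryRatio n x) (invScale n x) α := by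
  have hn0 : (0:ℝ) < n := by exact_mod_cast (by omega : 0 < n)
  unfold tiltFun
  rw [Real.sqrt_mul (by norm_num)]
  have h2 : √(2:ℝ) ≠ 0 := by positivity
  have e : Real.exp (-(α - uStar n x) ^ 2 / (2 * vStar n x))
      = Real.exp (-(uStar n x) ^ 2 / (2 * vStar n x)) *
        Real.exp ((1 - bdryRatio n x) * α / 2 - invScale n x * α ^ 2 / 2) := by
    rw [← Real.exp_add]
    congr 1
    have hu : uStar n x / vStar n x = (1 - bdryRatio n x) / 2 := by
      rw [vStar_eq]
      unfold uStar bdryRatio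
      field_simp
      unfold bdrySq quadVar
      ring
    have hv : (vStar n x)⁻¹ = invScale n x := by
      rw [vStar_eq, inv_div]; rfl
    have hv0 : vStar n x ≠ 0 := by rw [vStar_eq]; positivity
    have e1 : -(α - uStar n x) ^ 2 / (2 * vStar n x) = -(uStar n x) ^ 2 / (2 * vStar n x)
        + (uStar n x / vStar n x * α - (vStar n x)⁻¹ * α ^ 2 / 2) := by
      field_simp; ring
    rw [e1, hu, hv]
    ring
  rw [e]
  field_simp

theorem tiltedNormalPosterior_eq (hn : 2 ≤ n) (hS : 0 < quadVar n x) (hA : 0 < A₁ n x)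
    (hθ₀ : 0 < θ₀) (hα₀ : 0 < α₀)
    (h1 : RegularCondPrior θ₀ πc) (h3 : MarginalPriorTails θ₀ α₀ πc πm) :
    tiltedNormalPosterior θ₀ πc πm n x = densityMeasure fun α =>
      tiltFun (bdryRatio n x) (invScale n x) α * jointPrior θ₀ πc πm α := by
  have hI := integral_prior_pos hθ₀ hα₀ h1 h3
  refine withDensity_restrict_eq (c := Real.exp (-(uStar n x) ^ 2 / (2 * vStar n x)) / √2 /
    ∫ α' in Ioi (0 : ℝ), πc θ₀ α' * πm α') measurableSet_Ioi (by positivity)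
    ((measurable_tiltFun _ _).mul (measurable_jointPrior h1 h3)) ?_ ?_
  · intro α hα
    rw [tiltFun_eq hn hS hA, priorGivenTheta_eq hθ₀ hα]
    ring
  · intro α hα
    rw [jointPrior_of_nonpos (not_lt.1 hα), mul_zero]

theorem gaussianReal_prod_densityMeasure (hθ₀ : 0 < θ₀) {n : ℝ} (hn : 0 < n) (t : ℝ) {k : ℝ → ℝ}
    (hk : Measurable k) (hktop : ∫⁻ α, ENNReal.ofReal (k α) ≠ ⊤)
    (hk0 : ∫⁻ α, ENNReal.ofReal (k α) ≠ 0) :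
    (gaussianReal t (2 * θ₀ ^ 2 / n).toNNReal).prod (densityMeasure k)
      = densityMeasure fun q : ℝ × ℝ => normalKer θ₀ n t q.1 * k q.2 := by
  have hv : (2 * θ₀ ^ 2 / n).toNNReal ≠ 0 := by
    rw [ne_eq, Real.toNNReal_eq_zero, not_le]; positivity
  set G := gaussianReal t (2 * θ₀ ^ 2 / n).toNNReal with hG
  set μ := (volume : Measure ℝ).withDensity fun x => ENNReal.ofReal (k x) with hμ
  have hμu : μ univ = ∫⁻ α, ENNReal.ofReal (k α) := by
    rw [hμ, withDensity_apply _ MeasurableSet.univ, setLIntegral_univ]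
  have : IsFiniteMeasure μ := ⟨by rw [hμu]; exact hktop.lt_top⟩
  have hprod : G.prod (normalized μ) = normalized (G.prod μ) := by
    unfold normalized
    have hc : (μ univ)⁻¹ ≠ ⊤ := by rw [hμu]; exact ENNReal.inv_ne_top.2 hk0
    have hu : (G.prod μ) univ = μ univ := by
      rw [← univ_prod_univ, Measure.prod_prod, measure_univ, one_mul]
    rw [hu, Measure.prod_smul_right]
  change G.prod (normalized μ) = _
  have hc : 0 < (2 * θ₀ * √Real.pi)⁻¹ := by positivity
  rw [hprod, hG, gaussianReal_of_var_ne_zero _ hv, hμ,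
    prod_withDensity (measurable_gaussianPDF _ _) hk.ennreal_ofReal]
  unfold densityMeasure
  rw [← normalized_withDensity_const_mul _
    (measurable_normalKer_mul θ₀ n t hk).ennreal_ofReal
    (ENNReal.ofReal_pos.2 hc).ne' ENNReal.ofReal_ne_top, Measure.volume_eq_prod]
  congr 2
  ext q
  rw [gaussianPDF, gaussianPDFReal_eq_normalKer hθ₀ hn, ENNReal.ofReal_mul hc.le,
    ENNReal.ofReal_mul (normalKer_nonneg _ _ _ _), mul_assoc]

theorem isProbabilityMeasure_densityMeasure {E : Type*} [MeasureSpace E] {f : E → ℝ}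
    (h0 : ∫⁻ x, ENNReal.ofReal (f x) ≠ 0) (h1 : ∫⁻ x, ENNReal.ofReal (f x) ≠ ⊤) :
    IsProbabilityMeasure (densityMeasure f) := by
  refine isProbabilityMeasure_normalized ?_ ?_ <;>
  rwa [withDensity_apply _ MeasurableSet.univ, setLIntegral_univ]

theorem isProbabilityMeasure_posterior (hn : 2 ≤ n) (hS : 0 < quadVar n x) (hA : 0 < A₁ n x)
    (hθ₀ : 0 < θ₀) (hα₀ : 0 < α₀)
    (h1 : RegularCondPrior θ₀ πc) (h3 : MarginalPriorTails θ₀ α₀ πc πm) :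
    IsProbabilityMeasure (posterior πc πm n x) := by
  have hn0 : (0:ℝ) < n := by exact_mod_cast (by omega : 0 < n)
  rw [posterior_eq hn hS hA h1 h3]
  exact isProbabilityMeasure_densityMeasure (lintegral_jointDensity_ne_zero hθ₀ hα₀ h1 h3 hn0)
    (lintegral_jointDensity_ne_top h1 h3 hn0 hS (bdryRatio_nonneg hn hS) (invScale_pos hn hS hA))

theorem isProbabilityMeasure_profilePosterior (hn : 2 ≤ n) (hS : 0 < quadVar n x)
    (hA : 0 < A₁ n x) (hθ₀ : 0 < θ₀) (hα₀ : 0 < α₀)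
    (h1 : RegularCondPrior θ₀ πc) (h3 : MarginalPriorTails θ₀ α₀ πc πm) :
    IsProbabilityMeasure (profilePosterior θ₀ πc πm n x) := by
  have hn0 : (0:ℝ) < n := by exact_mod_cast (by omega : 0 < n)
  rw [profilePosterior_eq hn hS hA hθ₀ hα₀ h1 h3]
  exact isProbabilityMeasure_densityMeasure
    (lintegral_mul_jointPrior_ne_zero hθ₀ hα₀ h1 h3 (measurable_profileFun _ _ _)
      fun _ hα => profileFun_pos hn0 hα)
    (lintegral_profileFun_ne_top hθ₀ h1 h3 hn0 (bdryRatio_nonneg hn hS) (invScale_pos hn hS hA))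

theorem isProbabilityMeasure_tiltedNormalPosterior (hn : 2 ≤ n) (hS : 0 < quadVar n x)
    (hA : 0 < A₁ n x) (hθ₀ : 0 < θ₀) (hα₀ : 0 < α₀)
    (h1 : RegularCondPrior θ₀ πc) (h3 : MarginalPriorTails θ₀ α₀ πc πm) :
    IsProbabilityMeasure (tiltedNormalPosterior θ₀ πc πm n x) := by
  rw [tiltedNormalPosterior_eq hn hS hA hθ₀ hα₀ h1 h3]
  exact isProbabilityMeasure_densityMeasure
    (lintegral_mul_jointPrior_ne_zero hθ₀ hα₀ h1 h3 (measurable_tiltFun _ _)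
      fun _ hα => tiltFun_pos hα)
    (lintegral_tiltFun_ne_top hθ₀ h1 h3 (bdryRatio_nonneg hn hS) (invScale_pos hn hS hA))

theorem thetaLimit_prod_profilePosterior (hn : 2 ≤ n) (hS : 0 < quadVar n x) (hA : 0 < A₁ n x)
    (hθ₀ : 0 < θ₀) (hα₀ : 0 < α₀)
    (h1 : RegularCondPrior θ₀ πc) (h3 : MarginalPriorTails θ₀ α₀ πc πm) :
    (thetaLimit θ₀ α₀ n x).prod (profilePosterior θ₀ πc πm n x)
      = densityMeasure fun q : ℝ × ℝ => normalKer θ₀ n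
          (thetaFun n (quadVar n x) (bdryRatio n x) (invScale n x) α₀) q.1 *
        (profileFun n (bdryRatio n x) (invScale n x) q.2 * jointPrior θ₀ πc πm q.2) := by
  have hn0 : (0:ℝ) < n := by exact_mod_cast (by omega : 0 < n)
  rw [profilePosterior_eq hn hS hA hθ₀ hα₀ h1 h3, thetaLimit, thetaTilde_eq hn hS.ne' hα₀]
  exact gaussianReal_prod_densityMeasure hθ₀ hn0 _
    ((measurable_profileFun _ _ _).mul (measurable_jointPrior h1 h3))
    (lintegral_profileFun_ne_top hθ₀ h1 h3 hn0 (bdryRatio_nonneg hn hS) (invScale_pos hn hS hA))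
    (lintegral_mul_jointPrior_ne_zero hθ₀ hα₀ h1 h3 (measurable_profileFun _ _ _)
      fun _ hα => profileFun_pos hn0 hα)

theorem thetaLimit_prod_tiltedNormalPosterior (hn : 2 ≤ n) (hS : 0 < quadVar n x)
    (hA : 0 < A₁ n x) (hθ₀ : 0 < θ₀) (hα₀ : 0 < α₀)
    (h1 : RegularCondPrior θ₀ πc) (h3 : MarginalPriorTails θ₀ α₀ πc πm) :
    (thetaLimit θ₀ α₀ n x).prod (tiltedNormalPosterior θ₀ πc πm n x)
      = densityMeasure fun q : ℝ × ℝ => normalKer θ₀ n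
          (thetaFun n (quadVar n x) (bdryRatio n x) (invScale n x) α₀) q.1 *
        (tiltFun (bdryRatio n x) (invScale n x) q.2 * jointPrior θ₀ πc πm q.2) := by
  have hn0 : (0:ℝ) < n := by exact_mod_cast (by omega : 0 < n)
  rw [tiltedNormalPosterior_eq hn hS hA hθ₀ hα₀ h1 h3, thetaLimit, thetaTilde_eq hn hS.ne' hα₀]
  exact gaussianReal_prod_densityMeasure hθ₀ hn0 _
    ((measurable_tiltFun _ _).mul (measurable_jointPrior h1 h3))
    (lintegral_tiltFun_ne_top hθ₀ h1 h3 (bdryRatio_nonneg hn hS) (invScale_pos hn hS hA))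
    (lintegral_mul_jointPrior_ne_zero hθ₀ hα₀ h1 h3 (measurable_tiltFun _ _)
      fun _ hα => tiltFun_pos hα)

end

/-! ### Uniformity over data sets of typical behaviour -/

/-- Two-sided bounds on the sufficient statistics. -/
structure BoundedStats (K : ℝ) (n : ℕ) (x : ℕ → ℝ) : Prop where
  quadVar_ge : 1 / K ≤ quadVar n x
  quadVar_le : quadVar n x ≤ K
  A₁_ge : n / K ≤ A₁ n x
  A₁_le : A₁ n x ≤ K * n
  bdrySq_le : bdrySq n x ≤ K

/-- Data for which the sufficient statistics are bounded and the microergodic parameter is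
estimated at the rate `√n`. -/
structure GoodData (K θ₀ α₀ : ℝ) (n : ℕ) (x : ℕ → ℝ) : Prop extends BoundedStats K n x where
  two_le : 2 ≤ n
  thetaTilde_near : |√(n : ℝ) * (thetaTilde n x α₀ - θ₀)| ≤ K

section
variable {K θ₀ α₀ : ℝ} {πc : ℝ → ℝ → ℝ} {πm : ℝ → ℝ} {n : ℕ} {x : ℕ → ℝ}

theorem BoundedStats.quadVar_pos (h : BoundedStats K n x) (hK : 1 ≤ K) : 0 < quadVar n x :=
  lt_of_lt_of_le (by positivity) h.quadVar_ge

theorem BoundedStats.A₁_pos (h : BoundedStats K n x) (hK : 1 ≤ K) (hn : 2 ≤ n) : 0 < A₁ n x := by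
  have hn0 : (0:ℝ) < n := by exact_mod_cast (by omega : 0 < n)
  exact lt_of_lt_of_le (by positivity) h.A₁_ge

theorem BoundedStats.bdryRatio_le (h : BoundedStats K n x) (hK : 1 ≤ K) :
    bdryRatio n x ≤ K ^ 2 := by
  have hS := h.quadVar_pos hK
  have hK0 : 0 < K := by linarith
  unfold bdryRatio
  rw [div_le_iff₀ hS]
  have h1 := h.quadVar_ge
  rw [div_le_iff₀ hK0] at h1
  nlinarith [h.bdrySq_le]

theorem BoundedStats.invScale_mem (h : BoundedStats K n x) (hK : 1 ≤ K) (hn : 2 ≤ n) :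
    1 / K ^ 2 ≤ invScale n x ∧ invScale n x ≤ K ^ 2 := by
  have hS := h.quadVar_pos hK
  have hK0 : 0 < K := by linarith
  have hn0 : (0:ℝ) < n := by exact_mod_cast (by omega : 0 < n)
  have h1 := h.quadVar_ge
  have h2 := h.A₁_ge
  rw [div_le_iff₀ hK0] at h1 h2
  unfold invScale
  constructor
  · rw [div_le_div_iff₀ (by positivity) (by positivity), one_mul]
    calc (n : ℝ) * quadVar n x ≤ (A₁ n x * K) * K := by
          have := h.quadVar_le
          have := h.A₁_pos hK hn
          gcongr
      _ = _ := by ring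
  · rw [div_le_iff₀ (by positivity)]
    calc A₁ n x ≤ K * n := h.A₁_le
      _ = K * n * 1 := by ring
      _ ≤ K * n * (quadVar n x * K) := by gcongr
      _ = _ := by ring

/-- The total variation distances are uniformly small over good data. -/
theorem exists_forall_goodData_tvDist_lt (hK : 1 ≤ K) (hθ₀ : 0 < θ₀) (hα₀ : 0 < α₀)
    (h1 : RegularCondPrior θ₀ πc) (h2 : CondPriorGrowth θ₀ πc)
    (h3 : MarginalPriorTails θ₀ α₀ πc πm) {ε : ℝ} (hε : 0 < ε) :
    ∃ N : ℕ, ∀ n ≥ N, ∀ x, GoodData K θ₀ α₀ n x →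
      tvDist (posterior πc πm n x)
        ((thetaLimit θ₀ α₀ n x).prod (profilePosterior θ₀ πc πm n x)) < ε ∧
      tvDist (posterior πc πm n x)
        ((thetaLimit θ₀ α₀ n x).prod (tiltedNormalPosterior θ₀ πc πm n x)) < ε := by
  set l : Filter (ℕ × (ℕ → ℝ)) := comap Prod.fst atTop ⊓ 𝓟 {p | GoodData K θ₀ α₀ p.1 p.2} with hl
  have hfst : Tendsto (Prod.fst : ℕ × (ℕ → ℝ) → ℕ) l atTop := tendsto_comap.mono_left inf_le_left
  have hgood : ∀ᶠ p in l, GoodData K θ₀ α₀ p.1 p.2 := mem_inf_of_right (mem_principal_self _)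
  have hKK : K ≤ K ^ 2 := by nlinarith
  have main := tendsto_tvDist_densityMeasure (l := l) (ν := Prod.fst)
    (S := fun p => quadVar p.1 p.2) (b := fun p => bdryRatio p.1 p.2)
    (w := fun p => invScale p.1 p.2) (K := K ^ 2) (w0 := 1 / K ^ 2) hθ₀ hα₀ h1 h2 h3 hfst
    (hgood.mono fun p h => ⟨h.quadVar_pos hK, h.quadVar_le.trans hKK⟩)
    (hgood.mono fun p h => ⟨bdryRatio_nonneg h.two_le (h.quadVar_pos hK), h.bdryRatio_le hK⟩)
    (by positivity) (hgood.mono fun p h => h.invScale_mem hK h.two_le)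
    (hgood.mono fun p h => by
      rw [← thetaTilde_eq h.two_le (h.quadVar_pos hK).ne' hα₀]
      exact h.thetaTilde_near.trans hKK)
  have hev := (main.1.eventually_lt_const hε).and (main.2.eventually_lt_const hε)
  rw [hl, eventually_inf_principal, eventually_comap] at hev
  obtain ⟨N, hN⟩ := eventually_atTop.1 hev
  refine ⟨N, fun n hn x hx => ?_⟩
  have hS := hx.quadVar_pos hK
  have hA := hx.A₁_pos hK hx.two_le
  have h := hN n hn (n, x) rfl hx
  rw [posterior_eq hx.two_le hS hA h1 h3,
    thetaLimit_prod_profilePosterior hx.two_le hS hA hθ₀ hα₀ h1 h3,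
    thetaLimit_prod_tiltedNormalPosterior hx.two_le hS hA hθ₀ hα₀ h1 h3]
  exact h

theorem densityMeasure_apply {E : Type*} [MeasureSpace E] {f : E → ℝ} {A : Set E}
    (hA : MeasurableSet A) :
    densityMeasure f A = (∫⁻ x in A, ENNReal.ofReal (f x)) / ∫⁻ x, ENNReal.ofReal (f x) := by
  unfold densityMeasure normalized
  rw [Measure.smul_apply, withDensity_apply _ hA, withDensity_apply _ MeasurableSet.univ,
    setLIntegral_univ, smul_eq_mul, mul_comm, div_eq_mul_inv]

/-- The tilted normal distribution gives uniformly positive mass to intervals that the prior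
charges. -/
theorem exists_le_tiltedNormalPosterior (hK : 1 ≤ K) (hθ₀ : 0 < θ₀) (hα₀ : 0 < α₀)
    (h1 : RegularCondPrior θ₀ πc) (h3 : MarginalPriorTails θ₀ α₀ πc πm) {a₁ a₂ : ℝ} (ha₁ : 0 < a₁)
    (ha : a₁ < a₂) (hpos : ∀ α ∈ Icc a₁ a₂, 0 < jointPrior θ₀ πc πm α) :
    ∃ c : ℝ, 0 < c ∧ ∀ n x, GoodData K θ₀ α₀ n x →
      c ≤ (tiltedNormalPosterior θ₀ πc πm n x).real (Icc a₁ a₂) := by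
  have hjp := measurable_jointPrior h1 h3
  set I := ∫⁻ α in Icc a₁ a₂, ENNReal.ofReal (jointPrior θ₀ πc πm α) with hI
  set M := ∫⁻ α, ENNReal.ofReal (√(2 * α) * jointPrior θ₀ πc πm α) with hM
  have hMtop : M ≠ ⊤ := (lintegral_sqrt_jointPrior_lt_top hθ₀ h3).ne
  set L := K ^ 2
  set c0 := √(2 * a₁) * Real.exp (-(L * a₂ + L * a₂ ^ 2)) with hc0
  have hc0pos : 0 < c0 := by positivity
  set C := Real.exp (1 / (4 * (1 / L))) with hC
  have hCpos : 0 < C := Real.exp_pos _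
  have hI0 : I ≠ 0 := by
    rw [hI, ← lintegral_indicator measurableSet_Icc]
    refine lintegral_ne_zero_of_eventually_pos (a := (a₁ + a₂) / 2)
      (hjp.ennreal_ofReal.indicator measurableSet_Icc) ?_
    filter_upwards [Icc_mem_nhds (show a₁ < (a₁ + a₂) / 2 by linarith)
      (show (a₁ + a₂) / 2 < a₂ by linarith)] with α hα
    rw [indicator_of_mem hα]
    exact ENNReal.ofReal_pos.2 (hpos α hα)
  set r := ENNReal.ofReal c0 * I / (ENNReal.ofReal C * M) with hr
  have key : ∀ n x, GoodData K θ₀ α₀ n x →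
      r ≤ tiltedNormalPosterior θ₀ πc πm n x (Icc a₁ a₂) := by
    intro n x hx
    have hS := hx.quadVar_pos hK
    have hA := hx.A₁_pos hK hx.two_le
    have hb0 := bdryRatio_nonneg hx.two_le hS
    have hb := hx.bdryRatio_le hK
    have hw := hx.invScale_mem hK hx.two_le
    rw [tiltedNormalPosterior_eq hx.two_le hS hA hθ₀ hα₀ h1 h3,
      densityMeasure_apply measurableSet_Icc]
    refine ENNReal.div_le_div ?_ ?_
    · rw [hI, ← lintegral_const_mul' _ _ ENNReal.ofReal_ne_top]
      have hm := measurable_tiltFun (bdryRatio n x) (invScale n x)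
      refine setLIntegral_mono (by fun_prop) fun α hα => ?_
      rw [← ENNReal.ofReal_mul hc0pos.le]
      apply ENNReal.ofReal_le_ofReal
      refine mul_le_mul_of_nonneg_right (tiltFun_ge hb ?_ ha₁ hα) (hpos α hα).le
      rw [abs_of_pos (invScale_pos hx.two_le hS hA)]
      exact hw.2
    · rw [hM, ← lintegral_const_mul' _ _ ENNReal.ofReal_ne_top]
      refine lintegral_mono fun α => ?_
      rw [← ENNReal.ofReal_mul hCpos.le]
      apply ENNReal.ofReal_le_ofReal
      rcases le_or_gt α 0 with hα | hα
      · simp [jointPrior_of_nonpos hα]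
      · rw [← mul_assoc]
        exact mul_le_mul_of_nonneg_right (tiltFun_le hb0 (by positivity) hw.1 hα)
          (jointPrior_nonneg h1 h3 α)
  have hr0 : r ≠ 0 := by
    rw [hr, ne_eq, ENNReal.div_eq_zero_iff, not_or]
    exact ⟨mul_ne_zero (ENNReal.ofReal_pos.2 hc0pos).ne' hI0,
      ENNReal.mul_ne_top ENNReal.ofReal_ne_top hMtop⟩
  refine ⟨(min r 1).toReal, ENNReal.toReal_pos (by simp [hr0]) (by simp), fun n x hx => ?_⟩
  have hp := isProbabilityMeasure_tiltedNormalPosterior hx.two_le (hx.quadVar_pos hK)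
    (hx.A₁_pos hK hx.two_le) hθ₀ hα₀ h1 h3
  exact ENNReal.toReal_mono (measure_ne_top _ _) ((min_le_left _ _).trans (key n x hx))

end

/-! ### Non-degeneracy of the marginal posterior -/

/-- The piecewise linear function that is `0` below `a` and `1` above `b`. -/
noncomputable def ramp (a b : ℝ) : ℝ →ᵇ ℝ :=
  BoundedContinuousFunction.ofNormedAddCommGroup (fun t => max 0 (min 1 ((t - a) / (b - a))))
    (by fun_prop) 1 fun t => by
      rw [Real.norm_eq_abs, abs_of_nonneg (le_max_left _ _)]
      exact max_le zero_le_one (min_le_left _ _)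

theorem ramp_apply (a b t : ℝ) : ramp a b t = max 0 (min 1 ((t - a) / (b - a))) := rfl

theorem ramp_of_le {a b t : ℝ} (hab : a < b) (ht : t ≤ a) : ramp a b t = 0 := by
  rw [ramp_apply]
  have : (t - a) / (b - a) ≤ 0 := div_nonpos_of_nonpos_of_nonneg (by linarith) (by linarith)
  exact max_eq_left ((min_le_right _ _).trans this)

theorem ramp_of_ge {a b t : ℝ} (hab : a < b) (ht : b ≤ t) : ramp a b t = 1 := by
  rw [ramp_apply]
  have : 1 ≤ (t - a) / (b - a) := by rw [le_div_iff₀ (by linarith)]; linarith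
  rw [min_eq_left this]; norm_num

theorem quarter_le_integral_sq_sub {Q : Measure ℝ} [IsProbabilityMeasure Q] {a b c m : ℝ}
    {E₁ E₂ : Set ℝ} (hab : a < b) (hE₁m : MeasurableSet E₁) (hE₂m : MeasurableSet E₂)
    (hE₁ : ∀ t ∈ E₁, t ≤ a) (hE₂ : ∀ t ∈ E₂, b ≤ t) (hc : 0 ≤ c)
    (h₁ : c ≤ Q.real E₁) (h₂ : c ≤ Q.real E₂) :
    c / 2 ≤ ∫ t, (ramp a b * ramp a b) t ∂Q - 2 * m * ∫ t, ramp a b t ∂Q + m ^ 2 := by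
  have i1 : Integrable (fun t => (ramp a b * ramp a b) t) Q := BoundedContinuousFunction.integrable _ _
  have i2 : Integrable (fun t => ramp a b t) Q := BoundedContinuousFunction.integrable _ _
  have e : ∫ t, (ramp a b * ramp a b) t ∂Q - 2 * m * ∫ t, ramp a b t ∂Q + m ^ 2
      = ∫ t, (ramp a b t - m) ^ 2 ∂Q := by
    have e1 : (fun t => (ramp a b t - m) ^ 2)
        = fun t => ((ramp a b * ramp a b) t - 2 * m * ramp a b t) + m ^ 2 := by
      ext t; simp only [BoundedContinuousFunction.coe_mul, Pi.mul_apply]; ring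
    have i4 : Integrable (fun t => (ramp a b * ramp a b) t - 2 * m * ramp a b t) Q :=
      i1.sub (i2.const_mul _)
    rw [e1, integral_add i4 (integrable_const _),
      integral_sub i1 (i2.const_mul _), integral_const_mul, integral_const]
    simp
  have i3 : Integrable (fun t => (ramp a b t - m) ^ 2) Q := by
    have e1 : (fun t => (ramp a b t - m) ^ 2)
        = fun t => ((ramp a b * ramp a b) t - 2 * m * ramp a b t) + m ^ 2 := by
      ext t; simp only [BoundedContinuousFunction.coe_mul, Pi.mul_apply]; ring
    rw [e1]
    exact (i1.sub (i2.const_mul _)).add (integrable_const _)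
  have hlow : ∫ t, (E₁.indicator (fun _ => m ^ 2) t + E₂.indicator (fun _ => (1 - m) ^ 2) t) ∂Q
      ≤ ∫ t, (ramp a b t - m) ^ 2 ∂Q := by
    refine integral_mono (((integrable_const _).indicator hE₁m).add
      ((integrable_const _).indicator hE₂m)) i3 fun t => ?_
    simp only
    by_cases ht1 : t ∈ E₁
    · have ht2 : t ∉ E₂ := fun h => by linarith [hE₁ t ht1, hE₂ t h]
      rw [indicator_of_mem ht1, indicator_of_notMem ht2, ramp_of_le hab (hE₁ t ht1)]
      apply le_of_eq; ring
    · rw [indicator_of_notMem ht1]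
      by_cases ht2 : t ∈ E₂
      · rw [indicator_of_mem ht2, ramp_of_ge hab (hE₂ t ht2)]
        simp
      · rw [indicator_of_notMem ht2]
        simp only [add_zero]
        positivity
  rw [integral_add ((integrable_const _).indicator hE₁m) ((integrable_const _).indicator hE₂m),
    integral_indicator_const _ hE₁m, integral_indicator_const _ hE₂m, smul_eq_mul,
    smul_eq_mul] at hlow
  rw [e]
  refine le_trans ?_ hlow
  have h3 := mul_le_mul_of_nonneg_right h₁ (sq_nonneg m)
  have h4 := mul_le_mul_of_nonneg_right h₂ (sq_nonneg (1 - m))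
  nlinarith [mul_nonneg hc (sq_nonneg (2 * m - 1))]

section
variable {Ω : Type*} [MeasurableSpace Ω] {P : Measure Ω} {X : ℝ → Ω → ℝ}
  {K θ₀ α₀ : ℝ} {πc : ℝ → ℝ → ℝ} {πm : ℝ → ℝ}

/-- With probability arbitrarily close to one, the data are good. -/
def EventuallyGood (X : ℝ → Ω → ℝ) (P : Measure Ω) (θ₀ α₀ : ℝ) : Prop :=
  ∀ δ : ENNReal, 0 < δ → ∃ K : ℝ, 1 ≤ K ∧ ∀ᶠ n : ℕ in atTop,
    P {ω | ¬ GoodData K θ₀ α₀ n (obs X n ω)} ≤ δ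

theorem tendstoInMeasure_zero_of_eventuallyGood (hgood : EventuallyGood X P θ₀ α₀)
    {d : ℕ → (ℕ → ℝ) → ℝ} (hd0 : ∀ n x, 0 ≤ d n x)
    (hd : ∀ K : ℝ, 1 ≤ K → ∀ ε > 0, ∃ N : ℕ, ∀ n ≥ N, ∀ x, GoodData K θ₀ α₀ n x → d n x < ε) :
    TendstoInMeasure P (fun n ω => d n (obs X n ω)) atTop (fun _ => (0 : ℝ)) := by
  rw [tendstoInMeasure_iff_norm]
  intro ε hε
  rw [ENNReal.tendsto_nhds_zero]
  intro δ hδ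
  obtain ⟨K, hK, hev⟩ := hgood δ hδ
  obtain ⟨N, hN⟩ := hd K hK ε hε
  filter_upwards [hev, eventually_ge_atTop N] with n h1 h2
  refine (measure_mono fun ω hω => ?_).trans h1
  simp only [mem_ofPred_eq, sub_zero, Real.norm_eq_abs, abs_of_nonneg (hd0 _ _)] at hω ⊢
  exact fun hg => absurd (hN n h2 _ hg) (not_lt.2 hω)

theorem not_tendstoWeaklyInProb_dirac [IsProbabilityMeasure P]
    (hgood : EventuallyGood X P θ₀ α₀) (hθ₀ : 0 < θ₀) (hα₀ : 0 < α₀)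
    (h1 : RegularCondPrior θ₀ πc) (h2 : CondPriorGrowth θ₀ πc)
    (h3 : MarginalPriorTails θ₀ α₀ πc πm) (a : Ω → ℝ) :
    ¬ TendstoWeaklyInProb P (fun n ω => (posterior πc πm n (obs X n ω)).snd)
      (fun ω => Measure.dirac (a ω)) := by
  intro hweak
  obtain ⟨ε, hε, hball⟩ := Metric.eventually_nhds_iff_ball.1
    (jointPrior_eventually_pos hθ₀ hα₀ h1 h3)
  have hsub : ∀ s t : ℝ, α₀ - ε < s → t < α₀ + ε → Icc s t ⊆ Metric.ball α₀ ε := by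
    intro s t hs ht u hu
    rw [Real.ball_eq_Ioo]
    exact ⟨hs.trans_le hu.1, hu.2.trans_lt ht⟩
  obtain ⟨K, hK, hev⟩ := hgood (1 / 2) (by norm_num)
  obtain ⟨s₁, hs₁⟩ : ∃ s, s = α₀ - ε / 2 := ⟨_, rfl⟩
  obtain ⟨s₂, hs₂⟩ : ∃ s, s = α₀ - ε / 4 := ⟨_, rfl⟩
  obtain ⟨s₃, hs₃⟩ : ∃ s, s = α₀ + ε / 4 := ⟨_, rfl⟩
  obtain ⟨s₄, hs₄⟩ : ∃ s, s = α₀ + ε / 2 := ⟨_, rfl⟩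
  have hI₁ : Icc s₁ s₂ ⊆ Metric.ball α₀ ε := hsub _ _ (by linarith) (by linarith)
  have hI₂ : Icc s₃ s₄ ⊆ Metric.ball α₀ ε := hsub _ _ (by linarith) (by linarith)
  obtain ⟨c₁, hc₁, hm₁⟩ := exists_le_tiltedNormalPosterior (a₁ := s₁) (a₂ := s₂) hK hθ₀ hα₀ h1 h3
    (hball s₁ (hI₁ ⟨le_rfl, by linarith⟩)).1 (by linarith) fun α hα => (hball α (hI₁ hα)).2
  obtain ⟨c₂, hc₂, hm₂⟩ := exists_le_tiltedNormalPosterior (a₁ := s₃) (a₂ := s₄) hK hθ₀ hα₀ h1 h3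
    (hball s₃ (hI₂ ⟨le_rfl, by linarith⟩)).1 (by linarith) fun α hα => (hball α (hI₂ hα)).2
  set c := min c₁ c₂ / 2 with hc
  have hcpos : 0 < c := by have := lt_min hc₁ hc₂; positivity
  obtain ⟨N, hN⟩ := exists_forall_goodData_tvDist_lt hK hθ₀ hα₀ h1 h2 h3 hcpos
  set f := ramp s₂ s₃
  have h23 : s₂ < s₃ := by linarith
  have hw1 := (tendstoInMeasure_iff_norm.1 (hweak f)) (c / 16) (by positivity)
  have hw2 := (tendstoInMeasure_iff_norm.1 (hweak (f * f))) (c / 16) (by positivity)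
  have hsum := hw1.add hw2
  rw [add_zero] at hsum
  have hlt := hsum.eventually_lt_const (show (0 : ENNReal) < 1 / 2 by norm_num)
  obtain ⟨n, hn1, hn2, hn3⟩ := (hev.and (hlt.and (eventually_ge_atTop N))).exists
  have hcover : (univ : Set Ω) ⊆ {ω | ¬ GoodData K θ₀ α₀ n (obs X n ω)} ∪
      ({ω | c / 16 ≤ ‖∫ t, f t ∂(posterior πc πm n (obs X n ω)).snd
        - ∫ t, f t ∂(Measure.dirac (a ω))‖} ∪
      {ω | c / 16 ≤ ‖∫ t, (f * f) t ∂(posterior πc πm n (obs X n ω)).snd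
        - ∫ t, (f * f) t ∂(Measure.dirac (a ω))‖}) := by
    intro ω _
    by_contra hcon
    simp only [mem_union, mem_ofPred_eq, not_or, not_not, not_le] at hcon
    obtain ⟨hg, hb1, hb2⟩ := hcon
    set x := obs X n ω
    have hS := hg.quadVar_pos hK
    have hA := hg.A₁_pos hK hg.two_le
    have hp1 := isProbabilityMeasure_posterior hg.two_le hS hA hθ₀ hα₀ h1 h3
    have hp2 := isProbabilityMeasure_tiltedNormalPosterior hg.two_le hS hA hθ₀ hα₀ h1 h3
    have hp3 : IsProbabilityMeasure (thetaLimit θ₀ α₀ n x) := by unfold thetaLimit; infer_instance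
    have htv := (hN n hn3 x hg).2
    have hmass : ∀ E : Set ℝ, MeasurableSet E → min c₁ c₂
        ≤ (tiltedNormalPosterior θ₀ πc πm n x).real E →
        c ≤ (posterior πc πm n x).snd.real E := by
      intro E hE hmE
      have h5 := abs_sub_le_tvDist (posterior πc πm n x)
        ((thetaLimit θ₀ α₀ n x).prod (tiltedNormalPosterior θ₀ πc πm n x))
        (MeasurableSet.univ.prod hE : MeasurableSet ((univ : Set ℝ) ×ˢ E))
      have h6 : ((thetaLimit θ₀ α₀ n x).prod (tiltedNormalPosterior θ₀ πc πm n x)).real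
          ((univ : Set ℝ) ×ˢ E) = (tiltedNormalPosterior θ₀ πc πm n x).real E := by
        simp [Measure.real, Measure.prod_prod]
      have h7 : (posterior πc πm n x).snd.real E
          = (posterior πc πm n x).real ((univ : Set ℝ) ×ˢ E) := by
        rw [Measure.real, Measure.snd_apply hE, univ_prod]; rfl
      rw [h7]
      rw [h6] at h5
      have := (abs_le.1 h5).1
      linarith
    have hE1 := hmass (Icc s₁ s₂) measurableSet_Icc ((min_le_left _ _).trans (hm₁ n x hg))
    have hE2 := hmass (Icc s₃ s₄) measurableSet_Icc ((min_le_right _ _).trans (hm₂ n x hg))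
    have hq := quarter_le_integral_sq_sub (m := f (a ω)) h23 measurableSet_Icc measurableSet_Icc
      (fun t ht => ht.2) (fun t ht => ht.1) hcpos.le hE1 hE2
    rw [integral_dirac, Real.norm_eq_abs, abs_lt] at hb1 hb2
    have hm0 : 0 ≤ f (a ω) := le_max_left _ _
    have hm1 : f (a ω) ≤ 1 := max_le zero_le_one (min_le_left _ _)
    set J1 := ∫ t, f t ∂(posterior πc πm n x).snd
    set J2 := ∫ t, (f * f) t ∂(posterior πc πm n x).snd
    set m := f (a ω)
    have hff : (f * f) (a ω) = m * m := rfl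
    rw [hff] at hb2
    nlinarith [hb1.1, hb1.2, hb2.1, hb2.2]
  have hle := (measure_mono (μ := P) hcover).trans
    ((measure_union_le _ _).trans (add_le_add le_rfl (measure_union_le _ _)))
  rw [measure_univ] at hle
  have hlt' := hle.trans_lt (ENNReal.add_lt_add_of_le_of_lt
    ((hn1.trans_lt (by norm_num : (1 / 2 : ENNReal) < ⊤)).ne) hn1 hn2)
  rw [ENNReal.add_halves] at hlt'
  exact lt_irrefl _ hlt'

end

/-! ### Sums of squares of independent standard normal variables -/

theorem integral_exp_mul_sq_gaussianReal {t : ℝ} (ht : t < 1 / 2) :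
    ∫ z, Real.exp (t * z ^ 2) ∂gaussianReal 0 1 = 1 / √(1 - 2 * t) := by
  rw [integral_gaussianReal_eq_integral_smul one_ne_zero]
  have e : ∀ z : ℝ, gaussianPDFReal 0 1 z • Real.exp (t * z ^ 2)
      = (√(2 * Real.pi))⁻¹ * Real.exp (-(1 / 2 - t) * z ^ 2) := by
    intro z
    simp only [gaussianPDFReal, smul_eq_mul, NNReal.coe_one, mul_one, sub_zero, mul_assoc]
    rw [← Real.exp_add]
    congr 2
    ring
  have h1 : 0 < 1 - 2 * t := by linarith
  simp_rw [e]
  rw [integral_const_mul, integral_gaussian,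
    show Real.pi / (1 / 2 - t) = 2 * Real.pi / (1 - 2 * t) by
      rw [div_eq_div_iff (by linarith) h1.ne']; ring,
    Real.sqrt_div (by positivity)]
  have h2 : √(2 * Real.pi) ≠ 0 := by positivity
  field_simp

theorem integrable_pow_gaussianReal (v : NNReal) (k : ℕ) :
    Integrable (fun z : ℝ => z ^ k) (gaussianReal 0 v) := by
  have h := (memLp_id_gaussianReal (μ := 0) (v := v) (k : NNReal)).integrable_norm_pow'
  simp only [id_eq] at h
  refine (integrable_norm_iff (by fun_prop)).1 ?_
  simpa [norm_pow] using h

theorem integral_sq_gaussianReal : ∫ z, z ^ 2 ∂gaussianReal 0 1 = 1 := by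
  have h := variance_fun_id_gaussianReal (μ := 0) (v := 1)
  rw [variance_of_integral_eq_zero (by fun_prop) (by simp [integral_id_gaussianReal])] at h
  simpa using h

theorem integral_pow_four_gaussianReal (v : NNReal) :
    ∫ z, z ^ 4 ∂gaussianReal 0 v = (v : ℝ) ^ 2 * ∫ z, z ^ 4 ∂gaussianReal 0 1 := by
  have h := gaussianReal_map_const_mul (μ := 0) (v := 1) (√(v : ℝ))
  have h2 : gaussianReal 0 v = (gaussianReal 0 1).map (√(v : ℝ) * ·) := by
    rw [h, mul_zero]
    congr 1
    ext
    simp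
  rw [h2, integral_map (by fun_prop) (by fun_prop), ← integral_const_mul]
  congr 1
  ext z
  have : √(v : ℝ) ^ 4 = (v : ℝ) ^ 2 := by
    rw [show 4 = 2 * 2 from rfl, pow_mul, Real.sq_sqrt v.coe_nonneg]
  rw [mul_pow, this]

section
variable {Ω : Type*} [MeasurableSpace Ω] {P : Measure Ω}

/-- A fourth-moment tail bound for a centered normal variable. -/
theorem measure_le_abs_of_map_eq_gaussianReal [IsProbabilityMeasure P] {D : Ω → ℝ} {v : NNReal}
    (hm : AEMeasurable D P) (hD : P.map D = gaussianReal 0 v) {a : ℝ} (ha : 0 < a) :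
    P {ω | a ≤ |D ω|}
      ≤ ENNReal.ofReal ((∫ z, z ^ 4 ∂gaussianReal 0 1) * ((v : ℝ) ^ 2 / a ^ 4)) := by
  have hi : Integrable (fun ω => D ω ^ 4) P := by
    have := integrable_pow_gaussianReal v 4
    rw [← hD] at this
    exact this.comp_aemeasurable hm
  have h1 := mul_meas_ge_le_integral_of_nonneg (μ := P) (f := fun ω => D ω ^ 4)
    (Eventually.of_forall fun ω => by positivity) hi (a ^ 4)
  have h2 : ∫ ω, D ω ^ 4 ∂P = (v : ℝ) ^ 2 * ∫ z, z ^ 4 ∂gaussianReal 0 1 := by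
    rw [← integral_pow_four_gaussianReal, ← hD, integral_map hm (by fun_prop)]
  have h3 : {ω | a ≤ |D ω|} ⊆ {ω | a ^ 4 ≤ D ω ^ 4} := by
    intro ω hω
    simp only [mem_ofPred_eq] at hω ⊢
    have := pow_le_pow_left₀ ha.le hω 4
    rwa [← abs_pow, abs_of_nonneg (by positivity : (0:ℝ) ≤ D ω ^ 4)] at this
  rw [← ofReal_measureReal]
  apply ENNReal.ofReal_le_ofReal
  refine (measureReal_mono h3).trans ?_
  rw [h2] at h1
  rw [← mul_div_assoc, le_div_iff₀ (by positivity)]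
  linarith

variable {ι : Type*} [Fintype ι] {Z : ι → Ω → ℝ}

theorem mgf_sum_sq (hind : iIndepFun Z P) (hlaw : ∀ i, P.map (Z i) = gaussianReal 0 1) {t : ℝ}
    (ht : t < 1 / 2) :
    mgf (fun ω => ∑ i, Z i ω ^ 2) P t = (1 / √(1 - 2 * t)) ^ Fintype.card ι := by
  have hm : ∀ i, AEMeasurable (Z i) P := fun i =>
    AEMeasurable.of_map_ne_zero (by rw [hlaw i]; exact NeZero.ne _)
  have h := (hind.comp (fun _ z => z ^ 2) (fun _ => by fun_prop)).mgf_sum₀ (t := t)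
    (fun i => (hm i).pow_const 2) Finset.univ
  have e1 : (∑ i, (fun z : ℝ => z ^ 2) ∘ Z i) = fun ω => ∑ i, Z i ω ^ 2 := by
    ext ω; simp
  rw [e1] at h
  rw [h, Finset.prod_congr rfl (g := fun _ => 1 / √(1 - 2 * t)), Finset.prod_const,
    Finset.card_univ]
  intro i _
  rw [← integral_exp_mul_sq_gaussianReal ht, ← hlaw i, integral_map (hm i) (by fun_prop)]
  rfl

theorem integrable_exp_mul_sum_sq (hind : iIndepFun Z P)
    (hlaw : ∀ i, P.map (Z i) = gaussianReal 0 1) {t : ℝ} (ht : t < 1 / 2) :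
    Integrable (fun ω => Real.exp (t * ∑ i, Z i ω ^ 2)) P := by
  by_contra hcon
  have h1 := mgf_undef hcon
  rw [mgf_sum_sq hind hlaw ht] at h1
  have : 0 < 1 - 2 * t := by linarith
  have : (1 / √(1 - 2 * t)) ^ Fintype.card ι ≠ 0 := by positivity
  contradiction

theorem measure_le_sum_sq [IsProbabilityMeasure P] (hind : iIndepFun Z P) (hlaw : ∀ i, P.map (Z i) = gaussianReal 0 1) :
    P {ω | 4 * (Fintype.card ι : ℝ) ≤ ∑ i, Z i ω ^ 2}
      ≤ ENNReal.ofReal ((Real.exp (-1) * √2) ^ Fintype.card ι) := by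
  rw [← ofReal_measureReal]
  apply ENNReal.ofReal_le_ofReal
  refine (measure_ge_le_exp_mul_mgf (t := 1 / 4) _ (by norm_num)
    (integrable_exp_mul_sum_sq hind hlaw (by norm_num))).trans (le_of_eq ?_)
  rw [mgf_sum_sq hind hlaw (by norm_num), mul_pow, ← Real.exp_nat_mul]
  congr 2
  · ring
  · rw [show (1 : ℝ) - 2 * (1 / 4) = 2⁻¹ by norm_num, Real.sqrt_inv, one_div, inv_inv]

theorem measure_sum_sq_le [IsProbabilityMeasure P] (hind : iIndepFun Z P) (hlaw : ∀ i, P.map (Z i) = gaussianReal 0 1) :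
    P {ω | ∑ i, Z i ω ^ 2 ≤ (Fintype.card ι : ℝ) / 9}
      ≤ ENNReal.ofReal ((Real.exp (4 / 9) / 3) ^ Fintype.card ι) := by
  rw [← ofReal_measureReal]
  apply ENNReal.ofReal_le_ofReal
  refine (measure_le_le_exp_mul_mgf (t := -4) _ (by norm_num)
    (integrable_exp_mul_sum_sq hind hlaw (by norm_num))).trans (le_of_eq ?_)
  rw [mgf_sum_sq hind hlaw (by norm_num), div_eq_mul_one_div (Real.exp _), mul_pow,
    ← Real.exp_nat_mul]
  congr 2
  · ring
  · rw [show (1 : ℝ) - 2 * (-4) = 3 ^ 2 by norm_num, Real.sqrt_sq (by norm_num)]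

theorem measure_le_abs_sum_sq_sub [IsProbabilityMeasure P] (hind : iIndepFun Z P)
    (hlaw : ∀ i, P.map (Z i) = gaussianReal 0 1) {c : ℝ} (hc : 0 < c) :
    P {ω | c ≤ |∑ i, Z i ω ^ 2 - Fintype.card ι|}
      ≤ ENNReal.ofReal (Fintype.card ι * Var[fun z => z ^ 2; gaussianReal 0 1] / c ^ 2) := by
  have hm : ∀ i, AEMeasurable (Z i) P := fun i =>
    AEMeasurable.of_map_ne_zero (by rw [hlaw i]; exact NeZero.ne _)
  have hL : ∀ i, MemLp (fun ω => Z i ω ^ 2) 2 P := by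
    intro i
    refine (memLp_two_iff_integrable_sq ((hm i).pow_const 2).aestronglyMeasurable).2 ?_
    have := integrable_pow_gaussianReal 1 4
    rw [← hlaw i] at this
    simpa [← pow_mul, Function.comp_def] using this.comp_aemeasurable (hm i)
  have hmean : ∀ i, ∫ ω, Z i ω ^ 2 ∂P = 1 := by
    intro i
    rw [← integral_sq_gaussianReal, ← hlaw i, integral_map (hm i) (by fun_prop)]
  have hvar : ∀ i, Var[fun ω => Z i ω ^ 2; P] = Var[fun z => z ^ 2; gaussianReal 0 1] := by
    intro i
    rw [← hlaw i, variance_map (by fun_prop) (hm i)]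
    rfl
  have hsum : MemLp (fun ω => ∑ i, Z i ω ^ 2) 2 P := memLp_finsetSum _ fun i _ => hL i
  have h := meas_ge_le_variance_div_sq hsum hc
  have e1 : ∫ ω, ∑ i, Z i ω ^ 2 ∂P = Fintype.card ι := by
    rw [integral_finsetSum _ fun i _ => (hL i).integrable (by norm_num)]
    simp [hmean]
  have e2 : Var[fun ω => ∑ i, Z i ω ^ 2; P]
      = Fintype.card ι * Var[fun z => z ^ 2; gaussianReal 0 1] := by
    have h5 := IndepFun.variance_sum (s := Finset.univ) (X := fun i ω => Z i ω ^ 2)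
      (fun i _ => hL i) (fun i _ j _ hij =>
        (hind.indepFun hij).comp (φ := fun z => z ^ 2) (ψ := fun z => z ^ 2)
          (by fun_prop) (by fun_prop))
    have e3 : (∑ i, fun ω => Z i ω ^ 2) = fun ω => ∑ i, Z i ω ^ 2 := by ext ω; simp
    rw [e3] at h5
    rw [h5]
    simp [hvar]
  rwa [e1, e2] at h

end

/-! ### Gaussian vectors and the Ornstein-Uhlenbeck process -/

section
variable {Ω : Type*} [MeasurableSpace Ω] {P : Measure Ω}

theorem iIndepFun_mulVec_of_mul_mul_transpose_eq_one [IsProbabilityMeasure P] {ι : Type*}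
    [Fintype ι] [DecidableEq ι] {V : ι → Ω → ℝ} (hV : HasGaussianLaw (fun ω => (V · ω)) P)
    (hmean : ∀ i, ∫ ω, V i ω ∂P = 0) {C M : Matrix ι ι ℝ} (hcov : ∀ i j, cov[V i, V j; P] = C i j)
    (hM : M * C * Mᵀ = 1) :
    iIndepFun (fun i ω => (M *ᵥ fun j => V j ω) i) P ∧
      ∀ i, P.map (fun ω => (M *ᵥ fun j => V j ω) i) = gaussianReal 0 1 := by
  have hZ : HasGaussianLaw (fun ω => fun i => (M *ᵥ fun j => V j ω) i) P :=
    hV.map_fun (LinearMap.toContinuousLinearMap M.mulVecLin)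
  have hL : ∀ i, MemLp (V i) 2 P := fun i => (hV.eval i).memLp_two
  have hc : ∀ i j, cov[fun ω => (M *ᵥ fun j => V j ω) i, fun ω => (M *ᵥ fun j => V j ω) j; P]
      = (1 : Matrix ι ι ℝ) i j := by
    intro i j
    simp only [Matrix.mulVec, dotProduct]
    rw [covariance_fun_sum_fun_sum (fun k => (hL k).const_mul _) (fun k => (hL k).const_mul _),
      ← hM]
    simp only [covariance_const_mul_left, covariance_const_mul_right, hcov, Matrix.mul_apply,
      Matrix.transpose_apply, Finset.sum_mul]
    rw [Finset.sum_comm]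
    refine Finset.sum_congr rfl fun k _ => Finset.sum_congr rfl fun l _ => ?_
    ring
  refine ⟨hZ.iIndepFun_of_covariance_eq_zero fun i j hij => ?_, fun i => ?_⟩
  · rw [hc, Matrix.one_apply_ne hij]
  · rw [(hZ.eval i).map_eq_gaussianReal, ← covariance_self (hZ.eval i).aemeasurable, hc,
      Matrix.one_apply_eq, Real.toNNReal_one]
    congr 1
    simp only [Matrix.mulVec, dotProduct]
    rw [integral_finsetSum _ fun k _ => ((hL k).integrable (by norm_num)).const_mul _]
    simp [integral_const_mul, hmean]

theorem sum_mulVec_sq_of_mul_mul_transpose_eq_one {ι : Type*} [Fintype ι] [DecidableEq ι]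
    {C M : Matrix ι ι ℝ} (hM : M * C * Mᵀ = 1) (v : ι → ℝ) :
    ∑ i, (M *ᵥ v) i ^ 2 = v ⬝ᵥ (C⁻¹ *ᵥ v) := by
  have h1 : C * (Mᵀ * M) = 1 := by
    rw [← Matrix.mul_assoc, mul_eq_one_comm, ← Matrix.mul_assoc, hM]
  rw [Matrix.inv_eq_right_inv h1, ← Matrix.mulVec_mulVec, Matrix.dotProduct_mulVec,
    Matrix.vecMul_transpose]
  simp [dotProduct, sq]

variable {X : ℝ → Ω → ℝ} {σ2 α : ℝ}

theorem IsOUProcess.hasGaussianLaw (hX : IsOUProcess X P σ2 α) {ι : Type*} [Finite ι] {t : ι → ℝ}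
    (ht : ∀ i, t i ∈ Icc (0 : ℝ) 1) : HasGaussianLaw (fun ω => fun i => X (t i) ω) P := by
  have := Fintype.ofFinite ι
  have h := (hX.gaussian.comp_right fun i => (⟨t i, ht i⟩ : Icc (0 : ℝ) 1)).hasGaussianLaw
    Finset.univ
  let L : ({i // i ∈ (Finset.univ : Finset ι)} → ℝ) →L[ℝ] (ι → ℝ) :=
    { toFun := fun x i => x ⟨i, Finset.mem_univ i⟩
      map_add' := fun _ _ => rfl
      map_smul' := fun _ _ => rfl
      cont := by fun_prop }
  exact h.map_fun L

theorem grid_mem_Icc {i n : ℕ} (hi : i ≤ n) : (i : ℝ) / n ∈ Icc (0 : ℝ) 1 :=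
  ⟨by positivity, div_le_one_of_le₀ (by exact_mod_cast hi) (by positivity)⟩

theorem one_sub_exp_sq_pos (hα : 0 < α) (m : ℕ) :
    0 < 1 - Real.exp (-(α / ((m + 1 : ℕ) : ℝ))) ^ 2 := by
  rw [← Real.exp_nat_mul, sub_pos, Real.exp_lt_one_iff]
  have : 0 < α / ((m + 1 : ℕ) : ℝ) := by positivity
  push_cast at this ⊢
  linarith

/-- The quadratic form of the data, at the true parameter, is a sum of squares of independent
standard normal variables. -/
theorem IsOUProcess.exists_quadForm_eq_sum_sq [IsProbabilityMeasure P]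
    (hX : IsOUProcess X P σ2 α) (hσ : 0 < σ2) (hα : 0 < α) (m : ℕ) :
    ∃ Z : Fin (m + 1) → Ω → ℝ, iIndepFun Z P ∧ (∀ i, P.map (Z i) = gaussianReal 0 1) ∧
      ∀ ω, quadForm (m + 1) (obs X (m + 1) ω) α = σ2 * ∑ i, Z i ω ^ 2 := by
  set ρ := Real.exp (-(α / ((m + 1 : ℕ) : ℝ))) with hρ
  have hρ1 : 0 < 1 - ρ ^ 2 := one_sub_exp_sq_pos hα m
  have hd : ∀ i, 0 < innovVar m ρ i := by
    intro i
    unfold innovVar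
    split_ifs
    · exact one_pos
    · exact hρ1
  set R := corrMatrix (m + 1) α with hR
  set D := Matrix.diagonal fun i => (√(σ2 * innovVar m ρ i))⁻¹ with hD
  set M := D * innovMatrix m ρ with hMdef
  have hM : M * (σ2 • R) * Mᵀ = 1 := by
    have h1 : M * (σ2 • R) * Mᵀ = σ2 • (D * (innovMatrix m ρ * R * (innovMatrix m ρ)ᵀ) * D) := by
      rw [hMdef, Matrix.transpose_mul, hD, Matrix.diagonal_transpose, Matrix.mul_smul,
        Matrix.smul_mul]
      simp only [Matrix.mul_assoc]
    rw [h1, innovMatrix_mul_corrMatrix m α hρ, hD, Matrix.diagonal_mul_diagonal,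
      Matrix.diagonal_mul_diagonal, ← Matrix.diagonal_smul, ← Matrix.diagonal_one]
    congr 1
    ext i
    have h2 : 0 < σ2 * innovVar m ρ i := mul_pos hσ (hd i)
    have h3 := Real.sq_sqrt h2.le
    have h4 : √(σ2 * innovVar m ρ i) ≠ 0 := (Real.sqrt_pos.2 h2).ne'
    simp only [Pi.smul_apply, smul_eq_mul]
    field_simp
    rw [h3]
  have ht : ∀ i : Fin (m + 1), ((i + 1 : ℕ) : ℝ) / ((m + 1 : ℕ) : ℝ) ∈ Icc (0 : ℝ) 1 :=
    fun i => grid_mem_Icc (by omega)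
  obtain ⟨h1, h2⟩ := iIndepFun_mulVec_of_mul_mul_transpose_eq_one (hX.hasGaussianLaw ht)
    (fun i => hX.mean_zero _ (ht i)) (C := σ2 • R) (M := M) (fun i j => by
      rw [hX.covariance _ (ht i) _ (ht j)]
      simp [hR, corrMatrix]) hM
  refine ⟨_, h1, h2, fun ω => ?_⟩
  have h3 := sum_mulVec_sq_of_mul_mul_transpose_eq_one hM
    fun j : Fin (m + 1) => X (((j + 1 : ℕ) : ℝ) / ((m + 1 : ℕ) : ℝ)) ω
  have hdet : IsUnit R.det := by
    rw [hR, det_corrMatrix m α hρ]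
    exact (pow_pos hρ1 m).ne'.isUnit
  have := invertibleOfNonzero hσ.ne'
  rw [h3, Matrix.inv_smul R σ2 hdet, Matrix.smul_mulVec, dotProduct_smul, invOf_eq_inv, smul_eq_mul,
    mul_inv_cancel_left₀ hσ.ne']
  rfl

theorem IsOUProcess.map_eq_gaussianReal (hX : IsOUProcess X P σ2 α) {t : ℝ}
    (ht : t ∈ Icc (0 : ℝ) 1) : P.map (X t) = gaussianReal 0 σ2.toNNReal := by
  have h := hX.gaussian.hasGaussianLaw_eval ⟨t, ht⟩
  have h2 := h.map_eq_gaussianReal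
  rw [← covariance_self h.aemeasurable] at h2
  simpa [hX.covariance t ht t ht, hX.mean_zero t ht] using h2

theorem IsOUProcess.map_sub_eq_gaussianReal (hX : IsOUProcess X P σ2 α) {s t : ℝ}
    (hs : s ∈ Icc (0 : ℝ) 1) (ht : t ∈ Icc (0 : ℝ) 1) :
    P.map (X s - X t)
      = gaussianReal 0 (2 * σ2 * (1 - Real.exp (-α * |s - t|))).toNNReal := by
  have := hX.gaussian.isProbabilityMeasure
  have h : HasGaussianLaw (X s - X t) P :=
    hX.gaussian.hasGaussianLaw_sub (s := ⟨s, hs⟩) (t := ⟨t, ht⟩)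
  have h1 : HasGaussianLaw (X s) P := hX.gaussian.hasGaussianLaw_eval ⟨s, hs⟩
  have h2 : HasGaussianLaw (X t) P := hX.gaussian.hasGaussianLaw_eval ⟨t, ht⟩
  rw [h.map_eq_gaussianReal, variance_sub h1.memLp_two h2.memLp_two,
    ← covariance_self h1.aemeasurable, ← covariance_self h2.aemeasurable,
    hX.covariance s hs s hs, hX.covariance s hs t ht, hX.covariance t ht t ht]
  congr 1
  · simp only [Pi.sub_apply]
    rw [integral_sub h1.integrable h2.integrable, hX.mean_zero s hs, hX.mean_zero t ht, sub_zero]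
  · congr 1
    simp
    ring

theorem IsOUProcess.ae_ne_zero (hX : IsOUProcess X P σ2 α) (hσ : 0 < σ2) {t : ℝ}
    (ht : t ∈ Icc (0 : ℝ) 1) : ∀ᵐ ω ∂P, X t ω ≠ 0 := by
  have hm : AEMeasurable (X t) P := (hX.gaussian.hasGaussianLaw_eval ⟨t, ht⟩).aemeasurable
  have := nullSingletonClass_gaussianReal (μ := 0) (v := σ2.toNNReal)
    (Real.toNNReal_pos.2 hσ).ne'
  refine ae_of_ae_map (p := fun z => z ≠ 0) hm ?_
  rw [hX.map_eq_gaussianReal ht]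
  exact ae_iff.2 (by simp)

theorem IsOUProcess.ae_sub_ne_zero (hX : IsOUProcess X P σ2 α) (hσ : 0 < σ2) (hα : 0 < α)
    {s t : ℝ} (hs : s ∈ Icc (0 : ℝ) 1) (ht : t ∈ Icc (0 : ℝ) 1) (hst : s ≠ t) :
    ∀ᵐ ω ∂P, X s ω - X t ω ≠ 0 := by
  have hm : AEMeasurable (X s - X t) P :=
    (hX.gaussian.hasGaussianLaw_sub (s := ⟨s, hs⟩) (t := ⟨t, ht⟩)).aemeasurable
  have hv : 0 < 2 * σ2 * (1 - Real.exp (-α * |s - t|)) := by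
    have h1 : 0 < |s - t| := abs_pos.2 (sub_ne_zero.2 hst)
    have h2 : Real.exp (-α * |s - t|) < 1 := Real.exp_lt_one_iff.2 (by nlinarith)
    have : 0 < 1 - Real.exp (-α * |s - t|) := by linarith
    positivity
  have := nullSingletonClass_gaussianReal (μ := 0) (Real.toNNReal_pos.2 hv).ne'
  refine ae_of_ae_map (p := fun z => z ≠ 0) hm ?_
  rw [hX.map_sub_eq_gaussianReal hs ht]
  exact ae_iff.2 (by simpa only [ne_eq, not_not] using! measure_singleton 0)

/-- A fourth-moment bound for the increments. -/
theorem IsOUProcess.exists_measure_le_abs_sub_le (hX : IsOUProcess X P σ2 α) (hσ : 0 < σ2)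
    (hα : 0 < α) :
    ∃ C : ℝ, 0 ≤ C ∧ ∀ s ∈ Icc (0 : ℝ) 1, ∀ t ∈ Icc (0 : ℝ) 1, ∀ a > 0,
      P {ω | a ≤ |X s ω - X t ω|} ≤ ENNReal.ofReal (C * (|s - t| ^ 2 / a ^ 4)) := by
  have := hX.gaussian.isProbabilityMeasure
  have hc : 0 ≤ ∫ z, z ^ 4 ∂gaussianReal 0 1 := integral_nonneg fun z => by positivity
  refine ⟨(∫ z, z ^ 4 ∂gaussianReal 0 1) * (2 * σ2 * α) ^ 2, by positivity,
    fun s hs t ht a ha => ?_⟩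
  have hm : AEMeasurable (X s - X t) P :=
    (hX.gaussian.hasGaussianLaw_sub (s := ⟨s, hs⟩) (t := ⟨t, ht⟩)).aemeasurable
  refine (measure_le_abs_of_map_eq_gaussianReal hm (hX.map_sub_eq_gaussianReal hs ht) ha).trans ?_
  apply ENNReal.ofReal_le_ofReal
  have h1 : 0 ≤ α * |s - t| := by positivity
  have h2 := one_sub_exp_neg_le (α * |s - t|)
  have h3 : 0 ≤ 1 - Real.exp (-(α * |s - t|)) := by
    have := Real.exp_le_one_iff.2 (neg_nonpos.2 h1); linarith
  rw [Real.coe_toNNReal _ (by rw [neg_mul]; positivity), neg_mul,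
    mul_assoc (∫ z, z ^ 4 ∂gaussianReal 0 1), ← mul_div_assoc ((2 * σ2 * α) ^ 2)]
  refine mul_le_mul_of_nonneg_left (div_le_div_of_nonneg_right ?_ (by positivity)) hc
  calc (2 * σ2 * (1 - Real.exp (-(α * |s - t|)))) ^ 2
      ≤ (2 * σ2 * (α * |s - t|)) ^ 2 := by gcongr
    _ = (2 * σ2 * α) ^ 2 * |s - t| ^ 2 := by ring

/-- With high probability, the microergodic parameter is estimated at the rate `√n`. -/
theorem IsOUProcess.measure_le_abs_thetaTilde_sub (hX : IsOUProcess X P σ2 α) (hσ : 0 < σ2)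
    (hα : 0 < α) {K : ℝ} (hK : 0 < K) {n : ℕ} (hn : 1 ≤ n) :
    P {ω | K ≤ |√(n : ℝ) * (thetaTilde n (obs X n ω) α - σ2 * α)|}
      ≤ ENNReal.ofReal (Var[fun z => z ^ 2; gaussianReal 0 1] * (σ2 * α) ^ 2 / K ^ 2) := by
  have := hX.gaussian.isProbabilityMeasure
  obtain ⟨m, rfl⟩ := Nat.exists_eq_add_of_le' hn
  obtain ⟨Z, hind, hlaw, hq⟩ := hX.exists_quadForm_eq_sum_sq hσ hα m
  set r := √((m + 1 : ℕ) : ℝ) with hr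
  have hm : (0 : ℝ) < ((m + 1 : ℕ) : ℝ) := by positivity
  have hr0 : 0 < r := Real.sqrt_pos.2 hm
  have hrr : r ^ 2 = ((m + 1 : ℕ) : ℝ) := Real.sq_sqrt hm.le
  have hθ : 0 < σ2 * α := by positivity
  have h := measure_le_abs_sum_sq_sub hind hlaw (c := K * r / (σ2 * α)) (by positivity)
  rw [Fintype.card_fin] at h
  refine (measure_mono fun ω hω => ?_).trans (h.trans (le_of_eq ?_))
  · simp only [mem_ofPred_eq] at hω ⊢
    have e : r * (thetaTilde (m + 1) (obs X (m + 1) ω) α - σ2 * α)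
        = (σ2 * α) / r * (∑ i, Z i ω ^ 2 - ((m + 1 : ℕ) : ℝ)) := by
      rw [thetaTilde, hq, ← hrr]
      field_simp
    rw [e, abs_mul, abs_of_pos (by positivity : 0 < σ2 * α / r)] at hω
    rw [div_le_iff₀ hθ]
    calc K * r ≤ (σ2 * α / r * |∑ i, Z i ω ^ 2 - ((m + 1 : ℕ) : ℝ)|) * r := by gcongr
      _ = _ := by field_simp
  · congr 1
    rw [← hrr]
    field_simp

/-- Almost surely, the quadratic form is eventually of the order of the sample size. -/
theorem IsOUProcess.ae_eventually_quadForm_mem (hX : IsOUProcess X P σ2 α) (hσ : 0 < σ2)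
    (hα : 0 < α) :
    ∀ᵐ ω ∂P, ∀ᶠ n : ℕ in atTop, σ2 * (n / 9) ≤ quadForm n (obs X n ω) α ∧
      quadForm n (obs X n ω) α ≤ σ2 * (4 * n) := by
  have := hX.gaussian.isProbabilityMeasure
  set a := Real.exp (-1) * √2 with ha
  set b := Real.exp (4 / 9) / 3 with hb
  have ha0 : 0 ≤ a := by positivity
  have hb0 : 0 ≤ b := by positivity
  have ha1 : a < 1 := by
    have h1 : √2 < 1 + 1 := by rw [Real.sqrt_lt' (by norm_num)]; norm_num
    have h2 := Real.add_one_le_exp (1 : ℝ)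
    rw [ha, Real.exp_neg, inv_mul_lt_iff₀ (Real.exp_pos _)]
    linarith
  have hb1 : b < 1 := by
    have h1 : Real.exp (4 / 9) ≤ Real.exp 1 := Real.exp_le_exp.2 (by norm_num)
    have h2 := Real.exp_one_lt_d9
    rw [hb, div_lt_one (by norm_num)]
    linarith
  have hsum : ∀ r : ℝ, 0 ≤ r → r < 1 → ∑' m : ℕ, ENNReal.ofReal (r ^ (m + 1)) ≠ ⊤ := by
    intro r h0 h1
    have hs : Summable fun m : ℕ => r ^ (m + 1) :=
      (summable_nat_add_iff 1).2 (summable_geometric_of_lt_one h0 h1)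
    rw [← ENNReal.ofReal_tsum_of_nonneg (fun m => by positivity) hs]
    exact ENNReal.ofReal_ne_top
  choose Z hind hlaw hq using hX.exists_quadForm_eq_sum_sq hσ hα
  have h1 := ae_eventually_notMem (μ := P)
    (s := fun m => {ω | 4 * (Fintype.card (Fin (m + 1)) : ℝ) ≤ ∑ i, Z m i ω ^ 2})
    (ne_top_of_le_ne_top (hsum a ha0 ha1) (ENNReal.tsum_le_tsum fun m => by
      simpa only [Fintype.card_fin] using measure_le_sum_sq (hind m) (hlaw m)))
  have h2 := ae_eventually_notMem (μ := P)
    (s := fun m => {ω | ∑ i, Z m i ω ^ 2 ≤ (Fintype.card (Fin (m + 1)) : ℝ) / 9})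
    (ne_top_of_le_ne_top (hsum b hb0 hb1) (ENNReal.tsum_le_tsum fun m => by
      simpa only [Fintype.card_fin] using measure_sum_sq_le (hind m) (hlaw m)))
  filter_upwards [h1, h2] with ω h1 h2
  rw [← map_add_atTop_eq_nat 1, eventually_map]
  filter_upwards [h1, h2] with m h1 h2
  simp only [not_le, Fintype.card_fin] at h1 h2
  rw [hq]
  exact ⟨mul_le_mul_of_nonneg_left h2.le hσ.le, mul_le_mul_of_nonneg_left h1.le hσ.le⟩

end

/-! ### Uniform bounds on the path by dyadic chaining -/

/-- The largest multiple of `2⁻ᵏ` that is at most `t`. -/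
noncomputable def dyadicFloor (k : ℕ) (t : ℝ) : ℝ := (⌊t * 2 ^ k⌋₊ : ℝ) / 2 ^ k

theorem floor_mul_two_pow_le {t : ℝ} (ht : t ≤ 1) (k : ℕ) : ⌊t * 2 ^ k⌋₊ ≤ 2 ^ k := by
  have h : t * 2 ^ k ≤ 2 ^ k := mul_le_of_le_one_left (by positivity) ht
  have := Nat.floor_le_floor h
  have h2 : ⌊(2 : ℝ) ^ k⌋₊ = 2 ^ k := by
    rw [show (2 : ℝ) ^ k = ((2 ^ k : ℕ) : ℝ) by push_cast; rfl, Nat.floor_natCast]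
  rwa [h2] at this

theorem dyadicFloor_mem_Icc {t : ℝ} (ht : t ≤ 1) (k : ℕ) : dyadicFloor k t ∈ Icc (0 : ℝ) 1 := by
  have := grid_mem_Icc (floor_mul_two_pow_le ht k)
  push_cast at this
  exact this

theorem abs_sub_dyadicFloor_le {t : ℝ} (ht : 0 ≤ t) (k : ℕ) :
    |t - dyadicFloor k t| ≤ 1 / 2 ^ k := by
  have h2 : (0 : ℝ) < 2 ^ k := by positivity
  have h1 := Nat.floor_le (show 0 ≤ t * 2 ^ k by positivity)
  have h3 := Nat.lt_floor_add_one (t * 2 ^ k)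
  have e : t - dyadicFloor k t = (t * 2 ^ k - ⌊t * 2 ^ k⌋₊) / 2 ^ k := by
    unfold dyadicFloor; field_simp
  rw [e, abs_div, abs_of_pos h2]
  refine div_le_div_of_nonneg_right ?_ h2.le
  rw [abs_le]
  constructor <;> linarith

theorem dist_dyadicFloor_succ_le {f : ℝ → ℝ} {r t : ℝ} (hr : 0 ≤ r) (ht : t ≤ 1) {k : ℕ}
    (hstep : ∀ j < 2 ^ k,
      |f ((2 * j + 1 : ℕ) / (2 ^ (k + 1) : ℕ)) - f ((2 * j : ℕ) / (2 ^ (k + 1) : ℕ))| ≤ r ^ k) :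
    dist (f (dyadicFloor k t)) (f (dyadicFloor (k + 1) t)) ≤ r ^ k := by
  set N := ⌊t * 2 ^ (k + 1)⌋₊ with hN
  have hj : ⌊t * 2 ^ k⌋₊ = N / 2 := by
    rw [hN, ← Nat.floor_div_ofNat]
    congr 1
    rw [pow_succ]
    ring
  have hNle : N ≤ 2 ^ (k + 1) := floor_mul_two_pow_le ht (k + 1)
  have e1 : dyadicFloor (k + 1) t = (N : ℝ) / (2 ^ (k + 1) : ℕ) := by
    unfold dyadicFloor; push_cast; rfl
  have e2 : dyadicFloor k t = ((2 * (N / 2) : ℕ) : ℝ) / (2 ^ (k + 1) : ℕ) := by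
    unfold dyadicFloor
    rw [hj, pow_succ]
    push_cast
    field_simp
  rw [e1, e2, dist_comm, Real.dist_eq]
  rcases Nat.mod_two_eq_zero_or_one N with h | h
  · rw [show 2 * (N / 2) = N by omega, sub_self, abs_zero]
    positivity
  · have h2 : N = 2 * (N / 2) + 1 := by omega
    have h3 := hstep (N / 2) (by rw [pow_succ] at hNle; omega)
    rwa [← h2] at h3

theorem abs_sub_apply_dyadicFloor_le {f : ℝ → ℝ} {r t : ℝ} (hr : 0 ≤ r) (hr1 : r < 1) (ht : t ≤ 1)
    {k₀ : ℕ} (hstep : ∀ k ≥ k₀, ∀ j < 2 ^ k,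
      |f ((2 * j + 1 : ℕ) / (2 ^ (k + 1) : ℕ)) - f ((2 * j : ℕ) / (2 ^ (k + 1) : ℕ))| ≤ r ^ k)
    (hlim : Tendsto (fun k => f (dyadicFloor k t)) atTop (𝓝 (f t))) {k : ℕ} (hk : k₀ ≤ k) :
    |f t - f (dyadicFloor k t)| ≤ r ^ k / (1 - r) := by
  have h1 : ∀ i, dist (f (dyadicFloor (k + i) t)) (f (dyadicFloor (k + (i + 1)) t))
      ≤ r ^ k * r ^ i := by
    intro i
    rw [← pow_add]
    exact dist_dyadicFloor_succ_le hr ht (hstep (k + i) (by omega))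
  have h2 : Tendsto (fun i => f (dyadicFloor (k + i) t)) atTop (𝓝 (f t)) := by
    simp_rw [add_comm k]
    exact (tendsto_add_atTop_iff_nat k).2 hlim
  have h3 := dist_le_of_le_geometric_of_tendsto₀ r (r ^ k) hr1 h1 h2
  rwa [dist_comm, Real.dist_eq, add_zero] at h3

section
variable {Ω : Type*} [MeasurableSpace Ω] {P : Measure Ω} {X : ℝ → Ω → ℝ} {σ2 α : ℝ}

theorem one_div_two_mul_pow_four_pow (r : ℝ) (k : ℕ) :
    (1 / (2 * r ^ 4)) ^ k = 1 / 2 ^ k / (r ^ k) ^ 4 := by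
  rw [one_div_pow, mul_pow, ← pow_mul, mul_comm 4 k, pow_mul, div_div]

theorem tsum_ofReal_const_mul_pow_ne_top {C q : ℝ} (hC : 0 ≤ C) (hq : 0 ≤ q) (hq1 : q < 1) :
    ∑' k : ℕ, ENNReal.ofReal (C * q ^ k) ≠ ⊤ := by
  rw [← ENNReal.ofReal_tsum_of_nonneg (fun k => by positivity)
    ((summable_geometric_of_lt_one hq hq1).mul_left C)]
  exact ENNReal.ofReal_ne_top

theorem IsOUProcess.ae_eventually_abs_sub_lt (hX : IsOUProcess X P σ2 α) (hσ : 0 < σ2)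
    (hα : 0 < α) :
    ∀ᵐ ω ∂P, ∀ᶠ k : ℕ in atTop, ∀ j < 2 ^ k,
      |X ((2 * j + 1 : ℕ) / (2 ^ (k + 1) : ℕ)) ω - X ((2 * j : ℕ) / (2 ^ (k + 1) : ℕ)) ω|
        < (9 / 10) ^ k := by
  obtain ⟨C, hC, hbd⟩ := hX.exists_measure_le_abs_sub_le hσ hα
  have h := ae_eventually_notMem (μ := P) (s := fun k => ⋃ j ∈ Finset.range (2 ^ k),
      {ω | (9 / 10) ^ k ≤ |X ((2 * j + 1 : ℕ) / (2 ^ (k + 1) : ℕ)) ω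
        - X ((2 * j : ℕ) / (2 ^ (k + 1) : ℕ)) ω|})
    (ne_top_of_le_ne_top (tsum_ofReal_const_mul_pow_ne_top (C := C) (q := 1 / (2 * (9 / 10) ^ 4)) hC
      (by norm_num) (by norm_num)) (ENNReal.tsum_le_tsum fun k => ?_))
  · filter_upwards [h] with ω hω
    filter_upwards [hω] with k hk j hj
    simp only [Finset.mem_range, mem_iUnion, mem_ofPred_eq, not_exists, not_le] at hk
    exact hk j hj
  · refine (measure_biUnion_finset_le _ _).trans ?_
    have hj : ∀ j ∈ Finset.range (2 ^ k), P {ω | (9 / 10) ^ k ≤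
        |X ((2 * j + 1 : ℕ) / (2 ^ (k + 1) : ℕ)) ω - X ((2 * j : ℕ) / (2 ^ (k + 1) : ℕ)) ω|}
        ≤ ENNReal.ofReal (C * ((1 / 2 ^ (k + 1)) ^ 2 / ((9 / 10) ^ k) ^ 4)) := by
      intro j hj
      rw [Finset.mem_range] at hj
      have h1 := hbd ((2 * j + 1 : ℕ) / (2 ^ (k + 1) : ℕ)) (grid_mem_Icc (by rw [pow_succ]; omega))
        ((2 * j : ℕ) / (2 ^ (k + 1) : ℕ)) (grid_mem_Icc (by rw [pow_succ]; omega))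
        ((9 / 10) ^ k) (by positivity)
      have e : |((2 * j + 1 : ℕ) : ℝ) / (2 ^ (k + 1) : ℕ) - ((2 * j : ℕ) : ℝ) / (2 ^ (k + 1) : ℕ)|
          = 1 / 2 ^ (k + 1) := by
        rw [← sub_div]
        push_cast
        rw [add_sub_cancel_left, abs_of_pos (by positivity)]
      rwa [e] at h1
    refine (Finset.sum_le_sum hj).trans ?_
    rw [Finset.sum_const, Finset.card_range, nsmul_eq_mul, ← ENNReal.ofReal_natCast,
      ← ENNReal.ofReal_mul (by positivity)]
    apply ENNReal.ofReal_le_ofReal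
    have e2 : ((2 ^ k : ℕ) : ℝ) * (C * ((1 / 2 ^ (k + 1)) ^ 2 / ((9 / 10) ^ k) ^ 4))
        = C * (1 / (2 * (9 / 10) ^ 4)) ^ k * (1 / 4) := by
      have h2 : (2 : ℝ) ^ k ≠ 0 := by positivity
      push_cast
      rw [one_div_two_mul_pow_four_pow, pow_succ (2 : ℝ) k]
      field_simp
      ring
    rw [e2]
    exact mul_le_of_le_one_right (by positivity) (by norm_num)

theorem IsOUProcess.ae_tendsto_dyadicFloor (hX : IsOUProcess X P σ2 α) (hσ : 0 < σ2)
    (hα : 0 < α) {t : ℝ} (ht : t ∈ Icc (0 : ℝ) 1) :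
    ∀ᵐ ω ∂P, Tendsto (fun k => X (dyadicFloor k t) ω) atTop (𝓝 (X t ω)) := by
  obtain ⟨C, hC, hbd⟩ := hX.exists_measure_le_abs_sub_le hσ hα
  have h := ae_eventually_notMem (μ := P)
    (s := fun k => {ω | (9 / 10) ^ k ≤ |X (dyadicFloor k t) ω - X t ω|})
    (ne_top_of_le_ne_top (tsum_ofReal_const_mul_pow_ne_top (C := C) (q := 1 / (2 * (9 / 10) ^ 4)) hC
      (by norm_num) (by norm_num)) (ENNReal.tsum_le_tsum fun k => ?_))
  · filter_upwards [h] with ω hω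
    rw [tendsto_iff_dist_tendsto_zero]
    refine squeeze_zero' (Eventually.of_forall fun _ => dist_nonneg) ?_
      (tendsto_pow_atTop_nhds_zero_of_lt_one (r := (9 / 10 : ℝ)) (by norm_num) (by norm_num))
    filter_upwards [hω] with k hk
    simp only [not_le] at hk
    exact hk.le
  · refine (hbd _ (dyadicFloor_mem_Icc ht.2 k) _ ht _ (by positivity)).trans ?_
    apply ENNReal.ofReal_le_ofReal
    refine mul_le_mul_of_nonneg_left ?_ hC
    calc |dyadicFloor k t - t| ^ 2 / ((9 / 10) ^ k) ^ 4
        ≤ (1 / 2 ^ k) ^ 2 / ((9 / 10) ^ k) ^ 4 := by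
          rw [abs_sub_comm]
          gcongr
          exact abs_sub_dyadicFloor_le ht.1 k
      _ ≤ (1 / 2 ^ k) ^ 1 / ((9 / 10) ^ k) ^ 4 := by
          refine div_le_div_of_nonneg_right ?_ (by positivity)
          refine pow_le_pow_of_le_one (by positivity) ?_ (by norm_num)
          exact div_le_one_of_le₀ (one_le_pow₀ (by norm_num)) (by positivity)
      _ = (1 / (2 * (9 / 10) ^ 4)) ^ k := by
          rw [one_div_two_mul_pow_four_pow, pow_one]

/-- Almost surely, the observations are uniformly bounded, and those near time zero are bounded
away from zero. -/
theorem IsOUProcess.ae_exists_bounds (hX : IsOUProcess X P σ2 α) (hσ : 0 < σ2) (hα : 0 < α) :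
    ∀ᵐ ω ∂P, ∃ M c : ℝ, ∃ k : ℕ, 0 < c ∧ (∀ n i : ℕ, i ≤ n → |obs X n ω i| ≤ M) ∧
      ∀ n i : ℕ, i * 2 ^ k < n → c ≤ |obs X n ω i| := by
  have hlim : ∀ᵐ ω ∂P, ∀ n i : ℕ, i ≤ n →
      Tendsto (fun k => X (dyadicFloor k ((i : ℝ) / n)) ω) atTop (𝓝 (X ((i : ℝ) / n) ω)) := by
    simp only [ae_all_iff]
    exact fun n i hi => hX.ae_tendsto_dyadicFloor hσ hα (grid_mem_Icc hi)
  filter_upwards [hX.ae_eventually_abs_sub_lt hσ hα, hlim,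
    hX.ae_ne_zero hσ (t := 0) ⟨le_rfl, zero_le_one⟩] with ω hstep hlim h0
  obtain ⟨k₀, hk₀⟩ := eventually_atTop.1 hstep
  have hmain : ∀ k ≥ k₀, ∀ n i : ℕ, i ≤ n →
      |obs X n ω i - X (dyadicFloor k ((i : ℝ) / n)) ω| ≤ (9 / 10) ^ k / (1 - 9 / 10) :=
    fun k hk n i hi => abs_sub_apply_dyadicFloor_le (f := fun t => X t ω) (by norm_num)
      (by norm_num) (grid_mem_Icc hi).2 (fun k hk j hj => (hk₀ k hk j hj).le) (hlim n i hi) hk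
  have hc : 0 < |X 0 ω| / 2 := by have := abs_pos.2 h0; positivity
  have hpow : Tendsto (fun k : ℕ => (9 / 10 : ℝ) ^ k / (1 - 9 / 10)) atTop (𝓝 0) := by
    simpa using (tendsto_pow_atTop_nhds_zero_of_lt_one (r := (9 / 10 : ℝ)) (by norm_num)
      (by norm_num)).div_const (1 - 9 / 10)
  obtain ⟨k, hk1, hk2⟩ := ((hpow.eventually_le_const hc).and (eventually_ge_atTop k₀)).exists
  refine ⟨∑ j ∈ Finset.range (2 ^ k + 1), |X ((j : ℝ) / 2 ^ k) ω| + |X 0 ω| / 2, |X 0 ω| / 2, k, hc,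
    fun n i hi => ?_, fun n i hi => ?_⟩
  · have h1 := (hmain k hk2 n i hi).trans hk1
    have h2 : |X (dyadicFloor k ((i : ℝ) / n)) ω|
        ≤ ∑ j ∈ Finset.range (2 ^ k + 1), |X ((j : ℝ) / 2 ^ k) ω| :=
      Finset.single_le_sum (f := fun j : ℕ => |X ((j : ℝ) / 2 ^ k) ω|) (fun j _ => abs_nonneg _)
        (Finset.mem_range.2 (Nat.lt_succ_of_le (floor_mul_two_pow_le (grid_mem_Icc hi).2 k)))
    have h3 := abs_sub_abs_le_abs_sub (obs X n ω i) (X (dyadicFloor k ((i : ℝ) / n)) ω)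
    linarith
  · have hin : i ≤ n := by
      have : i * 1 ≤ i * 2 ^ k := Nat.mul_le_mul_left i Nat.one_le_two_pow
      omega
    have h1 := (hmain k hk2 n i hin).trans hk1
    have hn : (0 : ℝ) < n := by exact_mod_cast (Nat.zero_le _).trans_lt hi
    have h2 : dyadicFloor k ((i : ℝ) / n) = 0 := by
      unfold dyadicFloor
      have h4 : (i : ℝ) / n * 2 ^ k < 1 := by
        rw [div_mul_eq_mul_div, div_lt_one hn]
        exact_mod_cast hi
      rw [Nat.floor_eq_zero.2 h4]
      simp
    rw [h2] at h1
    have h3 := abs_sub_abs_le_abs_sub (X 0 ω) (obs X n ω i)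
    rw [abs_sub_comm] at h3
    linarith

end

/-! ### The data of an Ornstein-Uhlenbeck process are typically good -/

theorem BoundedStats.mono {K L : ℝ} {n : ℕ} {x : ℕ → ℝ} (h : BoundedStats K n x) (hK : 1 ≤ K)
    (hKL : K ≤ L) : BoundedStats L n x where
  quadVar_ge := (one_div_le_one_div_of_le (by linarith) hKL).trans h.quadVar_ge
  quadVar_le := h.quadVar_le.trans hKL
  A₁_ge := (div_le_div_of_nonneg_left (by positivity) (by linarith) hKL).trans h.A₁_ge
  A₁_le := h.A₁_le.trans (by gcongr)
  bdrySq_le := h.bdrySq_le.trans hKL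

theorem A₁_nonneg (n : ℕ) (x : ℕ → ℝ) : 0 ≤ A₁ n x := Finset.sum_nonneg fun _ _ => sq_nonneg _

theorem A₁_le_of_abs_le {n : ℕ} {x : ℕ → ℝ} {M : ℝ} (hM : ∀ i ≤ n, |x i| ≤ M) :
    A₁ n x ≤ M ^ 2 * n := by
  unfold A₁
  calc ∑ i ∈ Finset.Icc 2 (n - 1), x i ^ 2 ≤ ∑ i ∈ Finset.Icc 2 (n - 1), M ^ 2 :=
        Finset.sum_le_sum fun i hi => sq_le_sq'
          (abs_le.1 (hM i (by rw [Finset.mem_Icc] at hi; omega))).1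
          (abs_le.1 (hM i (by rw [Finset.mem_Icc] at hi; omega))).2
    _ = M ^ 2 * ((n - 1 + 1 - 2 : ℕ) : ℝ) := by
        rw [Finset.sum_const, Nat.card_Icc, nsmul_eq_mul, mul_comm]
    _ ≤ M ^ 2 * n := by
        gcongr
        omega

theorem le_A₁_of_le_abs {n k : ℕ} {x : ℕ → ℝ} {c : ℝ} (hc : 0 ≤ c) (hn : 2 + 4 * 2 ^ k ≤ n)
    (hx : ∀ i : ℕ, i * 2 ^ k < n → c ≤ |x i|) : c ^ 2 / 2 ^ (k + 1) * n ≤ A₁ n x := by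
  have h2 : 0 < 2 ^ k := by positivity
  set q := (n - 1) / 2 ^ k with hq
  have hq1 : q * 2 ^ k ≤ n - 1 := Nat.div_mul_le_self _ _
  have hq2 : n - 1 < (q + 1) * 2 ^ k := by
    have := Nat.lt_div_mul_add (a := n - 1) h2
    rw [add_mul, one_mul]; exact this
  have hqn : q ≤ n - 1 := Nat.div_le_self _ _
  have hq3 : 2 ≤ q := by
    by_contra hcon
    have : (q + 1) * 2 ^ k ≤ 2 * 2 ^ k := Nat.mul_le_mul_right _ (by omega)
    omega
  have h3 : c ^ 2 * ((q : ℝ) - 1) ≤ A₁ n x := by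
    calc c ^ 2 * ((q : ℝ) - 1) = ∑ i ∈ Finset.Icc 2 q, c ^ 2 := by
          rw [Finset.sum_const, Nat.card_Icc, nsmul_eq_mul, Nat.cast_sub (by omega)]
          push_cast
          ring
      _ ≤ ∑ i ∈ Finset.Icc 2 q, x i ^ 2 := by
          refine Finset.sum_le_sum fun i hi => ?_
          rw [Finset.mem_Icc] at hi
          rw [← sq_abs (x i)]
          have h4 : i * 2 ^ k ≤ q * 2 ^ k := Nat.mul_le_mul_right _ hi.2
          have := hx i (by omega)
          gcongr
      _ ≤ A₁ n x := Finset.sum_le_sum_of_subset_of_nonneg (Finset.Icc_subset_Icc_right hqn)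
          fun i _ _ => sq_nonneg _
  refine le_trans ?_ h3
  rw [div_mul_eq_mul_div, mul_div_assoc]
  refine mul_le_mul_of_nonneg_left ?_ (sq_nonneg c)
  have h5 : (n : ℝ) ≤ (q + 1) * 2 ^ k := by
    have : n ≤ (q + 1) * 2 ^ k := by omega
    exact_mod_cast this
  have h6 : (2 : ℝ) + 4 * 2 ^ k ≤ n := by exact_mod_cast hn
  have h7 : (0 : ℝ) < 2 ^ k := by positivity
  rw [div_le_iff₀ (by positivity), pow_succ]
  nlinarith

theorem bdrySq_le_of_abs_le {n : ℕ} (hn : 2 ≤ n) {x : ℕ → ℝ} {M : ℝ} (hM : ∀ i ≤ n, |x i| ≤ M) :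
    bdrySq n x ≤ 2 * M ^ 2 := by
  obtain ⟨m, rfl⟩ := Nat.exists_eq_add_of_le' (show 1 ≤ n by omega)
  rw [bdrySq_eq m (by omega)]
  have h1 := sq_le_sq' (abs_le.1 (hM 1 (by omega))).1 (abs_le.1 (hM 1 (by omega))).2
  have h2 := sq_le_sq' (abs_le.1 (hM (m + 1) le_rfl)).1 (abs_le.1 (hM (m + 1) le_rfl)).2
  linarith

theorem quadVar_nonneg {n : ℕ} (hn : 2 ≤ n) (x : ℕ → ℝ) : 0 ≤ quadVar n x := by
  obtain ⟨m, rfl⟩ := Nat.exists_eq_add_of_le' (show 1 ≤ n by omega)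
  rw [quadVar_eq_sum m (by omega)]
  exact Finset.sum_nonneg fun _ _ => sq_nonneg _

theorem quadForm_mul_eq {n : ℕ} (hn : 2 ≤ n) (x : ℕ → ℝ) {α : ℝ} (hα : 0 < α) :
    quadForm n x α * (1 - Real.exp (-(α / n)) ^ 2)
      = Real.exp (-(α / n)) * quadVar n x + (1 - Real.exp (-(α / n))) * bdrySq n x
        + (1 - Real.exp (-(α / n))) ^ 2 * A₁ n x := by
  obtain ⟨m, rfl⟩ := Nat.exists_eq_add_of_le' (show 1 ≤ n by omega)
  have h1 := (one_sub_exp_sq_pos hα m).ne'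
  have h2 := sum_innov_sq m (by omega) x (Real.exp (-(α / ((m + 1 : ℕ) : ℝ))))
  rw [quadForm_eq_sum m x α rfl h1, add_mul, div_mul_cancel₀ _ h1, mul_comm (x 1 ^ 2), h2]
  unfold quadVar bdrySq
  ring

theorem quadVar_mem_of_quadForm_mem {n : ℕ} (hn : 2 ≤ n) {x : ℕ → ℝ} {σ2 α M : ℝ} (hσ : 0 < σ2)
    (hα : 0 < α) (hM : ∀ i ≤ n, |x i| ≤ M) (hαn : 2 * α ≤ n)
    (hn2 : 36 * (2 * α * M ^ 2 + α ^ 2 * M ^ 2) ≤ σ2 * α * n)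
    (hq1 : σ2 * (n / 9) ≤ quadForm n x α) (hq2 : quadForm n x α ≤ σ2 * (4 * n)) :
    σ2 * α / 36 ≤ quadVar n x ∧ quadVar n x ≤ 16 * (σ2 * α) := by
  have hn0 : (0 : ℝ) < n := by exact_mod_cast (by omega : 0 < n)
  have hW := quadForm_mul_eq hn x hα
  set ρ := Real.exp (-(α / n)) with hρ
  have hS := quadVar_nonneg hn x
  have hB := bdrySq_nonneg hn x
  have hB2 := bdrySq_le_of_abs_le hn hM
  have hA := A₁_nonneg n x
  have hA2 := A₁_le_of_abs_le hM
  set y := α / n with hy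
  have hy0 : 0 < y := by positivity
  have hny : n * y = α := by rw [hy]; field_simp
  have hy1 : y ≤ 1 / 2 := by rw [hy, div_le_iff₀ hn0]; linarith
  have hδ1 : 1 - ρ ≤ y := one_sub_exp_neg_le y
  have hδ2 := sub_sq_div_le_one_sub_exp_neg hy0.le
  rw [← hρ] at hδ2
  have hδ3 : y / 2 ≤ 1 - ρ := by nlinarith
  have hρ0 : 0 < ρ := Real.exp_pos _
  have hρ2 : 1 / 2 ≤ ρ := by linarith
  have hδ0 : 0 ≤ 1 - ρ := by linarith
  have hfac : 1 - ρ ^ 2 = (1 - ρ) * (1 + ρ) := by ring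
  have hW2 : quadForm n x α * (1 - ρ ^ 2) ≤ 8 * (σ2 * α) := by
    calc quadForm n x α * (1 - ρ ^ 2) ≤ σ2 * (4 * n) * (y * 2) := by
          rw [hfac]
          gcongr
          linarith
      _ = 8 * (σ2 * (n * y)) := by ring
      _ = _ := by rw [hny]
  have hW1 : σ2 * α / 18 ≤ quadForm n x α * (1 - ρ ^ 2) := by
    calc σ2 * α / 18 = σ2 * (n / 9) * (y / 2 * 1) := by rw [← hny]; ring
      _ ≤ quadForm n x α * (1 - ρ ^ 2) := by
          rw [hfac]
          have : (0:ℝ) ≤ quadForm n x α := le_trans (by positivity) hq1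
          gcongr
          linarith
  constructor
  · have h1 : (1 - ρ) * bdrySq n x ≤ y * (2 * M ^ 2) := by gcongr
    have h2 : (1 - ρ) ^ 2 * A₁ n x ≤ y ^ 2 * (M ^ 2 * n) := by gcongr
    have h3 : ρ * quadVar n x ≤ quadVar n x := mul_le_of_le_one_left hS (by linarith)
    have h4 : y * (2 * M ^ 2) + y ^ 2 * (M ^ 2 * n) ≤ σ2 * α / 36 := by
      have e : y * (2 * M ^ 2) + y ^ 2 * (M ^ 2 * n)
          = (2 * α * M ^ 2 + α ^ 2 * M ^ 2) / n := by
        rw [hy]; field_simp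
      rw [e, div_le_iff₀ hn0]
      linarith
    linarith
  · have h1 : 0 ≤ (1 - ρ) * bdrySq n x := by positivity
    have h2 : 0 ≤ (1 - ρ) ^ 2 * A₁ n x := by positivity
    nlinarith

theorem exists_forall_boundedStats {x : ℕ → ℕ → ℝ} {σ2 α M c : ℝ} {k : ℕ} (hσ : 0 < σ2)
    (hα : 0 < α) (hc : 0 < c) (hM : ∀ n i : ℕ, i ≤ n → |x n i| ≤ M)
    (hx : ∀ n i : ℕ, i * 2 ^ k < n → c ≤ |x n i|)
    (hq : ∀ᶠ n : ℕ in atTop, σ2 * (n / 9) ≤ quadForm n (x n) α ∧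
      quadForm n (x n) α ≤ σ2 * (4 * n)) :
    ∃ K : ℕ, 1 ≤ K ∧ ∀ n ≥ K, BoundedStats K n (x n) := by
  have hθ : 0 < σ2 * α := by positivity
  have e1 : ∀ᶠ n : ℕ in atTop, 2 * α ≤ (n : ℝ) := tendsto_natCast_atTop_atTop.eventually_ge_atTop _
  have e2 : ∀ᶠ n : ℕ in atTop, 36 * (2 * α * M ^ 2 + α ^ 2 * M ^ 2) ≤ σ2 * α * (n : ℝ) :=
    (tendsto_natCast_atTop_atTop.const_mul_atTop hθ).eventually_ge_atTop _
  obtain ⟨N, hN⟩ := eventually_atTop.1 (hq.and (e1.and (e2.and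
    (eventually_ge_atTop (2 + 4 * 2 ^ k)))))
  obtain ⟨K, hK⟩ := eventually_atTop.1 ((eventually_ge_atTop N).and
    ((eventually_ge_atTop 1).and ((tendsto_natCast_atTop_atTop (R := ℝ)).eventually_ge_atTop
      (36 / (σ2 * α) + 16 * (σ2 * α) + 2 ^ (k + 1) / c ^ 2 + 2 * M ^ 2))))
  obtain ⟨hKN, hK1, hKge⟩ := hK K le_rfl
  refine ⟨K, hK1, fun n hn => ?_⟩
  obtain ⟨⟨hq1, hq2⟩, hn1, hn2, hn3⟩ := hN n (hKN.trans hn)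
  have h2n : 2 ≤ n := by omega
  obtain ⟨hS1, hS2⟩ := quadVar_mem_of_quadForm_mem h2n hσ hα (hM n) hn1 hn2 hq1 hq2
  have p1 : 0 < 36 / (σ2 * α) := by positivity
  have p2 : (0 : ℝ) < 2 ^ (k + 1) / c ^ 2 := by positivity
  have p3 := sq_nonneg M
  refine ⟨le_trans ?_ hS1, by linarith, le_trans ?_ (le_A₁_of_le_abs hc.le hn3 (hx n)),
    (A₁_le_of_abs_le (hM n)).trans ?_, (bdrySq_le_of_abs_le h2n (hM n)).trans (by linarith)⟩
  · rw [← one_div_div 36 (σ2 * α)]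
    exact one_div_le_one_div_of_le p1 (by linarith)
  · rw [← one_div_div (2 ^ (k + 1)) (c ^ 2), one_div_mul_eq_div]
    exact div_le_div_of_nonneg_left (by positivity) p2 (by linarith)
  · gcongr
    linarith

section
variable {Ω : Type*} [MeasurableSpace Ω] {P : Measure Ω} {X : ℝ → Ω → ℝ} {σ2 α : ℝ}

theorem IsOUProcess.ae_exists_forall_boundedStats (hX : IsOUProcess X P σ2 α) (hσ : 0 < σ2)
    (hα : 0 < α) :
    ∀ᵐ ω ∂P, ∃ K : ℕ, 1 ≤ K ∧ ∀ n ≥ K, BoundedStats K n (obs X n ω) := by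
  filter_upwards [hX.ae_exists_bounds hσ hα, hX.ae_eventually_quadForm_mem hσ hα]
    with ω ⟨M, c, k, hc, hM, hx⟩ hq
  exact exists_forall_boundedStats hσ hα hc hM hx hq

/-- Almost surely, the statistics in the denominators are positive. -/
theorem IsOUProcess.ae_forall_pos (hX : IsOUProcess X P σ2 α) (hσ : 0 < σ2) (hα : 0 < α) :
    ∀ᵐ ω ∂P, ∀ n : ℕ, 3 ≤ n → 0 < quadVar n (obs X n ω) ∧ 0 < A₁ n (obs X n ω) := by
  rw [ae_all_iff]
  intro n
  by_cases hn : 3 ≤ n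
  · have hn0 : (n : ℝ) ≠ 0 := by exact_mod_cast (show n ≠ 0 by omega)
    have hg2 := grid_mem_Icc (i := 2) (n := n) (by omega)
    have hg1 := grid_mem_Icc (i := 1) (n := n) (by omega)
    have hne : ((2 : ℕ) : ℝ) / n ≠ ((1 : ℕ) : ℝ) / n := by
      intro h
      rw [div_left_inj' hn0] at h
      norm_num at h
    filter_upwards [hX.ae_ne_zero hσ hg2, hX.ae_sub_ne_zero hσ hα hg2 hg1 hne] with ω h1 h2 _
    constructor
    · obtain ⟨m, rfl⟩ := Nat.exists_eq_add_of_le' (show 1 ≤ n by omega)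
      rw [quadVar_eq_sum m (by omega)]
      refine Finset.sum_pos' (fun _ _ => sq_nonneg _) ⟨0, Finset.mem_range.2 (by omega), ?_⟩
      exact sq_pos_of_ne_zero h2
    · refine Finset.sum_pos' (fun _ _ => sq_nonneg _) ⟨2, Finset.mem_Icc.2 (by omega), ?_⟩
      exact sq_pos_of_ne_zero h1
  · exact Eventually.of_forall fun ω h => absurd h hn

theorem IsOUProcess.aemeasurable_obs (hX : IsOUProcess X P σ2 α) {n i : ℕ} (hi : i ≤ n) :
    AEMeasurable (fun ω => obs X n ω i) P :=
  hX.gaussian.aemeasurable ⟨_, grid_mem_Icc hi⟩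

theorem IsOUProcess.nullMeasurableSet_boundedStats (hX : IsOUProcess X P σ2 α) (K : ℝ) (n : ℕ) :
    NullMeasurableSet {ω | BoundedStats K n (obs X n ω)} P := by
  have m1 : AEMeasurable (fun ω => A₁ n (obs X n ω)) P :=
    Finset.aemeasurable_fun_sum _ fun i hi =>
      (hX.aemeasurable_obs (by rw [Finset.mem_Icc] at hi; omega)).pow_const 2
  have m2 : AEMeasurable (fun ω => A₂ n (obs X n ω)) P :=
    Finset.aemeasurable_fun_sum _ fun i hi =>
      (hX.aemeasurable_obs (by rw [Finset.mem_Icc] at hi; omega)).mul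
        (hX.aemeasurable_obs (by rw [Finset.mem_Icc] at hi; omega))
  have m3 : AEMeasurable (fun ω => A₃ n (obs X n ω)) P :=
    Finset.aemeasurable_fun_sum _ fun i hi =>
      (hX.aemeasurable_obs (by rw [Finset.mem_Icc] at hi; omega)).pow_const 2
  have mS : AEMeasurable (fun ω => quadVar n (obs X n ω)) P := by
    unfold quadVar
    exact (m1.sub (m2.const_mul 2)).add m3
  have mB : AEMeasurable (fun ω => bdrySq n (obs X n ω)) P := m3.sub m1
  have e : {ω | BoundedStats K n (obs X n ω)} = {ω | 1 / K ≤ quadVar n (obs X n ω)} ∩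
      ({ω | quadVar n (obs X n ω) ≤ K} ∩ ({ω | (n : ℝ) / K ≤ A₁ n (obs X n ω)} ∩
      ({ω | A₁ n (obs X n ω) ≤ K * n} ∩ {ω | bdrySq n (obs X n ω) ≤ K}))) := by
    ext ω
    exact ⟨fun h => ⟨h.1, h.2, h.3, h.4, h.5⟩, fun ⟨h1, h2, h3, h4, h5⟩ => ⟨h1, h2, h3, h4, h5⟩⟩
  rw [e]
  exact (nullMeasurableSet_le aemeasurable_const mS).inter
    ((nullMeasurableSet_le mS aemeasurable_const).inter
    ((nullMeasurableSet_le aemeasurable_const m1).inter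
    ((nullMeasurableSet_le m1 aemeasurable_const).inter
    (nullMeasurableSet_le mB aemeasurable_const))))

theorem IsOUProcess.eventuallyGood (hX : IsOUProcess X P σ2 α) (hσ : 0 < σ2) (hα : 0 < α) :
    EventuallyGood X P (σ2 * α) α := by
  have := hX.gaussian.isProbabilityMeasure
  set s : ℕ → Set Ω := fun j => {ω | ∀ n ≥ j + 1, BoundedStats (j + 1 : ℕ) n (obs X n ω)}ᶜ with hs
  have hanti : Antitone s := by
    intro i j hij
    refine compl_subset_compl.2 fun ω hω n hn => ?_
    have h1 : (1 : ℝ) ≤ (i + 1 : ℕ) := by push_cast; linarith [(Nat.cast_nonneg i : (0:ℝ) ≤ i)]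
    exact (hω n (by omega)).mono h1 (by exact_mod_cast Nat.succ_le_succ hij)
  have hmeas : ∀ j, NullMeasurableSet (s j) P := by
    intro j
    have e : {ω | ∀ n ≥ j + 1, BoundedStats (j + 1 : ℕ) n (obs X n ω)}
        = ⋂ n : ℕ, ⋂ _ : n ≥ j + 1, {ω | BoundedStats (j + 1 : ℕ) n (obs X n ω)} := by
      ext ω; simp
    refine NullMeasurableSet.compl ?_
    rw [e]
    exact NullMeasurableSet.iInter fun n => NullMeasurableSet.iInter fun _ =>
      hX.nullMeasurableSet_boundedStats _ n
  have hnull : P (⋂ j, s j) = 0 := by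
    refine measure_mono_null ?_ (hX.ae_exists_forall_boundedStats hσ hα)
    intro ω hω
    rintro ⟨K, hK1, hK⟩
    have h1 := mem_iInter.1 hω (K - 1)
    apply h1
    rw [Nat.sub_add_cancel hK1]
    exact hK
  have hlim1 : Tendsto (fun j => P (s j)) atTop (𝓝 0) := by
    rw [← hnull]
    exact tendsto_measure_iInter_atTop hmeas hanti ⟨0, measure_ne_top _ _⟩
  set C := Var[fun z => z ^ 2; gaussianReal 0 1] * (σ2 * α) ^ 2
  have hlim2 : Tendsto (fun j : ℕ => ENNReal.ofReal (C / ((j + 1 : ℕ) : ℝ) ^ 2)) atTop (𝓝 0) := by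
    rw [← ENNReal.ofReal_zero]
    refine ENNReal.tendsto_ofReal (Tendsto.const_div_atTop ?_ C)
    exact (tendsto_pow_atTop two_ne_zero).comp
      (tendsto_natCast_atTop_atTop.comp (tendsto_add_atTop_nat 1))
  intro δ hδ
  have hlim := hlim1.add hlim2
  rw [add_zero] at hlim
  obtain ⟨j, hj⟩ := (hlim.eventually_le_const hδ).exists
  have hj1 : (1 : ℝ) ≤ ((j + 1 : ℕ) : ℝ) := by push_cast; linarith [(Nat.cast_nonneg j : (0:ℝ) ≤ j)]
  refine ⟨((j + 1 : ℕ) : ℝ), hj1, ?_⟩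
  filter_upwards [eventually_ge_atTop (j + 1), eventually_ge_atTop 2] with n hn1 hn2
  refine le_trans (measure_mono (t := s j ∪ {ω | ((j + 1 : ℕ) : ℝ)
    ≤ |√(n : ℝ) * (thetaTilde n (obs X n ω) α - σ2 * α)|}) fun ω hω => ?_)
    ((measure_union_le _ _).trans ((add_le_add le_rfl (hX.measure_le_abs_thetaTilde_sub hσ hα
      (by linarith) (by omega))).trans hj))
  by_contra hcon
  rw [mem_union, not_or] at hcon
  obtain ⟨h1, h2⟩ := hcon
  rw [hs, notMem_compl_iff] at h1
  exact hω ⟨h1 n hn1, hn2, (not_le.1 h2).le⟩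

end

end OUBvM

theorem theorem3 {Ω : Type*} [MeasurableSpace Ω] (P : Measure Ω) [IsProbabilityMeasure P]
    (σ₀2 α₀ θ₀ : ℝ) (hσ₀ : 0 < σ₀2) (hα₀ : 0 < α₀) (hθ₀ : θ₀ = σ₀2 * α₀)
    (X : ℝ → Ω → ℝ) (hX : OUBvM.IsOUProcess X P σ₀2 α₀)
    (πc : ℝ → ℝ → ℝ) (πm : ℝ → ℝ)
    (h1 : OUBvM.RegularCondPrior θ₀ πc)
    (h2 : OUBvM.CondPriorGrowth θ₀ πc)
    (h3 : OUBvM.MarginalPriorTails θ₀ α₀ πc πm) :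
    -- the three distributions are well defined
    (∀ᵐ ω ∂P, ∀ n : ℕ, 3 ≤ n →
      IsProbabilityMeasure (OUBvM.posterior πc πm n (OUBvM.obs X n ω)) ∧
      IsProbabilityMeasure (OUBvM.profilePosterior θ₀ πc πm n (OUBvM.obs X n ω)) ∧
      IsProbabilityMeasure (OUBvM.tiltedNormalPosterior θ₀ πc πm n (OUBvM.obs X n ω))) ∧
    -- approximation by the normal distribution times the profile posterior
    TendstoInMeasure P
      (fun n ω => OUBvM.tvDist (OUBvM.posterior πc πm n (OUBvM.obs X n ω))
        ((OUBvM.thetaLimit θ₀ α₀ n (OUBvM.obs X n ω)).prod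
          (OUBvM.profilePosterior θ₀ πc πm n (OUBvM.obs X n ω))))
      atTop (fun _ => (0 : ℝ)) ∧
    -- approximation by the normal distribution times the polynomially tilted normal
    TendstoInMeasure P
      (fun n ω => OUBvM.tvDist (OUBvM.posterior πc πm n (OUBvM.obs X n ω))
        ((OUBvM.thetaLimit θ₀ α₀ n (OUBvM.obs X n ω)).prod
          (OUBvM.tiltedNormalPosterior θ₀ πc πm n (OUBvM.obs X n ω))))
      atTop (fun _ => (0 : ℝ)) ∧
    -- the scale is positive and of constant order
    (∀ᵐ ω ∂P, (∀ n : ℕ, 3 ≤ n → 0 < OUBvM.vStar n (OUBvM.obs X n ω)) ∧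
      (fun n : ℕ => OUBvM.vStar n (OUBvM.obs X n ω)) =Θ[atTop] (fun _ : ℕ => (1 : ℝ))) ∧
    -- the marginal posterior of the range parameter does not become degenerate
    (∀ a : Ω → ℝ, Measurable a →
      ¬ OUBvM.TendstoWeaklyInProb P
        (fun n ω => (OUBvM.posterior πc πm n (OUBvM.obs X n ω)).snd)
        (fun ω => Measure.dirac (a ω))) := by
  have hθ : 0 < θ₀ := by rw [hθ₀]; positivity
  have hgood : OUBvM.EventuallyGood X P θ₀ α₀ := by
    rw [hθ₀]; exact hX.eventuallyGood hσ₀ hα₀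
  refine ⟨?_, ?_, ?_, ?_, fun a _ =>
    OUBvM.not_tendstoWeaklyInProb_dirac hgood hθ hα₀ h1 h2 h3 a⟩
  · filter_upwards [hX.ae_forall_pos hσ₀ hα₀] with ω hω n hn
    obtain ⟨hS, hA⟩ := hω n hn
    have hn2 : 2 ≤ n := by omega
    exact ⟨OUBvM.isProbabilityMeasure_posterior hn2 hS hA hθ hα₀ h1 h3,
      OUBvM.isProbabilityMeasure_profilePosterior hn2 hS hA hθ hα₀ h1 h3,
      OUBvM.isProbabilityMeasure_tiltedNormalPosterior hn2 hS hA hθ hα₀ h1 h3⟩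
  · refine OUBvM.tendstoInMeasure_zero_of_eventuallyGood hgood
      (d := fun n x => OUBvM.tvDist (OUBvM.posterior πc πm n x)
        ((OUBvM.thetaLimit θ₀ α₀ n x).prod (OUBvM.profilePosterior θ₀ πc πm n x)))
      (fun n x => OUBvM.tvDist_nonneg _ _) fun K hK ε hε => ?_
    obtain ⟨N, hN⟩ := OUBvM.exists_forall_goodData_tvDist_lt hK hθ hα₀ h1 h2 h3 hε
    exact ⟨N, fun n hn x hx => (hN n hn x hx).1⟩
  · refine OUBvM.tendstoInMeasure_zero_of_eventuallyGood hgood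
      (d := fun n x => OUBvM.tvDist (OUBvM.posterior πc πm n x)
        ((OUBvM.thetaLimit θ₀ α₀ n x).prod (OUBvM.tiltedNormalPosterior θ₀ πc πm n x)))
      (fun n x => OUBvM.tvDist_nonneg _ _) fun K hK ε hε => ?_
    obtain ⟨N, hN⟩ := OUBvM.exists_forall_goodData_tvDist_lt hK hθ hα₀ h1 h2 h3 hε
    exact ⟨N, fun n hn x hx => (hN n hn x hx).2⟩
  · filter_upwards [hX.ae_forall_pos hσ₀ hα₀, hX.ae_exists_forall_boundedStats hσ₀ hα₀]
      with ω hω ⟨K, hK1, hK⟩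
    have hpos : ∀ n : ℕ, 3 ≤ n → 0 < OUBvM.vStar n (OUBvM.obs X n ω) := by
      intro n hn
      obtain ⟨hS, hA⟩ := hω n hn
      have hn0 : (0 : ℝ) < n := by exact_mod_cast (by omega : 0 < n)
      rw [OUBvM.vStar_eq]
      positivity
    refine ⟨hpos, Asymptotics.IsBigO.of_bound ((K : ℝ) ^ 2) ?_,
      Asymptotics.IsBigO.of_bound ((K : ℝ) ^ 2) ?_⟩
    all_goals
      filter_upwards [eventually_ge_atTop K, eventually_ge_atTop 3] with n hn hn3
      have hb := hK n hn
      have hK1' : (1 : ℝ) ≤ K := by exact_mod_cast hK1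
      have hn0 : (0 : ℝ) < n := by exact_mod_cast (by omega : 0 < n)
      have hw := hb.invScale_mem hK1' (by omega)
      have hS := hb.quadVar_pos hK1'
      have hA := hb.A₁_pos hK1' (by omega)
      have e : OUBvM.vStar n (OUBvM.obs X n ω)
          = 1 / OUBvM.invScale n (OUBvM.obs X n ω) := by
        rw [OUBvM.vStar_eq, OUBvM.invScale, one_div_div]
      have hw0 : 0 < OUBvM.invScale n (OUBvM.obs X n ω) := lt_of_lt_of_le (by positivity) hw.1
      simp only [Real.norm_eq_abs, abs_of_pos (hpos n hn3), abs_one, mul_one]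
      rw [e]
    · rw [div_le_iff₀ hw0]
      have := hw.1
      rw [div_le_iff₀ (by positivity)] at this
      linarith
    · rw [mul_one_div, le_div_iff₀ hw0]
      linarith [hw.2]
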